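/- Let $(M,\omega,\nabla)$ be a Fedosov manifold: $M$ is a smooth manifold, $\omega$ a symplectic form on $M$, and $\nabla$ a smooth torsion-free affine connection on $M$ with $\nabla\omega=0$. Let $R(X,Y)Z=\nabla_X\nabla_YZ-\nabla_Y\nabla_XZ-\nabla_{[X,Y]}Z$ be its curvature. Let $x\in M$ and $X_x\in T_xM$, let $\gamma:(-\varepsilon,\varepsilon)\to M$ be the geodesic with $\gamma(0)=x$, $\dot\gamma(0)=X_x$, and put $X=\dot\gamma$. Along $\gamma$ let $\Pi$ be the field of endomorphisms $\Pi(Y)=R(X,Y)X$, and let $\nabla_X$ denote the covariant derivative along $\gamma$. For integers $r\ge 2$ define recursively the fields of endomorphisms along $\gamma$ $$Q^r=(r-1)\,\nabla_X^{r-2}\Pi+\sum_{q=2}^{r-2}\binom{r-1}{q+1}\,(\nabla_X^{r-2-q}\Pi)\circ Q^q$$ (the sum is $0$ for $r=2,3$, so $Q^2=\Pi$), and for odd $r\ge 3$ $$P^r=(r+2)\,Q^r+\sum_{q=2}^{(r-1)/2}\binom{r+2}{q+1}\,(Q^q)^\top\circ Q^{r-q},$$ where $A^\top$ is the symplectic adjoint,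 $\omega(u,Av)=\omega(A^\top u,v)$. Let $P^r_x$ be the value of $P^r$ at $\gamma(0)=x$; it depends only on $r$ and $X_x$. A symmetric normal neighbourhood of $x$ is an open set $U\ni x$ that is the diffeomorphic image under $\exp_x$ of an open star-shaped neighbourhood $V=-V$ of $0$ in $T_xM$; on it the geodesic symmetry is $s_x(\exp_xv)=\exp_x(-v)$, $v\in V$. We say that $\omega$ is locally invariant under $s_x$ if $s_x^\star\omega=\omega$ on some symmetric normal neighbourhood of $x$. We say that $\nabla$ is analytic at $x$ if in some smooth chart around $x$ its Christoffel symbols are real-analytic near $x$. Then, for every point $x\in M$: (i) If $\omega$ is locally invariant under $s_x$, then for every $r=3,5,7,\dots$ and every $X_x\in T_xM$ the endomorphism $P^r_x$ belongs to $\mathfrak{sp}(T_xM,\omega_x)$. (In particular, if this invariance holds at every point of $M$, then so does the conclusion.) (ii) Conversely, if $\nabla$ is analytic at $x$ and $P^r_x\in\mathfrak{sp}(T_xM,\omega_x)$ for every $r=3,5,7,\dots$ and every $X_x\in T_xM$, then $\omega$ is locally invariant under $s_x$. -/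

import Mathlib

open Bundle Set Filter
open scoped Manifold ContDiff Topology

noncomputable section

namespace Fedosov

/-! Throughout, a manifold is a Hausdorff space `M` with a `C^∞` structure modelled on a
finite-dimensional real vector space `E` (no boundary).  An affine connection on `M` is a
`CovariantDerivative` on the tangent bundle; `cov Y x u` is `(∇_u Y)(x)`. -/

section Basics

variable {E : Type*} [NormedAddCommGroup E] [NormedSpace ℝ E]
  {M : Type*} [TopologicalSpace M] [ChartedSpace E M]

/-- The tangent space of `M` at `x`. -/
abbrev Tan (E : Type*) [NormedAddCommGroup E] [NormedSpace ℝ E]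
    {M : Type*} [TopologicalSpace M] [ChartedSpace E M] (x : M) : Type _ :=
  TangentSpace 𝓘(ℝ, E) x

/-- Affine connections on `M` (not yet assumed to be smooth or torsion-free). -/
abbrev Connection (E : Type*) [NormedAddCommGroup E] [NormedSpace ℝ E]
    (M : Type*) [TopologicalSpace M] [ChartedSpace E M] [IsManifold 𝓘(ℝ, E) ∞ M] : Type _ :=
  CovariantDerivative 𝓘(ℝ, E) E (TangentSpace 𝓘(ℝ, E) : M → Type _)

instance (x : M) : T2Space (Tan E x) := inferInstanceAs (T2Space E)

instance [FiniteDimensional ℝ E] (x : M) : FiniteDimensional ℝ (Tan E x) :=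
  inferInstanceAs (FiniteDimensional ℝ E)

/-- The vector field `X` is differentiable at `x`, as a section of the tangent bundle. -/
def DiffFieldAt [IsManifold 𝓘(ℝ, E) ∞ M] (X : Π y : M, Tan E y) (x : M) : Prop :=
  MDifferentiableAt 𝓘(ℝ, E) (𝓘(ℝ, E).prod 𝓘(ℝ, E))
    (fun y ↦ (⟨y, X y⟩ : TangentBundle 𝓘(ℝ, E) M)) x

variable (E M) in
/-- A symplectic form on `M`: a smooth field of skew-symmetric nondegenerate bilinear forms on the
tangent spaces which is closed.  Closedness is expressed by the intrinsic formula for `dω`. -/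
structure SymplecticForm [IsManifold 𝓘(ℝ, E) ∞ M] where
  form : Π x : M, Tan E x →L[ℝ] Tan E x →L[ℝ] ℝ
  smooth : ContMDiff 𝓘(ℝ, E) (𝓘(ℝ, E).prod 𝓘(ℝ, E →L[ℝ] E →L[ℝ] ℝ)) ∞
    (fun x ↦ TotalSpace.mk' (E →L[ℝ] E →L[ℝ] ℝ)
      (E := fun x : M ↦ Tan E x →L[ℝ] Tan E x →L[ℝ] ℝ) x (form x))
  alternating : ∀ (x : M) (u : Tan E x), form x u u = 0
  nondegenerate : ∀ (x : M) (u : Tan E x), (∀ v, form x u v = 0) → u = 0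
  closed : ∀ (x : M) (X Y Z : Π y : M, Tan E y),
    DiffFieldAt X x → DiffFieldAt Y x → DiffFieldAt Z x →
      mvfderiv 𝓘(ℝ, E) (fun y ↦ form y (Y y) (Z y)) x (X x)
        + mvfderiv 𝓘(ℝ, E) (fun y ↦ form y (Z y) (X y)) x (Y x)
        + mvfderiv 𝓘(ℝ, E) (fun y ↦ form y (X y) (Y y)) x (Z x)
        - form x (VectorField.mlieBracket 𝓘(ℝ, E) X Y x) (Z x)
        - form x (VectorField.mlieBracket 𝓘(ℝ, E) Y Z x) (X x)
        - form x (VectorField.mlieBracket 𝓘(ℝ, E) Z X x) (Y x) = 0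

/-- `∇` is a symplectic connection for `ω`: it is torsion-free and `∇ω = 0`. -/
structure IsSymplecticConnection [FiniteDimensional ℝ E]
    [IsManifold 𝓘(ℝ, E) ∞ M]
    (Ω : SymplecticForm E M) (cov : Connection E M) : Prop where
  torsion_free : haveI : CompleteSpace E := FiniteDimensional.complete ℝ E
    cov.torsion = 0
  parallel : ∀ (x : M) (X Y : Π y : M, Tan E y), DiffFieldAt X x → DiffFieldAt Y x →
    ∀ u : Tan E x, mvfderiv 𝓘(ℝ, E) (fun y ↦ Ω.form y (X y) (Y y)) x u
      = Ω.form x (cov X x u) (Y x) + Ω.form x (X x) (cov Y x u)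

/-- `ω_x` as a bilinear form on the vector space `T_x M`. -/
def SymplecticForm.bilin [IsManifold 𝓘(ℝ, E) ∞ M]
    (Ω : SymplecticForm E M) (x : M) : LinearMap.BilinForm ℝ (Tan E x) :=
  LinearMap.mk₂ ℝ (fun u v ↦ Ω.form x u v) (by simp) (by simp) (by simp) (by simp)

theorem SymplecticForm.form_swap [IsManifold 𝓘(ℝ, E) ∞ M]
    (Ω : SymplecticForm E M) (x : M) (u v : Tan E x) :
    Ω.form x u v = -Ω.form x v u := by
  have h := Ω.alternating x (u + v)
  have hu := Ω.alternating x u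
  have hv := Ω.alternating x v
  simp only [map_add, add_apply] at h
  linarith

theorem SymplecticForm.bilin_nondegenerate [IsManifold 𝓘(ℝ, E) ∞ M]
    (Ω : SymplecticForm E M) (x : M) :
    (Ω.bilin x).Nondegenerate := by
  refine ⟨fun u hu ↦ Ω.nondegenerate x u hu, fun u hu ↦ Ω.nondegenerate x u fun v ↦ ?_⟩
  rw [Ω.form_swap, neg_eq_zero]
  exact hu v

end Basics

section Curvature

variable {E : Type*} [NormedAddCommGroup E] [NormedSpace ℝ E] [FiniteDimensional ℝ E]
  {M : Type*} [TopologicalSpace M] [T2Space M] [ChartedSpace E M] [IsManifold 𝓘(ℝ, E) ∞ M]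

/-- The curvature expression `(∇_X ∇_Y Z - ∇_Y ∇_X Z - ∇_[X,Y] Z)(x)` for vector fields. -/
def curvatureField (cov : Connection E M) (X Y Z : Π y : M, Tan E y) (x : M) : Tan E x :=
  cov (fun y ↦ cov Z y (Y y)) x (X x) - cov (fun y ↦ cov Z y (X y)) x (Y x)
    - cov Z x (VectorField.mlieBracket 𝓘(ℝ, E) X Y x)

/-- If `σ` is smooth near `x` then so is `∇σ`; in particular `∇σ` is differentiable at `x`. -/
theorem mdifferentiableAt_cov (cov : Connection E M) [CovariantDerivative.ContMDiffCovariantDerivative cov ∞]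
    {σ : Π y : M, Tan E y} {x : M} {s : Set M} (hs : s ∈ 𝓝 x)
    (hσ : ContMDiffOn 𝓘(ℝ, E) (𝓘(ℝ, E).prod 𝓘(ℝ, E)) ∞
      (fun y ↦ (⟨y, σ y⟩ : TangentBundle 𝓘(ℝ, E) M)) s) :
    MDifferentiableAt 𝓘(ℝ, E) (𝓘(ℝ, E).prod 𝓘(ℝ, E →L[ℝ] E))
      (fun y ↦ (⟨y, cov σ y⟩ :
        TotalSpace (E →L[ℝ] E) fun y : M ↦ Tan E y →L[ℝ] Tan E y)) x := by
  obtain ⟨u, hus, huo, hxu⟩ := mem_nhds_iff.1 hs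
  obtain ⟨f, hf, hfu⟩ := (SmoothBumpFunction.nhds_basis_tsupport (I := 𝓘(ℝ, E)) x).mem_iff.1
    (huo.mem_nhds hxu)
  have h1 : ContMDiff 𝓘(ℝ, E) (𝓘(ℝ, E).prod 𝓘(ℝ, E)) ∞
      (fun y ↦ (⟨y, ((f : M → ℝ) • σ) y⟩ : TangentBundle 𝓘(ℝ, E) M)) :=
    ContMDiffOn.smul_section_of_tsupport f.contMDiff.contMDiffOn huo hfu (hσ.mono hus)
  have h2 := (CovariantDerivative.ContMDiffCovariantDerivative.contMDiff (cov := cov) (k := ∞)).contMDiff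
    (σ := (f : M → ℝ) • σ) h1.contMDiffOn
  have h3 := (h2.contMDiffAt univ_mem (x := x)).mdifferentiableAt (by simp)
  refine h3.congr_of_eventuallyEq ?_
  have hev : ∀ᶠ y in 𝓝 x, ∀ᶠ z in 𝓝 y, f z = 1 :=
    eventually_eventually_nhds.2 f.eventuallyEq_one
  filter_upwards [hev, huo.mem_nhds hxu] with y hy hyu
  congr 1
  have hσy : DiffFieldAt σ y :=
    (((hσ.mono hus).contMDiffAt (huo.mem_nhds hyu))).mdifferentiableAt (by simp)
  refine cov.isCovariantDerivativeOnUniv.congr_of_eventuallyEq hσy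
    (h1.contMDiffAt.mdifferentiableAt (by simp)) univ_mem ?_
  filter_upwards [hy] with z hz
  simp [hz]

/-- For vector fields `X`, `Z` that are smooth near `x`, the curvature expression is tensorial in
the middle argument. -/
theorem curvatureField_tensorialAt (cov : Connection E M) [CovariantDerivative.ContMDiffCovariantDerivative cov ∞]
    (x : M) (u w : Tan E x) :
    TensorialAt 𝓘(ℝ, E) E (fun Y : Π y : M, Tan E y ↦
      curvatureField cov (FiberBundle.extend E u) Y (FiberBundle.extend E w) x) x := by
  have : CompleteSpace E := FiniteDimensional.complete ℝ E
  obtain ⟨s, hs, hsw⟩ := FiberBundle.exists_contMDiffOn_extend (k := ∞) 𝓘(ℝ, E) E w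
  have hcov := mdifferentiableAt_cov cov hs hsw
  constructor
  · intro f Y hf hY
    have h1 := hcov.clm_bundle_apply hY
    have h2 : (fun y ↦ cov (FiberBundle.extend E w) y ((f • Y) y))
        = f • (fun y ↦ cov (FiberBundle.extend E w) y (Y y)) := by
      ext y; simp
    simp only [curvatureField, h2]
    rw [cov.isCovariantDerivativeOnUniv.leibniz h1 hf,
      VectorField.mlieBracket_smul_right hf hY]
    simp
    module
  · intro Y Y' hY hY'
    have h1 := hcov.clm_bundle_apply hY
    have h1' := hcov.clm_bundle_apply hY'
    have h2 : (fun y ↦ cov (FiberBundle.extend E w) y ((Y + Y') y))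
        = (fun y ↦ cov (FiberBundle.extend E w) y (Y y))
          + (fun y ↦ cov (FiberBundle.extend E w) y (Y' y)) := by
      ext y; simp
    simp only [curvatureField, h2]
    rw [cov.isCovariantDerivativeOnUniv.add h1 h1',
      VectorField.mlieBracket_add_right hY hY']
    simp
    module

/-- The curvature endomorphism `v ↦ R(u, v) w` of `T_x M`, where
`R(X, Y) Z = ∇_X ∇_Y Z - ∇_Y ∇_X Z - ∇_[X,Y] Z` for local vector fields extending `u, v, w`
(the value does not depend on the extensions). -/
def curvature (cov : Connection E M) [CovariantDerivative.ContMDiffCovariantDerivative cov ∞]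
    (x : M) (u w : Tan E x) : Tan E x →L[ℝ] Tan E x :=
  TensorialAt.mkHom (fun Y : Π y : M, Tan E y ↦
      curvatureField cov (FiberBundle.extend E u) Y (FiberBundle.extend E w) x) x
    (curvatureField_tensorialAt cov x u w)

end Curvature

section Geodesics

variable {E : Type*} [NormedAddCommGroup E] [NormedSpace ℝ E] [FiniteDimensional ℝ E]
  {M : Type*} [TopologicalSpace M] [ChartedSpace E M] [IsManifold 𝓘(ℝ, E) ∞ M]

/-- The coordinate vector field of the chart `e` with constant components `v`. -/
def coordField (e : OpenPartialHomeomorph M E) (v : E) (y : M) : Tan E y :=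
  (mvfderiv 𝓘(ℝ, E) e y).inverse v

/-- The connection form of `∇` in the chart `e` at `y`: the endomorphism of `E` that sends the
components `v` to the components of `∇_u ∂_v`, where `∂_v` is the coordinate vector field with
components `v`.  It is given on a basis of `E` (by the Christoffel symbols) and extended linearly. -/
def connectionForm (cov : Connection E M) (e : OpenPartialHomeomorph M E) (y : M) (u : Tan E y) :
    E →L[ℝ] E :=
  LinearMap.toContinuousLinearMap ((Module.finBasis ℝ E).constr ℝ fun i ↦
    mvfderiv 𝓘(ℝ, E) e y (cov (coordField e (Module.finBasis ℝ E i)) y u))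

/-- The connection is real-analytic at `x`: in some smooth chart around `x` its
Christoffel symbols are real-analytic functions near `x`. -/
def IsAnalyticAt (cov : Connection E M) (x : M) : Prop :=
  ∃ e ∈ IsManifold.maximalAtlas 𝓘(ℝ, E) ∞ M, x ∈ e.source ∧
    ∀ v : E, AnalyticAt ℝ
      (fun z : E ↦ connectionForm cov e (e.symm z) (coordField e v (e.symm z))) (e x)

/-- The velocity of a curve. -/
def velocity (γ : ℝ → M) (t : ℝ) : Tan E (γ t) :=
  mfderiv 𝓘(ℝ, ℝ) 𝓘(ℝ, E) γ t (1 : ℝ)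

/-- The covariant derivative along `γ` of a vector field `V` along `γ`, computed in the
preferred chart at `γ t`. -/
def covDerivAlong (cov : Connection E M) (γ : ℝ → M) (V : Π t : ℝ, Tan E (γ t)) (t : ℝ) :
    Tan E (γ t) :=
  let e := chartAt E (γ t)
  (mvfderiv 𝓘(ℝ, E) e (γ t)).inverse
    (deriv (fun s ↦ mvfderiv 𝓘(ℝ, E) e (γ s) (V s)) t
      + connectionForm cov e (γ t) (velocity γ t) (mvfderiv 𝓘(ℝ, E) e (γ t) (V t)))

/-- The covariant derivative along `γ` of a field `A` of endomorphisms along `γ`, computed in the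
preferred chart at `γ t`.  It is characterised by `(∇A) V = ∇(A V) - A (∇V)`. -/
def covDerivEndAlong (cov : Connection E M) (γ : ℝ → M)
    (A : Π t : ℝ, Tan E (γ t) →L[ℝ] Tan E (γ t)) (t : ℝ) : Tan E (γ t) →L[ℝ] Tan E (γ t) :=
  let e := chartAt E (γ t)
  let L := mvfderiv 𝓘(ℝ, E) e (γ t)
  let Γ := connectionForm cov e (γ t) (velocity γ t)
  let B : ℝ → E →L[ℝ] E := fun s ↦
    mvfderiv 𝓘(ℝ, E) e (γ s) ∘L A s ∘L (mvfderiv 𝓘(ℝ, E) e (γ s)).inverse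
  L.inverse ∘L (deriv B t + Γ ∘L B t - B t ∘L Γ) ∘L L

/-- `γ` is a (smooth) geodesic on the open set `s` of times. -/
def IsGeodesicOn (cov : Connection E M) (γ : ℝ → M) (s : Set ℝ) : Prop :=
  IsOpen s ∧ ContMDiffOn 𝓘(ℝ, ℝ) 𝓘(ℝ, E) ∞ γ s ∧
    ∀ t ∈ s, covDerivAlong cov γ (velocity γ) t = 0

/-- `γ` passes through `x` at time `0` with velocity `X`. -/
def HasInitialVelocity (γ : ℝ → M) (x : M) (X : Tan E x) : Prop :=
  (⟨γ 0, velocity γ 0⟩ : TangentBundle 𝓘(ℝ, E) M) = ⟨x, X⟩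

/-- `y = exp_x X`: there is a geodesic, defined on an open interval containing `[0, 1]`, which
starts at `x` with velocity `X` and is at `y` at time `1`.  (For Hausdorff `M` there is at most
one such `y`.) -/
def IsExp (cov : Connection E M) (x : M) (X : Tan E x) (y : M) : Prop :=
  ∃ (γ : ℝ → M) (a b : ℝ), a < 0 ∧ 1 < b ∧ IsGeodesicOn cov γ (Ioo a b) ∧
    HasInitialVelocity γ x X ∧ γ 1 = y

/-- A symmetric normal neighbourhood of `x`: an open set `target` of `M` which is the
diffeomorphic image under `exp_x` of an open star-shaped neighbourhood `source = -source` of `0`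
in `T_x M` (which as a vector space is `E`). -/
structure SymmetricNormalNhd (cov : Connection E M) (x : M) extends
    OpenPartialHomeomorph E M where
  zero_mem : (0 : E) ∈ source
  starConvex : StarConvex ℝ (0 : E) source
  neg_mem : ∀ v ∈ source, -v ∈ source
  isExp : ∀ v ∈ source, IsExp cov x (v : E) (toFun v)
  contMDiffOn : ContMDiffOn 𝓘(ℝ, E) 𝓘(ℝ, E) ∞ toFun source
  contMDiffOn_symm : ContMDiffOn 𝓘(ℝ, E) 𝓘(ℝ, E) ∞ invFun target

/-- The geodesic symmetry `exp_x X ↦ exp_x (-X)` on a symmetric normal neighbourhood of `x`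
(it is only meaningful on `N.target`). -/
def geodesicSymmetry {cov : Connection E M} {x : M} (N : SymmetricNormalNhd cov x) (y : M) : M :=
  N.toFun (-N.invFun y)

/-- Locally around `x`, `s_x^* ω = ω`: there is a symmetric normal neighbourhood of `x` on which
the geodesic symmetry `s_x` preserves `ω`. -/
def SymmetryPreserves (Ω : SymplecticForm E M) (cov : Connection E M) (x : M) : Prop :=
  ∃ N : SymmetricNormalNhd cov x, ∀ y ∈ N.target, ∀ u v : Tan E y,
    Ω.form (geodesicSymmetry N y)
      (mfderiv 𝓘(ℝ, E) 𝓘(ℝ, E) (geodesicSymmetry N) y u)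
      (mfderiv 𝓘(ℝ, E) 𝓘(ℝ, E) (geodesicSymmetry N) y v) = Ω.form y u v

end Geodesics

section Recursion

/-- The recursion
`Q^r = (r-1) D_{r-2} + ∑_{q=2}^{r-2} (r-1 choose q+1) D_{r-2-q} ∘ Q^q` for `r ≥ 2`,
where `D k` stands for `∇_X^k Π`.  In particular `Q^2 = D 0`. -/
def recQ {V : Type*} [AddCommGroup V] [Module ℝ V] (D : ℕ → Module.End ℝ V) (r : ℕ) :
    Module.End ℝ V :=
  (r - 1) • D (r - 2)
    + ∑ q : {q // q ∈ Finset.Icc 2 (r - 2)},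
        ((r - 1).choose (q.1 + 1)) • (D (r - 2 - q.1) ∘ₗ recQ D q.1)
termination_by r
decreasing_by
  have h := Finset.mem_Icc.1 q.2
  omega

theorem recQ_eq {V : Type*} [AddCommGroup V] [Module ℝ V] (D : ℕ → Module.End ℝ V) (r : ℕ) :
    recQ D r = (r - 1) • D (r - 2)
      + ∑ q ∈ Finset.Icc 2 (r - 2), ((r - 1).choose (q + 1)) • (D (r - 2 - q) ∘ₗ recQ D q) := by
  rw [recQ, ← Finset.sum_coe_sort (Finset.Icc 2 (r - 2))]

/-- `P^r = (r+2) Q^r + ∑_{q=2}^{(r-1)/2} (r+2 choose q+1) (Q^q)^⊤ ∘ Q^{r-q}`, where `⊤` is the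
adjoint for the nondegenerate form `B`, that is `B u (A v) = B (A^⊤ u) v`. -/
def recP {V : Type*} [AddCommGroup V] [Module ℝ V] [FiniteDimensional ℝ V]
    (B : LinearMap.BilinForm ℝ V) (hB : B.Nondegenerate) (D : ℕ → Module.End ℝ V) (r : ℕ) :
    Module.End ℝ V :=
  (r + 2) • recQ D r
    + ∑ q ∈ Finset.Icc 2 ((r - 1) / 2), ((r + 2).choose (q + 1)) •
        (B.leftAdjointOfNondegenerate hB (recQ D q) ∘ₗ recQ D (r - q))

end Recursion

section Conditions

variable {E : Type*} [NormedAddCommGroup E] [NormedSpace ℝ E] [FiniteDimensional ℝ E]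
  {M : Type*} [TopologicalSpace M] [T2Space M] [ChartedSpace E M] [IsManifold 𝓘(ℝ, E) ∞ M]

/-- The fields `∇_X^k Π` along the curve `γ`, where `X` is the velocity of `γ`,
`Π(Y) = R(X, Y) X`, and `∇_X` is the covariant derivative along `γ`. -/
def iterPi (cov : Connection E M) [CovariantDerivative.ContMDiffCovariantDerivative cov ∞] (γ : ℝ → M) (k : ℕ) :
    Π t : ℝ, Tan E (γ t) →L[ℝ] Tan E (γ t) :=
  (covDerivEndAlong cov γ)^[k] fun t ↦ curvature cov (γ t) (velocity γ t) (velocity γ t)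

/-- The fields of endomorphisms `P^r` along `γ`. -/
def fieldP (Ω : SymplecticForm E M) (cov : Connection E M) [CovariantDerivative.ContMDiffCovariantDerivative cov ∞]
    (γ : ℝ → M) (r : ℕ) (t : ℝ) : Module.End ℝ (Tan E (γ t)) :=
  recP (Ω.bilin (γ t)) (Ω.bilin_nondegenerate (γ t))
    (fun k ↦ (iterPi cov γ k t).toLinearMap) r

/-- For every `X ∈ T_x M`, the endomorphism `P^r_x` lies in `sp(T_x M, ω_x)`.  Here `X` is extended
to the velocity field of the geodesic with initial velocity `X`. -/
def ConditionP (Ω : SymplecticForm E M) (cov : Connection E M)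
    [CovariantDerivative.ContMDiffCovariantDerivative cov ∞] (r : ℕ) (x : M) : Prop :=
  ∀ (X : Tan E x) (γ : ℝ → M) (ε : ℝ), 0 < ε → IsGeodesicOn cov γ (Ioo (-ε) ε) →
    HasInitialVelocity γ x X →
      fieldP Ω cov γ r 0 ∈ skewAdjointLieSubalgebra (Ω.bilin (γ 0))

end Conditions

end Fedosov

end

noncomputable section

/-! Fix `X` in `T_x M` and let `γ` be the radial geodesic `t ↦ exp_x(tX)`. For `Y` in `T_x M` the
field `J_Y(t) = t · d(exp_x)_{tX} Y` is the variation field of the geodesics `t ↦ exp_x(t(X + sY))`.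
Hence it is a Jacobi field, `∇²J = R(X,J)X = Π J`, with `J(0) = 0` and `∇J(0) = Y` (`radial_jacobi`,
`radial_jacobi_initial`). Differentiating the Jacobi equation repeatedly by Leibniz and evaluating
at `0` gives `∇²J(0) = 0` and exactly the recursion for `Q`: `∇^{r+1}J(0) = Q^r Y`
(`eq_recQ_of_recursion`).

Since `ω` is parallel, the derivatives at `0` of `φ(t) = ω(J_Y, J_Z) = t² (exp_x^* ω)_{tX}(Y,Z)` are
binomial sums of the numbers `ω(∇^p J_Y(0), ∇^q J_Z(0))`. In odd order `r + 2` these terms pair off,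
and the sum is `ω(P^r Y, Z) + ω(Y, P^r Z)` (`recP_symm_eq_sum`). So `P^r_x` lies in `sp` iff all
derivatives of order `r + 2` of the functions `φ` vanish at `0` (`fieldP_mem_iff_iteratedDeriv`).
The derivatives of order 1 and 3 vanish in any case.

In normal coordinates the geodesic symmetry is `v ↦ -v`, whose differential contributes two signs
that cancel in a bilinear form. Thus invariance of `ω` says that `exp_x^* ω` has the same
coefficients at `v` and `-v` (`symmetry_preserves_iff`). This makes every `φ` even near `0`, so its
odd derivatives vanish: this is (i).

For (ii), an analytic `φ` whose odd derivatives vanish at `0` is even on the whole connected set of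
admissible times, in particular at `t = 1` (`even_of_odd_iteratedDeriv`). Two facts make `φ`
analytic when the Christoffel symbols are. The exponential map is analytic, by the implicit function
theorem for the integrated geodesic equation in `C([0,1], E)` (`exists_analytic_exp`). The form is
analytic because a parallel form solves a linear total differential equation with analytic
coefficients (`analyticAt_parallel_form`).

All computations take place in a chart. The passage between intrinsic objects and their components
is made by `comps_cov`, `comps_curvature`, `endRep_iterPi` and `fieldP_mem_iff`. -/

namespace Fedosov

set_option maxSynthPendingDepth 3
set_option maxHeartbeats 400000

/-! ### Covariant differentiation along a curve in coordinates, and iterated Leibniz rules -/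

section CurveCalculus

variable {E : Type*} [NormedAddCommGroup E] [NormedSpace ℝ E]
  {F : Type*} [NormedAddCommGroup F] [NormedSpace ℝ F]

/-- Covariant derivative of a vector-valued function of time for the connection matrix `A`. -/
def covCurve (A : ℝ → E →L[ℝ] E) (V : ℝ → E) (t : ℝ) : E := deriv V t + A t (V t)

/-- Covariant derivative of an endomorphism-valued function of time. -/
def covCurveEnd (A B : ℝ → E →L[ℝ] E) (t : ℝ) : E →L[ℝ] E :=
  deriv B t + A t ∘L B t - B t ∘L A t

theorem contDiffOn_deriv {I : Set ℝ} (hI : IsOpen I) {V : ℝ → F} (hV : ContDiffOn ℝ ∞ V I) :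
    ContDiffOn ℝ ∞ (deriv V) I :=
  ((contDiffOn_infty_iff_deriv_of_isOpen hI).1 hV).2

theorem eqOn_deriv {I : Set ℝ} (hI : IsOpen I) {V W : ℝ → F} (h : EqOn V W I) :
    EqOn (deriv V) (deriv W) I := fun _ ht ↦
  (h.eventuallyEq_of_mem (hI.mem_nhds ht)).deriv_eq

theorem differentiableAt_of_contDiffOn {I : Set ℝ} (hI : IsOpen I) {V : ℝ → F}
    (hV : ContDiffOn ℝ ∞ V I) {t : ℝ} (ht : t ∈ I) : DifferentiableAt ℝ V t :=
  (hV.contDiffAt (hI.mem_nhds ht)).differentiableAt (by simp)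

section

variable {A : ℝ → E →L[ℝ] E} {I : Set ℝ}

theorem contDiffOn_covCurve (hI : IsOpen I) (hA : ContDiffOn ℝ ∞ A I) {V : ℝ → E}
    (hV : ContDiffOn ℝ ∞ V I) : ContDiffOn ℝ ∞ (covCurve A V) I :=
  (contDiffOn_deriv hI hV).add (hA.clm_apply hV)

theorem contDiffOn_covCurveEnd (hI : IsOpen I) (hA : ContDiffOn ℝ ∞ A I) {B : ℝ → E →L[ℝ] E}
    (hB : ContDiffOn ℝ ∞ B I) : ContDiffOn ℝ ∞ (covCurveEnd A B) I :=
  ((contDiffOn_deriv hI hB).add (hA.clm_comp hB)).sub (hB.clm_comp hA)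

theorem contDiffOn_covCurveEnd_iterate (hI : IsOpen I) (hA : ContDiffOn ℝ ∞ A I)
    {B : ℝ → E →L[ℝ] E} (hB : ContDiffOn ℝ ∞ B I) (n : ℕ) :
    ContDiffOn ℝ ∞ ((covCurveEnd A)^[n] B) I := by
  induction n with
  | zero => exact hB
  | succ n ih =>
    rw [Function.iterate_succ_apply']
    exact contDiffOn_covCurveEnd hI hA ih

theorem covCurve_eqOn (hI : IsOpen I) {V W : ℝ → E} (h : EqOn V W I) :
    EqOn (covCurve A V) (covCurve A W) I := fun t ht ↦ by
  simp only [covCurve, eqOn_deriv hI h ht, h ht]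

theorem covCurveEnd_eqOn (hI : IsOpen I) {B C : ℝ → E →L[ℝ] E} (h : EqOn B C I) :
    EqOn (covCurveEnd A B) (covCurveEnd A C) I := fun t ht ↦ by
  simp only [covCurveEnd, eqOn_deriv hI h ht, h ht]

theorem covCurve_add (hI : IsOpen I) {V W : ℝ → E} (hV : ContDiffOn ℝ ∞ V I)
    (hW : ContDiffOn ℝ ∞ W I) : EqOn (covCurve A (V + W)) (covCurve A V + covCurve A W) I := by
  intro t ht
  simp only [covCurve, Pi.add_apply, map_add]
  rw [deriv_add (differentiableAt_of_contDiffOn hI hV ht) (differentiableAt_of_contDiffOn hI hW ht)]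
  abel

theorem covCurve_clm_apply (hI : IsOpen I) {B : ℝ → E →L[ℝ] E} {V : ℝ → E}
    (hB : ContDiffOn ℝ ∞ B I) (hV : ContDiffOn ℝ ∞ V I) :
    EqOn (covCurve A (fun t ↦ B t (V t)))
      (fun t ↦ covCurveEnd A B t (V t) + B t (covCurve A V t)) I := by
  intro t ht
  have h := ((differentiableAt_of_contDiffOn hI hB ht).hasDerivAt.clm_apply
    (differentiableAt_of_contDiffOn hI hV ht).hasDerivAt).deriv
  simp only [covCurve, covCurveEnd, h]
  simp
  abel

end

/-- The usual induction through Pascal's rule, for three abstract derivations tied by a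
time-dependent pairing `b`. It serves twice: for endomorphism fields acting on vector fields, and
for a parallel form evaluated on two vector fields. -/
theorem iterate_leibniz {V W U : Type*} [NormedAddCommGroup V] [NormedSpace ℝ V]
    [NormedAddCommGroup W] [NormedSpace ℝ W] [NormedAddCommGroup U] [NormedSpace ℝ U]
    {I : Set ℝ} {δ₁ : (ℝ → V) → ℝ → V} {δ₂ : (ℝ → W) → ℝ → W} {δ₃ : (ℝ → U) → ℝ → U}
    (h₁ : ∀ x, ContDiffOn ℝ ∞ x I → ContDiffOn ℝ ∞ (δ₁ x) I)
    (h₂ : ∀ x, ContDiffOn ℝ ∞ x I → ContDiffOn ℝ ∞ (δ₂ x) I)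
    (h₃ : ∀ x, ContDiffOn ℝ ∞ x I → ContDiffOn ℝ ∞ (δ₃ x) I)
    (hloc : ∀ x y, EqOn x y I → EqOn (δ₃ x) (δ₃ y) I)
    (hadd : ∀ x y, ContDiffOn ℝ ∞ x I → ContDiffOn ℝ ∞ y I →
      EqOn (δ₃ (x + y)) (δ₃ x + δ₃ y) I)
    (b : ℝ → V → W → U)
    (hb : ∀ x y, ContDiffOn ℝ ∞ x I → ContDiffOn ℝ ∞ y I →
      ContDiffOn ℝ ∞ (fun t ↦ b t (x t) (y t)) I)
    (hleib : ∀ x y, ContDiffOn ℝ ∞ x I → ContDiffOn ℝ ∞ y I →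
      EqOn (δ₃ (fun t ↦ b t (x t) (y t)))
        (fun t ↦ b t (δ₁ x t) (y t) + b t (x t) (δ₂ y t)) I)
    (n : ℕ) {x : ℝ → V} {y : ℝ → W} (hx : ContDiffOn ℝ ∞ x I) (hy : ContDiffOn ℝ ∞ y I) :
    EqOn (δ₃^[n] (fun t ↦ b t (x t) (y t)))
      (fun t ↦ ∑ p ∈ Finset.HasAntidiagonal.antidiagonal n, n.choose p.1 • b t (δ₁^[p.1] x t) (δ₂^[p.2] y t)) I := by
  -- The product and sum rules are identities on `I` only, so locality is needed to apply further
  -- iterates of `δ₃` to them.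
  have hloc' : ∀ (n : ℕ) x y, EqOn x y I → EqOn (δ₃^[n] x) (δ₃^[n] y) I := by
    intro n
    induction n with
    | zero => exact fun x y h ↦ h
    | succ n ih => exact fun x y h ↦ ih _ _ (hloc _ _ h)
  have hadd' : ∀ (n : ℕ) x y, ContDiffOn ℝ ∞ x I → ContDiffOn ℝ ∞ y I →
      EqOn (δ₃^[n] (x + y)) (δ₃^[n] x + δ₃^[n] y) I := by
    intro n
    induction n with
    | zero => exact fun x y _ _ ↦ fun t _ ↦ rfl
    | succ n ih =>
      exact fun x y hx hy ↦ (hloc' n _ _ (hadd x y hx hy)).trans (ih _ _ (h₃ _ hx) (h₃ _ hy))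
  induction n generalizing x y with
  | zero => intro t _; simp
  | succ n ih =>
    intro t ht
    rw [Function.iterate_succ_apply, hloc' n _ _ (hleib x y hx hy) ht]
    refine (hadd' n _ _ (hb _ _ (h₁ _ hx) hy) (hb _ _ hx (h₂ _ hy)) ht).trans ?_
    rw [Pi.add_apply, ih (h₁ _ hx) hy ht, ih hx (h₂ _ hy) ht]
    beta_reduce
    rw [Finset.sum_antidiagonal_choose_succ_nsmul
        (f := fun i j ↦ b t (δ₁^[i] x t) (δ₂^[j] y t)), add_comm]
    congr 1
    refine Finset.sum_congr rfl fun p hp ↦ ?_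
    rw [Function.iterate_succ_apply, Nat.choose_symm_of_eq_add (Finset.HasAntidiagonal.mem_antidiagonal.1 hp).symm]

section

variable {A : ℝ → E →L[ℝ] E} {I : Set ℝ}

theorem covCurve_iterate_clm_apply (hI : IsOpen I) (hA : ContDiffOn ℝ ∞ A I)
    {B : ℝ → E →L[ℝ] E} {V : ℝ → E}
    (hB : ContDiffOn ℝ ∞ B I) (hV : ContDiffOn ℝ ∞ V I) (n : ℕ) :
    EqOn ((covCurve A)^[n] (fun t ↦ B t (V t)))
      (fun t ↦ ∑ p ∈ Finset.HasAntidiagonal.antidiagonal n,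
        n.choose p.1 • ((covCurveEnd A)^[p.1] B t) ((covCurve A)^[p.2] V t)) I :=
  iterate_leibniz (fun _ ↦ contDiffOn_covCurveEnd hI hA) (fun _ ↦ contDiffOn_covCurve hI hA)
    (fun _ ↦ contDiffOn_covCurve hI hA) (fun _ _ ↦ covCurve_eqOn hI)
    (fun _ _ ↦ covCurve_add hI) (fun _ T v ↦ T v) (fun _ _ hx hy ↦ hx.clm_apply hy)
    (fun _ _ ↦ covCurve_clm_apply hI) n hB hV

/-- Apply `∇^n` to the Jacobi equation `∇²J = D J` and expand the right side by Leibniz. At time `0`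
this is the recursion behind `Q^r`. -/
theorem covCurve_iterate_of_jacobi (hI : IsOpen I) (hA : ContDiffOn ℝ ∞ A I)
    {D : ℝ → E →L[ℝ] E} {J : ℝ → E} (hD : ContDiffOn ℝ ∞ D I) (hJ : ContDiffOn ℝ ∞ J I)
    (hjac : EqOn (covCurve A (covCurve A J)) (fun t ↦ D t (J t)) I) (n : ℕ) :
    EqOn ((covCurve A)^[n + 2] J)
      (fun t ↦ ∑ p ∈ Finset.HasAntidiagonal.antidiagonal n,
        n.choose p.1 • ((covCurveEnd A)^[p.1] D t) ((covCurve A)^[p.2] J t)) I := by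
  refine EqOn.trans ?_ (covCurve_iterate_clm_apply hI hA hD hJ n)
  have : ∀ (n : ℕ) x y, EqOn x y I → EqOn ((covCurve A)^[n] x) ((covCurve A)^[n] y) I := by
    intro n
    induction n with
    | zero => exact fun x y h ↦ h
    | succ n ih => exact fun x y h ↦ ih _ _ (covCurve_eqOn hI h)
  exact this n _ _ hjac

/-- Leibniz formula for the derivatives of a parallel bilinear form evaluated on two fields. -/
theorem iteratedDeriv_parallel_form (hI : IsOpen I) (hA : ContDiffOn ℝ ∞ A I)
    {h : ℝ → E →L[ℝ] E →L[ℝ] ℝ} (hh : ContDiffOn ℝ ∞ h I)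
    (hpar : ∀ t ∈ I, ∀ u v, deriv h t u v = h t (A t u) v + h t u (A t v))
    {V W : ℝ → E} (hV : ContDiffOn ℝ ∞ V I) (hW : ContDiffOn ℝ ∞ W I) (n : ℕ) :
    EqOn (iteratedDeriv n (fun t ↦ h t (V t) (W t)))
      (fun t ↦ ∑ p ∈ Finset.HasAntidiagonal.antidiagonal n,
        n.choose p.1 • h t ((covCurve A)^[p.1] V t) ((covCurve A)^[p.2] W t)) I := by
  rw [iteratedDeriv_eq_iterate]
  refine iterate_leibniz (fun _ ↦ contDiffOn_covCurve hI hA) (fun _ ↦ contDiffOn_covCurve hI hA)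
    (fun _ ↦ contDiffOn_deriv hI) (fun _ _ ↦ eqOn_deriv hI) (fun x y hx hy t ht ↦ ?_)
    (fun t u v ↦ h t u v) (fun _ _ hx hy ↦ (hh.clm_apply hx).clm_apply hy)
    (fun x y hx hy t ht ↦ ?_) n hV hW
  · exact deriv_add (differentiableAt_of_contDiffOn hI hx ht) (differentiableAt_of_contDiffOn hI hy ht)
  · have e1 : HasDerivAt (fun s ↦ h s (x s)) (deriv h t (x t) + h t (deriv x t)) t :=
      HasDerivAt.clm_apply (differentiableAt_of_contDiffOn hI hh ht).hasDerivAt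
        (differentiableAt_of_contDiffOn hI hx ht).hasDerivAt
    have e2 : HasDerivAt (fun s ↦ h s (x s) (y s))
        ((deriv h t (x t) + h t (deriv x t)) (y t) + h t (x t) (deriv y t)) t :=
      HasDerivAt.clm_apply e1 (differentiableAt_of_contDiffOn hI hy ht).hasDerivAt
    have this := e2.deriv
    rw [this]
    simp only [covCurve, map_add, add_apply, hpar t ht]
    ring

end

end CurveCalculus

/-! ### Algebra of the recursions for `Q` and `P` -/

section RecursionAlgebra

variable {V : Type*} [AddCommGroup V] [Module ℝ V]

/-- The recursion for the covariant derivatives of a Jacobi field with initial values `0, y`. -/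
theorem eq_recQ_of_recursion (D : ℕ → Module.End ℝ V) {a : ℕ → V} (y : V) (h0 : a 0 = 0)
    (h1 : a 1 = y)
    (h : ∀ n, a (n + 2) = ∑ p ∈ Finset.HasAntidiagonal.antidiagonal n, n.choose p.1 • D p.1 (a p.2)) :
    a 2 = 0 ∧ ∀ r, 2 ≤ r → a (r + 1) = recQ D r y := by
  have h2 : a 2 = 0 := by simpa [h0] using h 0
  refine ⟨h2, fun r ↦ ?_⟩
  induction r using Nat.strong_induction_on with
  | _ r ih =>
    intro hr
    obtain ⟨m, rfl⟩ : ∃ m, r = m + 2 := ⟨r - 2, by omega⟩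
    have e1 : a (m + 2 + 1) = ∑ k ∈ Finset.range (m + 2), (m + 1).choose k • D (m + 1 - k) (a k) := by
      rw [show m + 2 + 1 = (m + 1) + 2 by ring, h,
        ← Finset.Nat.sum_antidiagonal_swap (n := m + 1),
        Finset.Nat.sum_antidiagonal_eq_sum_range_succ_mk]
      refine Finset.sum_congr rfl fun k hk ↦ ?_
      simp only [Prod.swap_prod_mk]
      rw [Nat.choose_symm (by simp at hk; omega)]
    -- With `r = m + 2`: the term `k = 0` vanishes, `k = 1` gives `(r-1) D_{r-2} y`, `k = 2` will
    -- vanish, and `k = q + 1` gives the summand of index `q` in the recursion.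
    rw [e1, Finset.sum_range_succ', h0, Finset.sum_range_succ', recQ_eq]
    simp only [map_zero, smul_zero, add_zero, zero_add, Nat.choose_one_right, h1,
      LinearMap.add_apply, LinearMap.smul_apply, LinearMap.sum_apply, LinearMap.comp_apply]
    rw [show m + 2 - 1 = m + 1 by omega, show m + 2 - 2 = m by omega,
      show m + 1 - 1 = m by omega, add_comm]
    congr 1
    cases m with
    | zero => simp
    | succ m =>
      rw [Finset.sum_range_succ', h2]
      simp only [map_zero, smul_zero, add_zero, zero_add]
      have : Finset.Icc 2 (m + 1) = Finset.Ico (0 + 2) (m + 2) := by ext; simp; omega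
      rw [this, ← Finset.sum_Ico_add' _ 0 m 2, ← Finset.range_eq_Ico]
      refine Finset.sum_congr rfl fun q hq ↦ ?_
      have hq' := Finset.mem_range.1 hq
      rw [← ih (q + 2) (by omega) (by omega)]
      congr 3
      all_goals omega

/-- An odd total has no middle term, so the antidiagonal splits into pairs of transposed indices. -/
theorem sum_antidiagonal_odd {W : Type*} [AddCommGroup W] (k : ℕ) (F : ℕ → ℕ → W) :
    ∑ p ∈ Finset.HasAntidiagonal.antidiagonal (2 * k + 3), F p.1 p.2
      = ∑ i ∈ Finset.range (k + 2), (F i (2 * k + 3 - i) + F (2 * k + 3 - i) i) := by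
  rw [Finset.Nat.sum_antidiagonal_eq_sum_range_succ, Finset.sum_add_distrib,
    show (2 * k + 3).succ = (k + 2) + (k + 2) by omega, Finset.sum_range_add,
    ← Finset.sum_range_reflect (fun x ↦ F (k + 2 + x) _)]
  congr 1
  refine Finset.sum_congr rfl fun i hi ↦ ?_
  have := Finset.mem_range.1 hi
  congr 1 <;> omega

theorem recQ_conj {W : Type*} [AddCommGroup W] [Module ℝ W] (L : V →ₗ[ℝ] W)
    {D : ℕ → Module.End ℝ V} {D' : ℕ → Module.End ℝ W} (h : ∀ k u, L (D k u) = D' k (L u))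
    (r : ℕ) (u : V) : L (recQ D r u) = recQ D' r (L u) := by
  induction r using Nat.strong_induction_on with
  | _ r ih =>
    rw [recQ_eq, recQ_eq]
    simp only [LinearMap.add_apply, LinearMap.smul_apply, LinearMap.sum_apply,
      LinearMap.comp_apply, map_add, map_sum, map_nsmul, h]
    congr 1
    refine Finset.sum_congr rfl fun q hq ↦ ?_
    rw [ih q (by have := Finset.mem_Icc.1 hq; omega)]

variable [FiniteDimensional ℝ V]

/-- The odd Taylor coefficients of `ω(J_y, J_z)` are the obstruction to `P^r ∈ sp`. -/
theorem recP_symm_eq_sum (B : LinearMap.BilinForm ℝ V) (hB : B.Nondegenerate)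
    (hskew : ∀ u v, B u v = -B v u) (D : ℕ → Module.End ℝ V) {a b : ℕ → V} {y z : V}
    (ha0 : a 0 = 0) (ha1 : a 1 = y) (ha2 : a 2 = 0) (ha : ∀ r, 2 ≤ r → a (r + 1) = recQ D r y)
    (hb0 : b 0 = 0) (hb1 : b 1 = z) (hb2 : b 2 = 0) (hb : ∀ r, 2 ≤ r → b (r + 1) = recQ D r z)
    {r : ℕ} (hr : Odd r) (hr3 : 3 ≤ r) :
    B (recP B hB D r y) z + B y (recP B hB D r z)
      = ∑ p ∈ Finset.HasAntidiagonal.antidiagonal (r + 2), (r + 2).choose p.1 • B (a p.1) (b p.2) := by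
  obtain ⟨k, rfl⟩ := hr
  obtain ⟨j, rfl⟩ : ∃ j, k = j + 1 := ⟨k - 1, by omega⟩
  rw [show 2 * (j + 1) + 1 + 2 = 2 * (j + 1) + 3 by ring]
  rw [sum_antidiagonal_odd (j + 1) (fun i l ↦ (2 * (j + 1) + 3).choose i • B (a i) (b l))]
  have hadj1 : ∀ (T : Module.End ℝ V) u v,
      B (B.leftAdjointOfNondegenerate hB T u) v = B u (T v) := fun T u v ↦
    B.isAdjointPairLeftAdjointOfNondegenerate hB T u v
  have hadj2 : ∀ (T : Module.End ℝ V) u v,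
      B u (B.leftAdjointOfNondegenerate hB T v) = B (T u) v := fun T u v ↦ by
    rw [hskew, hadj1, ← hskew]
  -- Here `r = 2(j+1) + 1`. The pairs `i = 0` and `i = 2` vanish because `a 0 = a 2 = 0` and
  -- likewise for `b`. The pair `i = 1` yields the two `(r+2) Q^r` terms, and `i = q + 1` the two
  -- terms with `(Q^q)^⊤ Q^{r-q}`, for `2 ≤ q ≤ (r-1)/2`.
  rw [show j + 1 + 2 = j + 1 + 1 + 1 by ring, Finset.sum_range_succ', Finset.sum_range_succ',
    Finset.sum_range_succ']
  have hc : ∀ i, i ≤ 2 * (j + 1) + 3 → (2 * (j + 1) + 3).choose (2 * (j + 1) + 3 - i)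
      = (2 * (j + 1) + 3).choose i := fun i hi ↦ Nat.choose_symm hi
  simp only [recP, ha0, hb0, ha2, hb2, map_zero, LinearMap.zero_apply, smul_zero, add_zero, zero_add,
    ha1, hb1, LinearMap.add_apply, LinearMap.smul_apply, map_add, LinearMap.sum_apply, map_sum,
    LinearMap.comp_apply, hadj1, hadj2, map_nsmul]
  have : Finset.Icc 2 ((2 * (j + 1) + 1 - 1) / 2) = Finset.Ico (0 + 2) (j + 2) := by
    ext; simp; omega
  rw [this, ← Finset.sum_Ico_add' _ 0 j 2, ← Finset.sum_Ico_add' _ 0 j 2, ← Finset.range_eq_Ico,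
    hc 1 (by omega), Nat.choose_one_right, show 2 * (j + 1) + 3 - 1 = (2 * (j + 1) + 1) + 1 by omega,
    ha _ (by omega), hb _ (by omega), show 2 * (j + 1) + 1 + 2 = 2 * (j + 1) + 3 by ring]
  have e : ∑ i ∈ Finset.range j,
      ((2 * (j + 1) + 3).choose (i + 1 + 1 + 1) • B (a (i + 1 + 1 + 1)) (b (2 * (j + 1) + 3 - (i + 1 + 1 + 1)))
      + (2 * (j + 1) + 3).choose (2 * (j + 1) + 3 - (i + 1 + 1 + 1)) •
        B (a (2 * (j + 1) + 3 - (i + 1 + 1 + 1))) (b (i + 1 + 1 + 1)))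
      = ∑ x ∈ Finset.range j, (2 * (j + 1) + 3).choose (x + 2 + 1) •
          B (recQ D (2 * (j + 1) + 1 - (x + 2)) y) (recQ D (x + 2) z)
        + ∑ x ∈ Finset.range j, (2 * (j + 1) + 3).choose (x + 2 + 1) •
          B (recQ D (x + 2) y) (recQ D (2 * (j + 1) + 1 - (x + 2)) z) := by
    rw [← Finset.sum_add_distrib]
    refine Finset.sum_congr rfl fun i hi ↦ ?_
    have hi' := Finset.mem_range.1 hi
    rw [hc _ (by omega), show i + 1 + 1 + 1 = i + 2 + 1 by ring,
      show 2 * (j + 1) + 3 - (i + 2 + 1) = (2 * (j + 1) + 1 - (i + 2)) + 1 by omega,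
      ha _ (by omega), hb _ (by omega), ha _ (by omega), hb _ (by omega), add_comm]
  rw [e]
  abel

end RecursionAlgebra

/-! ### Geodesic variations and the Jacobi equation in coordinates -/

section LocalGeometry

variable {E : Type*} [NormedAddCommGroup E] [NormedSpace ℝ E]
  {F : Type*} [NormedAddCommGroup F] [NormedSpace ℝ F]

theorem contDiffOn_fderiv {O : Set E} (hO : IsOpen O) {c : E → F} (hc : ContDiffOn ℝ ∞ c O) :
    ContDiffOn ℝ ∞ (fderiv ℝ c) O :=
  hc.fderiv_of_isOpen hO (by simp)

theorem hasFDerivAt_of_contDiffOn {O : Set E} (hO : IsOpen O) {c : E → F}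
    (hc : ContDiffOn ℝ ∞ c O) {p : E} (hp : p ∈ O) : HasFDerivAt c (fderiv ℝ c p) p :=
  ((hc.contDiffAt (hO.mem_nhds hp)).differentiableAt (by simp)).hasFDerivAt

/-- The derivative of `c` in the constant direction `w`. -/
def dirDeriv (w : E) (c : E → F) (p : E) : F := fderiv ℝ c p w

theorem contDiffOn_dirDeriv {O : Set E} (hO : IsOpen O) {c : E → F}
    (hc : ContDiffOn ℝ ∞ c O) (w : E) : ContDiffOn ℝ ∞ (dirDeriv w c) O :=
  (contDiffOn_fderiv hO hc).clm_apply contDiffOn_const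

theorem dirDeriv_dirDeriv {O : Set E} (hO : IsOpen O) {c : E → F}
    (hc : ContDiffOn ℝ ∞ c O) (w w' : E) {p : E} (hp : p ∈ O) :
    dirDeriv w (dirDeriv w' c) p = fderiv ℝ (fderiv ℝ c) p w w' := by
  have h := (hasFDerivAt_of_contDiffOn hO (contDiffOn_fderiv hO hc) hp).clm_apply
    (hasFDerivAt_const w' p)
  have e : dirDeriv w (dirDeriv w' c) p = _ := congrArg (fun f : E →L[ℝ] F ↦ f w) h.fderiv
  rw [e]
  simp

theorem dirDeriv_comm {O : Set E} (hO : IsOpen O) {c : E → F}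
    (hc : ContDiffOn ℝ ∞ c O) (w w' : E) {p : E} (hp : p ∈ O) :
    dirDeriv w (dirDeriv w' c) p = dirDeriv w' (dirDeriv w c) p := by
  rw [dirDeriv_dirDeriv hO hc _ _ hp, dirDeriv_dirDeriv hO hc _ _ hp]
  exact ((hc.contDiffAt (hO.mem_nhds hp)).isSymmSndFDerivAt (by simp; exact ENat.LEInfty.out)).eq w w'

theorem dirDeriv_eqOn {O : Set E} (hO : IsOpen O) {c c' : E → F} (h : EqOn c c' O) (w : E) :
    EqOn (dirDeriv w c) (dirDeriv w c') O := fun p hp ↦ by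
  simp only [dirDeriv, (h.eventuallyEq_of_mem (hO.mem_nhds hp)).fderiv_eq]

theorem hasDerivAt_snd {O : Set (ℝ × ℝ)} (hO : IsOpen O) {c : ℝ × ℝ → F}
    (hc : ContDiffOn ℝ ∞ c O) {s t : ℝ} (hp : (s, t) ∈ O) :
    HasDerivAt (fun τ ↦ c (s, τ)) (dirDeriv (0, 1) c (s, t)) t :=
  (hasFDerivAt_of_contDiffOn hO hc hp).comp_hasDerivAt t
    ((hasDerivAt_const t s).prodMk (hasDerivAt_id t))

/-- The curvature endomorphism `v ↦ R(u, v) w` at `z` for the Christoffel symbols `Γ`. -/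
def curvLoc (Γ : E → E →L[ℝ] E →L[ℝ] E) (z u w : E) : E →L[ℝ] E :=
  (fderiv ℝ Γ z u).flip w - ((fderiv ℝ Γ z).flip u).flip w + (Γ z u) ∘L (Γ z).flip w
    - (Γ z).flip (Γ z u w)

theorem curvLoc_apply (Γ : E → E →L[ℝ] E →L[ℝ] E) (z u w v : E) :
    curvLoc Γ z u w v = fderiv ℝ Γ z u v w - fderiv ℝ Γ z v u w + Γ z u (Γ z v w)
      - Γ z v (Γ z u w) := by
  simp [curvLoc]

theorem _root_.ContDiffOn.clm_flip {G H K : Type*} [NormedAddCommGroup G] [NormedSpace ℝ G]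
    [NormedAddCommGroup H] [NormedSpace ℝ H] [NormedAddCommGroup K] [NormedSpace ℝ K]
    {s : Set K} {n : ℕ∞ω} {f : K → F →L[ℝ] G →L[ℝ] H} (hf : ContDiffOn ℝ n f s) :
    ContDiffOn ℝ n (fun x ↦ (f x).flip) s :=
  ContDiff.comp_contDiffOn (g := fun f : F →L[ℝ] G →L[ℝ] H ↦ f.flip)
    (ContinuousLinearMap.flipₗᵢ ℝ F G H).contDiff hf

theorem contDiffOn_curvLoc {Γ : E → E →L[ℝ] E →L[ℝ] E} {U : Set E} (hU : IsOpen U)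
    (hΓ : ContDiffOn ℝ ∞ Γ U) {I : Set F} {γ T W : F → E} (hγ : ContDiffOn ℝ ∞ γ I)
    (hT : ContDiffOn ℝ ∞ T I) (hW : ContDiffOn ℝ ∞ W I) (hm : MapsTo γ I U) :
    ContDiffOn ℝ ∞ (fun t ↦ curvLoc Γ (γ t) (T t) (W t)) I := by
  have h1 : ContDiffOn ℝ ∞ (fun t ↦ fderiv ℝ Γ (γ t)) I := (contDiffOn_fderiv hU hΓ).comp hγ hm
  have h2 : ContDiffOn ℝ ∞ (fun t ↦ Γ (γ t)) I := hΓ.comp hγ hm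
  have h3 : ContDiffOn ℝ ∞ (fun t ↦ Γ (γ t) (T t)) I := h2.clm_apply hT
  have h4 : ContDiffOn ℝ ∞ (fun t ↦ (Γ (γ t)).flip) I := h2.clm_flip
  have h5 : ContDiffOn ℝ ∞ (fun t ↦ fderiv ℝ Γ (γ t) (T t)) I := h1.clm_apply hT
  have h6 : ContDiffOn ℝ ∞ (fun t ↦ (fderiv ℝ Γ (γ t)).flip (T t)) I := h1.clm_flip.clm_apply hT
  exact (((h5.clm_flip.clm_apply hW).sub (h6.clm_flip.clm_apply hW)).add
    (h3.clm_comp (h4.clm_apply hW))).sub (h4.clm_apply (h3.clm_apply hW))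

/-- The variation field of a family of geodesics satisfies the Jacobi equation. -/
theorem jacobi_of_family {Γ : E → E →L[ℝ] E →L[ℝ] E} {U : Set E} (hU : IsOpen U)
    (hΓ : ContDiffOn ℝ ∞ Γ U) (hsym : ∀ z ∈ U, ∀ u v, Γ z u v = Γ z v u)
    {O : Set (ℝ × ℝ)} (hO : IsOpen O) {c : ℝ × ℝ → E} (hc : ContDiffOn ℝ ∞ c O)
    (hm : MapsTo c O U)
    (hgeo : ∀ p ∈ O, dirDeriv (0, 1) (dirDeriv (0, 1) c) p
      + Γ (c p) (dirDeriv (0, 1) c p) (dirDeriv (0, 1) c p) = 0)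
    {s t : ℝ} (hp : (s, t) ∈ O) {A : ℝ → E →L[ℝ] E} {J : ℝ → E}
    (hA : ∀ᶠ τ in 𝓝 t, A τ = Γ (c (s, τ)) (dirDeriv (0, 1) c (s, τ)))
    (hJ : ∀ᶠ τ in 𝓝 t, J τ = dirDeriv (1, 0) c (s, τ)) :
    covCurve A (covCurve A J) t = curvLoc Γ (c (s, t)) (dirDeriv (0, 1) c (s, t))
      (dirDeriv (0, 1) c (s, t)) (J t) := by
  set T := dirDeriv ((0, 1) : ℝ × ℝ) c with hT
  set S := dirDeriv ((1, 0) : ℝ × ℝ) c with hS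
  have cT : ContDiffOn ℝ ∞ T O := contDiffOn_dirDeriv hO hc _
  have cS : ContDiffOn ℝ ∞ S O := contDiffOn_dirDeriv hO hc _
  have cT2 : ContDiffOn ℝ ∞ (dirDeriv ((0, 1) : ℝ × ℝ) T) O := contDiffOn_dirDeriv hO cT _
  have cS2 : ContDiffOn ℝ ∞ (dirDeriv ((0, 1) : ℝ × ℝ) S) O := contDiffOn_dirDeriv hO cS _
  have cG : ContDiffOn ℝ ∞ (fun p ↦ Γ (c p)) O := hΓ.comp hc hm
  have cA : ContDiffOn ℝ ∞ (fun p ↦ Γ (c p) (T p)) O := cG.clm_apply cT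
  have dG : ∀ p ∈ O, HasFDerivAt (fun p ↦ Γ (c p))
      ((fderiv ℝ Γ (c p)).comp (fderiv ℝ c p)) p := fun p hp ↦
    (hasFDerivAt_of_contDiffOn hU hΓ (hm hp)).comp p (hasFDerivAt_of_contDiffOn hO hc hp)
  have dA : ∀ p ∈ O, ∀ w, dirDeriv w (fun p ↦ Γ (c p) (T p)) p
      = fderiv ℝ Γ (c p) (dirDeriv w c p) (T p) + Γ (c p) (dirDeriv w T p) := by
    intro p hp w
    have := ((dG p hp).clm_apply (hasFDerivAt_of_contDiffOn hO cT hp)).fderiv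
    simp only [dirDeriv, this]
    simp [add_comm]
  -- the derivative of the geodesic equation in the direction of the parameter
  have e1 : dirDeriv ((1, 0) : ℝ × ℝ) (dirDeriv ((0, 1) : ℝ × ℝ) T) (s, t)
      + (fderiv ℝ Γ (c (s, t)) (S (s, t)) (T (s, t)) + Γ (c (s, t)) (dirDeriv (1, 0) T (s, t)))
          (T (s, t))
      + Γ (c (s, t)) (T (s, t)) (dirDeriv (1, 0) T (s, t)) = 0 := by
    have h0 : EqOn (fun p ↦ dirDeriv ((0, 1) : ℝ × ℝ) T p + Γ (c p) (T p) (T p)) (fun _ ↦ 0) O :=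
      fun p hp ↦ hgeo p hp
    have h1 := dirDeriv_eqOn hO h0 (1, 0) hp
    have h2 : dirDeriv ((1, 0) : ℝ × ℝ) (fun _ : ℝ × ℝ ↦ (0 : E)) (s, t) = 0 := by
      simp [dirDeriv]
    rw [h2] at h1
    rw [← h1]
    have h3 := ((hasFDerivAt_of_contDiffOn hO cT2 hp).add
      ((hasFDerivAt_of_contDiffOn hO cA hp).clm_apply (hasFDerivAt_of_contDiffOn hO cT hp))).fderiv
    have h4 := dA (s, t) hp (1, 0)
    have h5 : dirDeriv ((1, 0) : ℝ × ℝ) (fun p ↦ dirDeriv ((0, 1) : ℝ × ℝ) T p + Γ (c p) (T p) (T p))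
      (s, t) = _ := congrArg (fun f : ℝ × ℝ →L[ℝ] E ↦ f (1, 0)) h3
    rw [h5]
    simp only [dirDeriv] at h4
    simp only [add_apply, ContinuousLinearMap.comp_apply, ContinuousLinearMap.flip_apply, h4]
    simp only [hS, dirDeriv]
    abel
  -- Partial derivatives commute, so the third derivative in the varied geodesic equation is the
  -- second time derivative of the variation field.
  have e2 : dirDeriv ((1, 0) : ℝ × ℝ) (dirDeriv ((0, 1) : ℝ × ℝ) T) (s, t)
      = dirDeriv ((0, 1) : ℝ × ℝ) (dirDeriv ((0, 1) : ℝ × ℝ) S) (s, t) := by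
    rw [dirDeriv_comm hO cT _ _ hp]
    exact dirDeriv_eqOn hO (fun p hp ↦ dirDeriv_comm hO hc _ _ hp) _ hp
  have e3 : dirDeriv ((1, 0) : ℝ × ℝ) T (s, t) = dirDeriv ((0, 1) : ℝ × ℝ) S (s, t) :=
    dirDeriv_comm hO hc _ _ hp
  have hOt : ∀ᶠ τ in 𝓝 t, (s, τ) ∈ O :=
    (Continuous.prodMk_right s).continuousAt.eventually (hO.mem_nhds hp)
  have hcJ : ∀ᶠ τ in 𝓝 t, covCurve A J τ
      = dirDeriv ((0, 1) : ℝ × ℝ) S (s, τ) + Γ (c (s, τ)) (T (s, τ)) (S (s, τ)) := by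
    filter_upwards [hA, hJ.eventually_nhds, hOt] with τ h1 h2 h3
    have h4 : deriv J τ = dirDeriv (0, 1) S (s, τ) := by
      rw [EventuallyEq.deriv_eq h2]; exact (hasDerivAt_snd hO cS h3).deriv
    rw [covCurve, h4, h1, h2.self_of_nhds]
  have d1 : deriv (covCurve A J) t = dirDeriv ((0, 1) : ℝ × ℝ) (dirDeriv ((0, 1) : ℝ × ℝ) S) (s, t)
      + (dirDeriv (0, 1) (fun p ↦ Γ (c p) (T p)) (s, t) (S (s, t))
        + Γ (c (s, t)) (T (s, t)) (dirDeriv (0, 1) S (s, t))) := by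
    rw [EventuallyEq.deriv_eq hcJ]
    exact ((hasDerivAt_snd hO cS2 hp).add
      ((hasDerivAt_snd hO cA hp).clm_apply (hasDerivAt_snd hO cS hp))).deriv
  have e4 : dirDeriv ((0, 1) : ℝ × ℝ) T (s, t) = - Γ (c (s, t)) (T (s, t)) (T (s, t)) :=
    eq_neg_of_add_eq_zero_left (hgeo _ hp)
  have e5 : dirDeriv ((1, 0) : ℝ × ℝ) (dirDeriv ((0, 1) : ℝ × ℝ) T) (s, t)
      = -((fderiv ℝ Γ (c (s, t)) (S (s, t)) (T (s, t)) + Γ (c (s, t)) (dirDeriv (1, 0) T (s, t)))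
          (T (s, t)) + Γ (c (s, t)) (T (s, t)) (dirDeriv (1, 0) T (s, t))) := by
    rw [eq_neg_iff_add_eq_zero, ← add_assoc, e1]
  -- The geodesic equation and its variation eliminate the second time derivative of `c` and its
  -- parameter derivative. The rest is the curvature expression, up to the symmetry of `Γ`.
  rw [covCurve, d1, hcJ.self_of_nhds, hA.self_of_nhds, hJ.self_of_nhds, dA _ hp, curvLoc_apply, e4,
    ← e2, e5, e3]
  have s1 := hsym _ (hm hp) (S (s, t)) (Γ (c (s, t)) (T (s, t)) (T (s, t)))
  have s3 := hsym _ (hm hp) (dirDeriv (0, 1) S (s, t)) (T (s, t))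
  have s4 := hsym _ (hm hp) (S (s, t)) (T (s, t))
  -- Symmetry of `Γ` holds on an open set, hence passes to its derivative.
  have s2 : fderiv ℝ Γ (c (s, t)) (T (s, t)) (T (s, t)) (S (s, t))
      = fderiv ℝ Γ (c (s, t)) (T (s, t)) (S (s, t)) (T (s, t)) := by
    have hd := hasFDerivAt_of_contDiffOn hU hΓ (hm hp)
    have a1 := ((hd.clm_apply (hasFDerivAt_const (T (s, t)) _)).clm_apply
      (hasFDerivAt_const (S (s, t)) _)).fderiv
    have a2 := ((hd.clm_apply (hasFDerivAt_const (S (s, t)) _)).clm_apply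
      (hasFDerivAt_const (T (s, t)) _)).fderiv
    have a3 : (fun z ↦ Γ z (T (s, t)) (S (s, t))) =ᶠ[𝓝 (c (s, t))]
        (fun z ↦ Γ z (S (s, t)) (T (s, t))) := by
      filter_upwards [hU.mem_nhds (hm hp)] with z hz using hsym z hz _ _
    have a4 := congrArg (fun f : E →L[ℝ] E ↦ f (T (s, t))) a3.fderiv_eq
    simp only [a1, a2] at a4
    simpa using a4
  have hTdef : dirDeriv ((0, 1) : ℝ × ℝ) c (s, t) = T (s, t) := rfl
  simp only [hTdef, add_apply, map_add, map_neg, neg_apply, s1, s2, s3, s4]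
  abel

theorem hasDerivAt_comp_smul {V : Set E} (hV : IsOpen V) {f : E → F} (hf : ContDiffOn ℝ ∞ f V)
    {X : E} {t : ℝ} (ht : t • X ∈ V) :
    HasDerivAt (fun τ : ℝ ↦ f (τ • X)) (fderiv ℝ f (t • X) X) t := by
  have h : HasDerivAt (fun τ : ℝ ↦ τ • X) X t := by
    simpa using (hasDerivAt_id t).smul_const X
  exact (hasFDerivAt_of_contDiffOn hV hf ht).comp_hasDerivAt t h

/-- Radial curves `t ↦ Ex (t v)` solve the geodesic equation, if `Ex` does so infinitesimally. -/
theorem radial_geodesic {Γ : E → E →L[ℝ] E →L[ℝ] E} {U : Set E}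
    (hΓ : ContDiffOn ℝ ∞ Γ U) {V : Set E} (hV : IsOpen V) {Ex : E → E}
    (hEx : ContDiffOn ℝ ∞ Ex V) (hm : MapsTo Ex V U)
    (hgeo : ∀ w ∈ V, fderiv ℝ (fderiv ℝ Ex) w w w + Γ (Ex w) (fderiv ℝ Ex w w) (fderiv ℝ Ex w w) = 0)
    {v : E} {t : ℝ} (ht : t • v ∈ V) :
    fderiv ℝ (fderiv ℝ Ex) (t • v) v v
      + Γ (Ex (t • v)) (fderiv ℝ Ex (t • v) v) (fderiv ℝ Ex (t • v) v) = 0 := by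
  have key : ∀ t : ℝ, t ≠ 0 → t • v ∈ V → fderiv ℝ (fderiv ℝ Ex) (t • v) v v
      + Γ (Ex (t • v)) (fderiv ℝ Ex (t • v) v) (fderiv ℝ Ex (t • v) v) = 0 := by
    intro t h0 ht
    -- At `w = t • v` the hypothesis is `t²` times the claim.
    have := hgeo _ ht
    simp only [map_smul, smul_apply] at this
    rw [← smul_add, ← smul_add] at this
    exact (smul_eq_zero_iff_right h0).1 ((smul_eq_zero_iff_right h0).1 this)
  rcases eq_or_ne t 0 with rfl | h0
  swap
  · exact key t h0 ht
  -- Division by `t²` is impossible at `t = 0`; there the identity follows by continuity from `t ≠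
  -- 0`.
  have c1 : ContDiffOn ℝ ∞ (fderiv ℝ Ex) V := contDiffOn_fderiv hV hEx
  have c2 : ContDiffOn ℝ ∞ (fun w ↦ fderiv ℝ (fderiv ℝ Ex) w v v
      + Γ (Ex w) (fderiv ℝ Ex w v) (fderiv ℝ Ex w v)) V :=
    (((contDiffOn_fderiv hV c1).clm_apply contDiffOn_const).clm_apply contDiffOn_const).add
      (((hΓ.comp hEx hm).clm_apply (c1.clm_apply contDiffOn_const)).clm_apply
        (c1.clm_apply contDiffOn_const))
  have hev : ∀ᶠ τ in 𝓝 (0 : ℝ), τ • v ∈ V :=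
    (by fun_prop : Continuous fun τ : ℝ ↦ τ • v).continuousAt.eventually (hV.mem_nhds ht)
  have h1 : Tendsto (fun τ : ℝ ↦ fderiv ℝ (fderiv ℝ Ex) (τ • v) v v
      + Γ (Ex (τ • v)) (fderiv ℝ Ex (τ • v) v) (fderiv ℝ Ex (τ • v) v)) (𝓝 0)
      (𝓝 (fderiv ℝ (fderiv ℝ Ex) ((0 : ℝ) • v) v v
      + Γ (Ex ((0 : ℝ) • v)) (fderiv ℝ Ex ((0 : ℝ) • v) v) (fderiv ℝ Ex ((0 : ℝ) • v) v))) :=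
    ContinuousAt.comp (f := fun τ : ℝ ↦ τ • v) (x := 0)
      (c2.contDiffAt (hV.mem_nhds ht)).continuousAt (by fun_prop)
  refine tendsto_nhds_unique (h1.mono_left (nhdsWithin_le_nhds (s := {0}ᶜ)))
    (Tendsto.congr' ?_ tendsto_const_nhds)
  filter_upwards [nhdsWithin_le_nhds hev, self_mem_nhdsWithin] with τ h2 h3
  exact (key τ h3 h2).symm

theorem fderiv_comp_smul_second {V : Set E} (hV : IsOpen V) {f : E → F} (hf : ContDiffOn ℝ ∞ f V)
    {v : E} {t : ℝ} (ht : t • v ∈ V) :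
    deriv (deriv (fun τ : ℝ ↦ f (τ • v))) t = fderiv ℝ (fderiv ℝ f) (t • v) v v := by
  have hev : ∀ᶠ τ in 𝓝 t, τ • v ∈ V :=
    (by fun_prop : Continuous fun τ : ℝ ↦ τ • v).continuousAt.eventually (hV.mem_nhds ht)
  have e : deriv (fun τ : ℝ ↦ f (τ • v)) =ᶠ[𝓝 t] fun τ ↦ fderiv ℝ f (τ • v) v := by
    filter_upwards [hev] with τ hτ using (hasDerivAt_comp_smul hV hf hτ).deriv
  rw [e.deriv_eq]
  have := (hasDerivAt_comp_smul hV (contDiffOn_fderiv hV hf) ht).clm_apply (hasDerivAt_const t v)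
  rw [this.deriv]
  simp

/-! ### Jacobi fields along a radial geodesic and derivatives of the pulled-back form -/

section Radial

variable {Γ : E → E →L[ℝ] E →L[ℝ] E} {U : Set E} (hU : IsOpen U)
  (hΓ : ContDiffOn ℝ ∞ Γ U) (hsym : ∀ z ∈ U, ∀ u v, Γ z u v = Γ z v u)
  {V : Set E} (hV : IsOpen V) (hV0 : (0 : E) ∈ V) {Ex : E → E}
  (hEx : ContDiffOn ℝ ∞ Ex V) (hm : MapsTo Ex V U)
  (hgeo : ∀ w ∈ V, fderiv ℝ (fderiv ℝ Ex) w w w + Γ (Ex w) (fderiv ℝ Ex w w) (fderiv ℝ Ex w w) = 0)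
  {X : E} {γ : ℝ → E} {A D : ℝ → E →L[ℝ] E} {I : Set ℝ} (hI : IsOpen I)
  (hIV : ∀ t ∈ I, t • X ∈ V) (hγ : ∀ t ∈ I, γ t = Ex (t • X))
  (hA : ∀ t ∈ I, A t = Γ (γ t) (deriv γ t))
  (hD : ∀ t ∈ I, D t = curvLoc Γ (γ t) (deriv γ t) (deriv γ t))

include hEx hIV hγ in
theorem contDiffOn_radial : ContDiffOn ℝ ∞ γ I :=
  (hEx.comp (g := Ex) (f := fun t : ℝ ↦ t • X) (by fun_prop) hIV).congr hγ

include hEx hI hIV hγ hA hΓ hm in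
theorem contDiffOn_radial_matrix : ContDiffOn ℝ ∞ A I := by
  have h := contDiffOn_radial hEx hIV hγ
  refine ((hΓ.comp h fun t ht ↦ ?_).clm_apply (contDiffOn_deriv hI h)).congr hA
  rw [hγ t ht]
  exact hm (hIV t ht)

include hEx hI hIV hγ hD hΓ hm hU in
theorem contDiffOn_radial_curvature : ContDiffOn ℝ ∞ D I := by
  have h := contDiffOn_radial hEx hIV hγ
  refine (contDiffOn_curvLoc hU hΓ h (contDiffOn_deriv hI h) (contDiffOn_deriv hI h)
    fun t ht ↦ ?_).congr hD
  rw [hγ t ht]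
  exact hm (hIV t ht)

include hV hEx hIV in
theorem contDiffOn_radial_jacobi (Y : E) :
    ContDiffOn ℝ ∞ (fun t : ℝ ↦ t • fderiv ℝ Ex (t • X) Y) I :=
  contDiffOn_id.smul (((contDiffOn_fderiv hV hEx).comp (f := fun t : ℝ ↦ t • X)
    (by fun_prop) hIV).clm_apply contDiffOn_const)

include hU hΓ hsym hV hEx hm hgeo hI hIV hγ hA hD in
-- The field `t • dEx_{tX} Y` is the derivative at `s = 0` of `Ex(t(X + sY))`, and for every `s`
-- this is a solution of the geodesic equation in `t`; so `jacobi_of_family` applies.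
theorem radial_jacobi (Y : E) :
    EqOn (covCurve A (covCurve A fun t ↦ t • fderiv ℝ Ex (t • X) Y))
      (fun t ↦ D t (t • fderiv ℝ Ex (t • X) Y)) I := by
  intro t ht
  set q : ℝ × ℝ → E := fun p ↦ p.2 • (X + p.1 • Y) with hq
  set O : Set (ℝ × ℝ) := q ⁻¹' V with hO
  have hqc : ContDiff ℝ ∞ q := by fun_prop
  have hOo : IsOpen O := hV.preimage hqc.continuous
  have hc : ContDiffOn ℝ ∞ (Ex ∘ q) O := hEx.comp hqc.contDiffOn fun p hp ↦ hp
  have d2 : ∀ p ∈ O, dirDeriv (0, 1) (Ex ∘ q) p = fderiv ℝ Ex (q p) (X + p.1 • Y) := by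
    rintro ⟨s, τ⟩ hp
    rw [← (hasDerivAt_snd hOo hc hp).deriv]
    exact (hasDerivAt_comp_smul hV hEx hp).deriv
  have d22 : ∀ p ∈ O, dirDeriv (0, 1) (dirDeriv (0, 1) (Ex ∘ q)) p
      = fderiv ℝ (fderiv ℝ Ex) (q p) (X + p.1 • Y) (X + p.1 • Y) := by
    rintro ⟨s, τ⟩ hp
    rw [dirDeriv_eqOn hOo (c' := fun p ↦ fderiv ℝ Ex (q p) (X + p.1 • Y)) d2 _ hp,
      ← (hasDerivAt_snd hOo (c := fun p ↦ fderiv ℝ Ex (q p) (X + p.1 • Y)) ?_ hp).deriv]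
    · have := (hasDerivAt_comp_smul hV (contDiffOn_fderiv hV hEx) hp).clm_apply
        (hasDerivAt_const τ (X + s • Y))
      refine this.deriv.trans ?_
      simp [hq]
    · exact ((contDiffOn_fderiv hV hEx).comp hqc.contDiffOn fun p hp ↦ hp).clm_apply
        (by fun_prop)
  have q0 : ∀ τ : ℝ, q (0, τ) = τ • X := fun τ ↦ by simp [hq]
  have hJ : ∀ τ ∈ I, τ • fderiv ℝ Ex (τ • X) Y = dirDeriv (1, 0) (Ex ∘ q) (0, τ) := by
    intro τ hτ
    have hτV : q (0, τ) ∈ V := by rw [q0]; exact hIV τ hτ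
    have h1 : HasFDerivAt q (fderiv ℝ q (0, τ)) (0, τ) :=
      (hqc.differentiable (by simp) _).hasFDerivAt
    have h2 : HasDerivAt (fun s : ℝ ↦ q (s, τ)) (τ • Y) 0 := by
      have := (((hasDerivAt_id (0 : ℝ)).smul_const Y).const_add X).const_smul τ
      rw [one_smul] at this
      exact this
    have h3 : HasDerivAt (fun s : ℝ ↦ q (s, τ)) (fderiv ℝ q (0, τ) (1, 0)) 0 :=
      HasFDerivAt.comp_hasDerivAt (l := q) (f := fun s : ℝ ↦ (s, τ)) (0 : ℝ) h1 ((hasDerivAt_id (0 : ℝ)).prodMk (hasDerivAt_const (0 : ℝ) τ))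
    have h4 := ((hasFDerivAt_of_contDiffOn hV hEx hτV).comp _ h1).fderiv
    rw [dirDeriv, h4, ContinuousLinearMap.comp_apply, h3.unique h2, q0, map_smul]
  have hγ' : ∀ τ ∈ I, deriv γ τ = dirDeriv (0, 1) (Ex ∘ q) (0, τ) := by
    intro τ hτ
    have : γ =ᶠ[𝓝 τ] fun τ ↦ Ex (τ • X) := by
      filter_upwards [hI.mem_nhds hτ] with σ hσ using hγ σ hσ
    rw [this.deriv_eq, (hasDerivAt_comp_smul hV hEx (hIV τ hτ)).deriv,
      d2 _ (by simpa [hO, q0] using hIV τ hτ), q0]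
    simp
  have := jacobi_of_family (A := A) (J := fun t ↦ t • fderiv ℝ Ex (t • X) Y)
    (s := 0) (t := t) hU hΓ hsym hOo hc (fun p hp ↦ hm hp) (fun p hp ↦ ?_)
    (show q (0, t) ∈ V by rw [q0]; exact hIV t ht) ?_ ?_
  · rw [this]
    beta_reduce
    rw [hD t ht, hγ' t ht, hγ t ht]
    simp [q0]
  · rw [d22 p hp, d2 p hp]
    exact radial_geodesic hΓ hV hEx hm hgeo hp
  · filter_upwards [hI.mem_nhds ht] with τ hτ
    rw [hA τ hτ, hγ' τ hτ, hγ τ hτ, Function.comp_apply, q0]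
  · filter_upwards [hI.mem_nhds ht] with τ hτ using hJ τ hτ

variable {h : E → E →L[ℝ] E →L[ℝ] ℝ} (hh : ContDiffOn ℝ ∞ h U)
  (hpar : ∀ z ∈ U, ∀ w u v, fderiv ℝ h z w u v = h z (Γ z w u) v + h z u (Γ z w v))
  (h0 : (0 : ℝ) ∈ I)

include hU hΓ hV hEx hm hI hIV hγ hA hh hpar in
theorem iteratedDeriv_radial_form (Y Z : E) (n : ℕ) :
    EqOn (iteratedDeriv n fun t : ℝ ↦
        h (Ex (t • X)) (t • fderiv ℝ Ex (t • X) Y) (t • fderiv ℝ Ex (t • X) Z))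
      (fun t ↦ ∑ p ∈ Finset.HasAntidiagonal.antidiagonal n, n.choose p.1 •
        h (Ex (t • X)) ((covCurve A)^[p.1] (fun t ↦ t • fderiv ℝ Ex (t • X) Y) t)
          ((covCurve A)^[p.2] (fun t ↦ t • fderiv ℝ Ex (t • X) Z) t)) I := by
  refine iteratedDeriv_parallel_form (A := A) (h := fun t : ℝ ↦ h (Ex (t • X))) hI
    (contDiffOn_radial_matrix hΓ hEx hm hI hIV hγ hA)
    (hh.comp (hEx.comp (f := fun t : ℝ ↦ t • X) (by fun_prop) hIV) fun t ht ↦ hm (hIV t ht)) ?_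
    (contDiffOn_radial_jacobi hV hEx hIV Y) (contDiffOn_radial_jacobi hV hEx hIV Z) n
  intro t ht u v
  have e1 := hasDerivAt_comp_smul hV hEx (hIV t ht)
  have e2 : deriv γ t = fderiv ℝ Ex (t • X) X := by
    have : γ =ᶠ[𝓝 t] fun τ ↦ Ex (τ • X) := by
      filter_upwards [hI.mem_nhds ht] with σ hσ using hγ σ hσ
    rw [this.deriv_eq, e1.deriv]
  have e3 : HasDerivAt (fun τ : ℝ ↦ h (Ex (τ • X)))
      (fderiv ℝ h (Ex (t • X)) (fderiv ℝ Ex (t • X) X)) t :=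
    (hasFDerivAt_of_contDiffOn hU hh (hm (hIV t ht))).comp_hasDerivAt t e1
  rw [e3.deriv, hpar _ (hm (hIV t ht)), hA t ht, hγ t ht, e2]

include hV hEx hIV h0 in
-- The field vanishes at `0`, so the connection term drops out and only the derivative of the factor
-- `t` contributes.
theorem radial_jacobi_initial (Y : E) : covCurve A (fun t ↦ t • fderiv ℝ Ex (t • X) Y) 0
    = fderiv ℝ Ex 0 Y := by
  have h1 := ((hasDerivAt_id (0 : ℝ)).smul
    ((hasDerivAt_comp_smul hV (contDiffOn_fderiv hV hEx) (hIV 0 h0)).clm_apply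
      (hasDerivAt_const 0 Y))).deriv
  have h2 : deriv (fun t : ℝ ↦ t • fderiv ℝ Ex (t • X) Y) 0 = _ := h1
  simp [covCurve, h2]

include hU hΓ hsym hV hEx hm hgeo hI hIV hγ hA hD hh hpar h0 in
/-- The odd derivatives of order at least five of the pulled back form along a radial curve. -/
theorem iteratedDeriv_radial_form_eq_recP [FiniteDimensional ℝ E] (B : LinearMap.BilinForm ℝ E)
    (hB : B.Nondegenerate) (hBh : ∀ u v, B u v = h (Ex 0) u v) (hskew : ∀ u v, B u v = -B v u)
    (Y Z : E) {r : ℕ} (hr : Odd r) (hr3 : 3 ≤ r) :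
    iteratedDeriv (r + 2) (fun t : ℝ ↦
        h (Ex (t • X)) (t • fderiv ℝ Ex (t • X) Y) (t • fderiv ℝ Ex (t • X) Z)) 0
      = B (recP B hB (fun k ↦ ((covCurveEnd A)^[k] D 0).toLinearMap) r (fderiv ℝ Ex 0 Y))
          (fderiv ℝ Ex 0 Z)
        + B (fderiv ℝ Ex 0 Y)
          (recP B hB (fun k ↦ ((covCurveEnd A)^[k] D 0).toLinearMap) r (fderiv ℝ Ex 0 Z)) := by
  have cA := contDiffOn_radial_matrix hΓ hEx hm hI hIV hγ hA
  have cD := contDiffOn_radial_curvature hU hΓ hEx hm hI hIV hγ hD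
  -- The values `∇^n J_Y(0)` satisfy the recursion of `Q` with `D k = ∇^k Π` at `0`.
  have key : ∀ Y, _ := fun Y ↦ eq_recQ_of_recursion
    (fun k ↦ ((covCurveEnd A)^[k] D 0).toLinearMap)
    (a := fun n ↦ (covCurve A)^[n] (fun t ↦ t • fderiv ℝ Ex (t • X) Y) 0) (fderiv ℝ Ex 0 Y)
    (by simp) (radial_jacobi_initial hV hEx hIV h0 Y) fun n ↦
      covCurve_iterate_of_jacobi hI cA cD (contDiffOn_radial_jacobi hV hEx hIV Y)
        (radial_jacobi hU hΓ hsym hV hEx hm hgeo hI hIV hγ hA hD Y) n h0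
  rw [iteratedDeriv_radial_form hU hΓ hV hEx hm hI hIV hγ hA hh hpar Y Z _ h0,
    recP_symm_eq_sum B hB hskew _
      (a := fun n ↦ (covCurve A)^[n] (fun t ↦ t • fderiv ℝ Ex (t • X) Y) 0)
      (b := fun n ↦ (covCurve A)^[n] (fun t ↦ t • fderiv ℝ Ex (t • X) Z) 0)
      (by simp) (radial_jacobi_initial hV hEx hIV h0 Y) (key Y).1 (key Y).2
      (by simp) (radial_jacobi_initial hV hEx hIV h0 Z) (key Z).1 (key Z).2 hr hr3]
  simp [hBh]

include hU hΓ hsym hV hEx hm hgeo hI hIV hγ hA hD hh hpar h0 in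
-- In total order 1 or 3 every term of the Leibniz sum contains a derivative of order 0 or 2 of a
-- Jacobi field, and `J(0) = 0`, `∇²J(0) = Π J(0) = 0`. This is why no condition on `P^r` with `r <
-- 3` is needed.
theorem iteratedDeriv_radial_form_low [FiniteDimensional ℝ E] (Y Z : E) {n : ℕ}
    (hn : n = 1 ∨ n = 3) :
    iteratedDeriv n (fun t : ℝ ↦
        h (Ex (t • X)) (t • fderiv ℝ Ex (t • X) Y) (t • fderiv ℝ Ex (t • X) Z)) 0 = 0 := by
  have cA := contDiffOn_radial_matrix hΓ hEx hm hI hIV hγ hA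
  have cD := contDiffOn_radial_curvature hU hΓ hEx hm hI hIV hγ hD
  have key : ∀ Y, (covCurve A)^[2] (fun t ↦ t • fderiv ℝ Ex (t • X) Y) 0 = 0 := fun Y ↦ by
    rw [covCurve_iterate_of_jacobi hI cA cD (contDiffOn_radial_jacobi hV hEx hIV Y)
        (radial_jacobi hU hΓ hsym hV hEx hm hgeo hI hIV hγ hA hD Y) 0 h0]
    simp
  rw [iteratedDeriv_radial_form hU hΓ hV hEx hm hI hIV hγ hA hh hpar Y Z _ h0]
  rcases hn with rfl | rfl
  · simp [Finset.Nat.antidiagonal_succ]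
  · simp only [Function.iterate_succ, Function.iterate_zero, Function.comp_apply, id_eq] at key
    simp [Finset.Nat.antidiagonal_succ, key]

end Radial

end LocalGeometry

/-! ### Superposition and integration operators on spaces of continuous functions -/

section FunctionSpace

open unitInterval

variable {E : Type*} [NormedAddCommGroup E] [NormedSpace ℝ E]
  {F : Type*} [NormedAddCommGroup F] [NormedSpace ℝ F]
  {K : Type*} [TopologicalSpace K] [CompactSpace K]

/-- The multilinear map on spaces of continuous functions induced by pointwise application. -/
def pointwiseMultilinear (K : Type*) [TopologicalSpace K] [CompactSpace K] {n : ℕ}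
    (p : E [×n]→L[ℝ] F) : C(K, E) [×n]→L[ℝ] C(K, F) :=
  MultilinearMap.mkContinuous
    { toFun := fun m ↦ ⟨fun s ↦ p fun i ↦ m i s, by fun_prop⟩
      map_update_add' := fun m i x y ↦ by
        ext s
        have h : ∀ z : C(K, E), (fun j ↦ (Function.update m i z) j s)
            = Function.update (fun j ↦ m j s) i (z s) := fun z ↦ by
          ext j; rcases eq_or_ne j i with rfl | hj <;> simp [*]
        simp [h]
      map_update_smul' := fun m i c x ↦ by
        ext s
        have h : ∀ z : C(K, E), (fun j ↦ (Function.update m i z) j s)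
            = Function.update (fun j ↦ m j s) i (z s) := fun z ↦ by
          ext j; rcases eq_or_ne j i with rfl | hj <;> simp [*]
        simp [h] }
    ‖p‖ fun m ↦ by
      refine (ContinuousMap.norm_le _ (by positivity)).2 fun s ↦ (p.le_opNorm _).trans ?_
      gcongr with i
      exact (m i).norm_coe_le_norm s

/-- Composition with an analytic map is analytic on spaces of continuous functions. -/
theorem exists_analyticAt_superposition [CompleteSpace F] {g : E → F} {x₀ : E}
    (hg : AnalyticAt ℝ g x₀) :
    ∃ N : C(K, E) → C(K, F), AnalyticAt ℝ N 0 ∧ ∀ᶠ y in 𝓝 0, ∀ s, N y s = g (x₀ + y s) := by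
  obtain ⟨p, r, hp⟩ := hg
  -- The Taylor series of `g` acts pointwise, with coefficients of no larger norm in the supremum
  -- norm, so it converges at least on the same ball. `N` is its sum and represents superposition
  -- with `g` near `0` only.
  let P : FormalMultilinearSeries ℝ C(K, E) C(K, F) := fun n ↦ pointwiseMultilinear K (p n)
  have hr : p.radius ≤ P.radius := FormalMultilinearSeries.radius_le_of_le fun n ↦
    MultilinearMap.mkContinuous_norm_le _ (by positivity) _
  have hP := P.hasFPowerSeriesOnBall (hp.r_pos.trans_le (hp.r_le.trans hr))
  refine ⟨P.sum, hP.analyticAt, ?_⟩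
  filter_upwards [Metric.eball_mem_nhds 0 hp.r_pos] with y hy s
  have h1 := (hP.hasSum (Metric.eball_subset_eball (hp.r_le.trans hr) hy)).mapL
    (ContinuousMap.evalCLM ℝ s)
  have h2 : HasSum (fun n ↦ p n fun _ ↦ y s) (g (x₀ + y s)) := by
    refine hp.hasSum ?_
    rw [Metric.mem_eball, edist_zero_right] at hy ⊢
    refine lt_of_le_of_lt ?_ hy
    rw [← ofReal_norm, ← ofReal_norm]
    exact ENNReal.ofReal_le_ofReal (y.norm_coe_le_norm s)
  rw [zero_add] at h1
  exact h1.unique h2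

/-- Pointwise application of operator-valued functions. -/
def pointwiseApply (p : C(K, E →L[ℝ] F) × C(K, E)) : C(K, F) :=
  ⟨fun s ↦ p.1 s (p.2 s), by fun_prop⟩

theorem isBoundedBilinearMap_pointwiseApply :
    IsBoundedBilinearMap ℝ (pointwiseApply : C(K, E →L[ℝ] F) × C(K, E) → C(K, F)) where
  add_left _ _ _ := by ext; simp [pointwiseApply]
  smul_left _ _ _ := by ext; simp [pointwiseApply]
  add_right _ _ _ := by ext; simp [pointwiseApply]
  smul_right _ _ _ := by ext; simp [pointwiseApply]
  bound := ⟨1, one_pos, fun A w ↦ by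
    refine (ContinuousMap.norm_le _ (by positivity)).2 fun s ↦ ((A s).le_opNorm _).trans ?_
    rw [one_mul]
    gcongr
    · exact A.norm_coe_le_norm s
    · exact w.norm_coe_le_norm s⟩

theorem contDiffAt_pointwiseApply {H : Type*} [NormedAddCommGroup H] [NormedSpace ℝ H] {n : ℕ∞ω}
    {A : H → C(K, E →L[ℝ] F)} {w : H → C(K, E)} {x : H} (hA : ContDiffAt ℝ n A x)
    (hw : ContDiffAt ℝ n w x) : ContDiffAt ℝ n (fun x ↦ pointwiseApply (A x, w x)) x :=
  ContDiffAt.comp x (g := pointwiseApply) (f := fun x ↦ (A x, w x))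
    isBoundedBilinearMap_pointwiseApply.contDiff.contDiffAt (hA.prodMk hw)

/-- The extension of a function on the unit interval by constants. -/
def extendI (w : C(I, E)) : ℝ → E := IccExtend zero_le_one w

omit [NormedSpace ℝ E] in
theorem continuous_extendI (w : C(I, E)) : Continuous (extendI w) := w.continuous.Icc_extend'

omit [NormedSpace ℝ E] in
theorem extendI_of_mem (w : C(I, E)) {t : ℝ} (ht : t ∈ Icc (0 : ℝ) 1) :
    extendI w t = w ⟨t, ht⟩ := IccExtend_of_mem _ _ ht

omit [NormedSpace ℝ E] in
theorem norm_extendI_le (w : C(I, E)) (t : ℝ) : ‖extendI w t‖ ≤ ‖w‖ := w.norm_coe_le_norm _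

/-- The primitive that vanishes at `0`. -/
def primI (w : C(I, E)) (t : ℝ) : E := ∫ x in (0 : ℝ)..t, extendI w x

theorem primI_zero (w : C(I, E)) : primI w 0 = 0 := by simp [primI]

theorem norm_primI_le (w : C(I, E)) {t : ℝ} (ht : t ∈ Icc (0 : ℝ) 1) : ‖primI w t‖ ≤ ‖w‖ := by
  refine (intervalIntegral.norm_integral_le_of_norm_le_const (C := ‖w‖)
    fun x _ ↦ norm_extendI_le w x).trans ?_
  rw [sub_zero, abs_of_nonneg ht.1]
  exact mul_le_of_le_one_right (norm_nonneg _) ht.2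

variable [CompleteSpace E]

theorem hasDerivAt_primI (w : C(I, E)) (t : ℝ) : HasDerivAt (primI w) (extendI w t) t :=
  (continuous_extendI w).integral_hasStrictDerivAt 0 t |>.hasDerivAt

/-- The primitive as an operator on continuous functions. -/
def primitiveI (E : Type*) [NormedAddCommGroup E] [NormedSpace ℝ E] [CompleteSpace E] :
    C(I, E) →L[ℝ] C(I, E) :=
  LinearMap.mkContinuous
    { toFun := fun w ↦ ⟨fun s ↦ primI w s, by
        have : Continuous (primI w) :=
          continuous_iff_continuousAt.2 fun t ↦ (hasDerivAt_primI w t).continuousAt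
        fun_prop⟩
      map_add' := fun v w ↦ by
        ext s
        exact intervalIntegral.integral_add ((continuous_extendI v).intervalIntegrable _ _)
          ((continuous_extendI w).intervalIntegrable _ _)
      map_smul' := fun c w ↦ by
        ext s
        exact intervalIntegral.integral_smul c (extendI w) }
    1 fun w ↦ by
      rw [one_mul]
      exact (ContinuousMap.norm_le _ (by positivity)).2 fun s ↦ norm_primI_le w s.2

theorem primitiveI_apply (w : C(I, E)) (s : I) : primitiveI E w s = primI w s := rfl

end FunctionSpace

/-! ### Analytic dependence of the geodesic velocity on its initial value -/

section AnalyticExponential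

open unitInterval

variable {E : Type*} [NormedAddCommGroup E] [NormedSpace ℝ E] [CompleteSpace E]

/-- The geodesic equation for the velocity `w` with initial value `v` reads `w = v - ∫ Γ(x₀ + ∫w)(w,
w)`, with integrals from `0`. It is solved on the fixed interval `[0,1]` for small `v` by the
analytic implicit function theorem in `C([0,1], E)`: the nonlinear term is quadratic in `w`, so the
partial derivative in `w` at the origin is the identity. -/
theorem exists_analytic_velocity {Γ : E → E →L[ℝ] E →L[ℝ] E} {x₀ : E} (hΓ : AnalyticAt ℝ Γ x₀) :
    ∃ ψ : E → C(I, E), AnalyticAt ℝ ψ 0 ∧ ψ 0 = 0 ∧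
      HasFDerivAt ψ (ContinuousLinearMap.const ℝ I) 0 ∧
      ∀ᶠ v in 𝓝 0, ∃ g : C(I, E), (∀ s : I, g s =
          Γ (x₀ + primI (ψ v) s) (ψ v s) (ψ v s)) ∧ ∀ s : I, ψ v s = v - primI g s := by
  obtain ⟨N, hN, hNe⟩ := exists_analyticAt_superposition (K := I) hΓ
  let Q : C(I, E) → C(I, E) := fun w ↦
    pointwiseApply (pointwiseApply (N (primitiveI E w), w), w)
  have hP0 : primitiveI E (0 : C(I, E)) = 0 := map_zero _
  have hNP : AnalyticAt ℝ (fun w ↦ N (primitiveI E w)) 0 := by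
    have : AnalyticAt ℝ N (primitiveI E 0) := by rwa [hP0]
    exact this.comp ((primitiveI E).analyticAt 0)
  have hQ1 : ContDiffAt ℝ ω (fun w ↦ pointwiseApply (N (primitiveI E w), w)) 0 :=
    contDiffAt_pointwiseApply hNP.contDiffAt contDiffAt_id
  have hQ : ContDiffAt ℝ ω Q 0 := contDiffAt_pointwiseApply hQ1 contDiffAt_id
  have hQ1d := (hQ1.differentiableAt (𝕜 := ℝ) (by simp)).hasFDerivAt
  -- Product rule at `w = 0`: each term still contains a factor that vanishes there.
  have hQd : HasFDerivAt Q (0 : C(I, E) →L[ℝ] C(I, E)) 0 := by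
    have h := (isBoundedBilinearMap_pointwiseApply (K := I) (E := E) (F := E)).hasFDerivAt
      ((pointwiseApply (N (primitiveI E 0), 0), 0) : C(I, E →L[ℝ] E) × C(I, E))
    have h2 := HasFDerivAt.comp (0 : C(I, E)) (g := pointwiseApply) (f := fun w ↦
      (pointwiseApply (N (primitiveI E w), w), w)) h (hQ1d.prodMk (hasFDerivAt_id (𝕜 := ℝ) (0 : C(I, E))))
    refine h2.congr_fderiv ?_
    ext w s
    simp [pointwiseApply]
  let G : E × C(I, E) → C(I, E) := fun p ↦
    p.2 - ContinuousLinearMap.const ℝ I p.1 + primitiveI E (Q p.2)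
  have hG : ContDiffAt ℝ ω G (0, 0) := by
    have h1 : ContDiffAt ℝ ω (fun p : E × C(I, E) ↦ Q p.2) (0, 0) :=
      ContDiffAt.comp (0, 0) (g := Q) hQ contDiffAt_snd
    exact (contDiffAt_snd.sub ((ContinuousLinearMap.contDiff _).contDiffAt.comp _
      contDiffAt_fst)).add ((primitiveI E).contDiff.contDiffAt.comp _ h1)
  have hGd : HasFDerivAt G (ContinuousLinearMap.snd ℝ E C(I, E)
      - (ContinuousLinearMap.const ℝ I).comp (ContinuousLinearMap.fst ℝ E C(I, E))) (0, 0) := by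
    have h1 : HasFDerivAt (fun p : E × C(I, E) ↦ Q p.2) _ (0, 0) :=
      HasFDerivAt.comp (0, 0) (g := Q) hQd hasFDerivAt_snd
    have h2 := (hasFDerivAt_snd.sub ((ContinuousLinearMap.const ℝ I).hasFDerivAt.comp _
      hasFDerivAt_fst)).add ((primitiveI E).hasFDerivAt.comp _ h1)
    refine h2.congr_fderiv ?_
    ext w <;> simp
  have hinr : fderiv ℝ G (0, 0) ∘L .inr ℝ E C(I, E) = ContinuousLinearMap.id ℝ _ := by
    rw [hGd.fderiv]; ext w; simp
  have hinl : fderiv ℝ G (0, 0) ∘L .inl ℝ E C(I, E) = -ContinuousLinearMap.const ℝ I := by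
    rw [hGd.fderiv]; ext w; simp
  have hinv : (fderiv ℝ G (0, 0) ∘L .inr ℝ E C(I, E)).IsInvertible := by
    rw [hinr]; exact ⟨ContinuousLinearEquiv.refl ℝ _, rfl⟩
  have hG0 : G (0, 0) = 0 := by
    ext s; simp [G, Q, pointwiseApply, primitiveI_apply, primI, extendI, IccExtend]
  have hω : (ω : ℕ∞ω) ≠ 0 := by simp
  refine ⟨hG.implicitFunction hω hinv, (hG.contDiffAt_implicitFunction hω hinv).analyticAt,
    hG.implicitFunction_apply_self hω hinv, ?_, ?_⟩
  · have := (hG.hasStrictFDerivAt_implicitFunction hω hinv).hasFDerivAt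
    refine this.congr_fderiv ?_
    rw [hinr, hinl]
    simp
  · have h1 := hG.eventually_apply_implicitFunction hω hinv
    have h2 := (hG.contDiffAt_implicitFunction hω hinv).continuousAt
    have h3 : Tendsto (fun v ↦ primitiveI E (hG.implicitFunction hω hinv v)) (𝓝 0) (𝓝 0) := by
      have := (primitiveI E).continuous.continuousAt.comp (x := (0 : E)) h2
      rw [ContinuousAt, Function.comp_apply, hG.implicitFunction_apply_self hω hinv, hP0] at this
      exact this
    filter_upwards [h1, h3.eventually hNe] with v hv hNv
    refine ⟨Q (hG.implicitFunction hω hinv v), fun s ↦ ?_, fun s ↦ ?_⟩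
    · simp only [Q, pointwiseApply, ContinuousMap.coe_mk, hNv s]
      rfl
    · rw [hG0] at hv
      have := congrArg (fun w : C(I, E) ↦ w s) hv
      simp only [G, ContinuousMap.add_apply, ContinuousMap.sub_apply, ContinuousMap.zero_apply,
        primitiveI_apply] at this
      rw [sub_add_eq_add_sub, sub_eq_zero] at this
      exact eq_sub_of_add_eq this

end AnalyticExponential

/-! ### An analytic exponential map in a chart -/

section AnalyticExponential

open unitInterval

variable {E : Type*} [NormedAddCommGroup E] [NormedSpace ℝ E] [CompleteSpace E]

/-- The geodesic equation as a first order system. -/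
def geodesicField (Γ : E → E →L[ℝ] E →L[ℝ] E) (p : E × E) : E × E := (p.2, -Γ p.1 p.2 p.2)

omit [CompleteSpace E] in
theorem contDiffAt_geodesicField {Γ : E → E →L[ℝ] E →L[ℝ] E} {n : ℕ∞ω} {p : E × E}
    (hΓ : ContDiffAt ℝ n Γ p.1) : ContDiffAt ℝ n (geodesicField Γ) p := by
  have h : ContDiffAt ℝ n (fun q : E × E ↦ Γ q.1) p := ContDiffAt.comp p hΓ contDiffAt_fst
  exact contDiffAt_snd.prodMk ((h.clm_apply contDiffAt_snd).clm_apply contDiffAt_snd).neg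

/-- Existence of an exponential map at `x₀` for analytic Christoffel symbols: an analytic map with
identity differential at `0` whose restrictions to rays solve the geodesic equation. -/
theorem exists_analytic_exp {Γ : E → E →L[ℝ] E →L[ℝ] E} {x₀ : E} (hΓ : AnalyticAt ℝ Γ x₀) :
    ∃ Ex : E → E, AnalyticAt ℝ Ex 0 ∧ Ex 0 = x₀ ∧ fderiv ℝ Ex 0 = ContinuousLinearMap.id ℝ E ∧
      ∀ᶠ w in 𝓝 0, fderiv ℝ (fderiv ℝ Ex) w w w
        + Γ (Ex w) (fderiv ℝ Ex w w) (fderiv ℝ Ex w w) = 0 := by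
  obtain ⟨ψ, hψ, hψ0, hψd, hψe⟩ := exists_analytic_velocity hΓ
  -- The exponential map is the position at time `1`, the integral of the velocity curve.
  set Ex : E → E := fun v ↦ x₀ + primI (ψ v) 1 with hEx
  have hExa : AnalyticAt ℝ Ex 0 :=
    analyticAt_const.add (((ContinuousMap.evalCLM ℝ (1 : I)).comp (primitiveI E)).analyticAt _
      |>.comp hψ)
  have hExd : fderiv ℝ Ex 0 = ContinuousLinearMap.id ℝ E := by
    have h := ((((ContinuousMap.evalCLM ℝ (1 : I)).comp (primitiveI E)).hasFDerivAt).comp _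
      hψd).const_add x₀
    refine h.fderiv.trans ?_
    ext v
    simp only [ContinuousLinearMap.comp_apply, ContinuousMap.evalCLM_apply, primitiveI_apply, primI]
    simp [extendI, IccExtend]
  -- A Lipschitz neighbourhood of `(x₀, 0)` in phase space; all curves below stay in it, so that
  -- uniqueness for the first-order system is available.
  obtain ⟨κ, T, hT, hlip⟩ := (contDiffAt_geodesicField (p := (x₀, 0))
    (hΓ.contDiffAt (n := 1))).exists_lipschitzOnWith
  obtain ⟨ρ, hρ, hρT⟩ := Metric.mem_nhds_iff.1 hT
  have hsmall : ∀ᶠ v in 𝓝 (0 : E), ‖ψ v‖ < ρ := by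
    have := hψ.continuousAt.norm
    rw [ContinuousAt, hψ0, norm_zero] at this
    exact this.eventually (gt_mem_nhds hρ)
  obtain ⟨δ, hδ, hball⟩ := Metric.eventually_nhds_iff_ball.1 (hψe.and hsmall)
  have hode : ∀ v ∈ Metric.ball (0 : E) δ, ∀ t ∈ Icc (0 : ℝ) 1,
      HasDerivWithinAt (extendI (ψ v))
        (-Γ (x₀ + primI (ψ v) t) (extendI (ψ v) t) (extendI (ψ v) t)) (Icc 0 1) t := by
    intro v hv t ht
    obtain ⟨g, hg1, hg2⟩ := (hball v hv).1
    have h1 : HasDerivWithinAt (fun t ↦ v - primI g t) (-extendI g t) (Icc 0 1) t :=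
      ((hasDerivAt_primI g t).const_sub v).hasDerivWithinAt
    have h2 : ∀ s ∈ Icc (0 : ℝ) 1, extendI (ψ v) s = v - primI g s := fun s hs ↦ by
      rw [extendI_of_mem _ hs, hg2]
    rw [extendI_of_mem (ψ v) ht, ← hg1 ⟨t, ht⟩, ← extendI_of_mem g ht]
    exact h1.congr h2 (h2 t ht)
  have hinit : ∀ v ∈ Metric.ball (0 : E) δ, extendI (ψ v) 0 = v := by
    intro v hv
    obtain ⟨g, hg1, hg2⟩ := (hball v hv).1
    rw [extendI_of_mem _ (by simp), hg2]
    simp [primI_zero]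
  -- The factor `c` allows for the velocity of a curve reparametrized by `t ↦ c t`.
  have hmem : ∀ v ∈ Metric.ball (0 : E) δ, ∀ t ∈ Icc (0 : ℝ) 1, ∀ c ∈ Icc (0 : ℝ) 1,
      (x₀ + primI (ψ v) t, c • extendI (ψ v) t) ∈ T := by
    intro v hv t ht c hc
    refine hρT ?_
    rw [← ball_prod_same]
    have h1 := (hball v hv).2
    refine ⟨?_, ?_⟩
    · simpa using (norm_primI_le _ ht).trans_lt h1
    · rw [mem_ball_zero_iff, norm_smul, Real.norm_of_nonneg hc.1]
      exact (mul_le_of_le_one_left (norm_nonneg _) hc.2).trans_lt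
        ((norm_extendI_le _ _).trans_lt h1)
  -- Homogeneity of geodesics: the curve with initial velocity `τ v` and the curve of `v` run at
  -- speed `τ` have the same initial data, hence agree. So `Ex` restricted to a ray traces one
  -- geodesic.
  have hscale : ∀ v ∈ Metric.ball (0 : E) δ, ∀ τ ∈ Icc (0 : ℝ) 1,
      Ex (τ • v) = x₀ + primI (ψ v) τ := by
    intro v hv τ hτ
    have hτv : τ • v ∈ Metric.ball (0 : E) δ := by
      rw [mem_ball_zero_iff] at hv ⊢
      rw [norm_smul, Real.norm_of_nonneg hτ.1]
      exact (mul_le_of_le_one_left (norm_nonneg _) hτ.2).trans_lt hv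
    have hmaps : MapsTo (fun t ↦ τ * t) (Icc (0 : ℝ) 1) (Icc 0 1) := fun t ht ↦
      ⟨mul_nonneg hτ.1 ht.1, mul_le_one₀ hτ.2 ht.1 ht.2⟩
    have hmul : ∀ t, HasDerivWithinAt (fun t ↦ τ * t) τ (Icc (0 : ℝ) 1) t := fun t ↦ by
      simpa using ((hasDerivAt_id t).const_mul τ).hasDerivWithinAt
    have hf : ∀ t ∈ Icc (0 : ℝ) 1, HasDerivWithinAt
        (fun t ↦ (x₀ + primI (ψ (τ • v)) t, extendI (ψ (τ • v)) t))
        (geodesicField Γ (x₀ + primI (ψ (τ • v)) t, extendI (ψ (τ • v)) t)) (Icc 0 1) t :=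
      fun t ht ↦ ((hasDerivAt_primI _ t).const_add x₀).hasDerivWithinAt.prodMk (hode _ hτv t ht)
    have hg : ∀ t ∈ Icc (0 : ℝ) 1, HasDerivWithinAt
        (fun t ↦ (x₀ + primI (ψ v) (τ * t), τ • extendI (ψ v) (τ * t)))
        (geodesicField Γ (x₀ + primI (ψ v) (τ * t), τ • extendI (ψ v) (τ * t))) (Icc 0 1) t := by
      intro t ht
      have h1 := (((hasDerivAt_primI (ψ v) (τ * t)).hasDerivWithinAt (s := Icc 0 1)).scomp t
        (hmul t) hmaps).const_add x₀
      have h2 := ((hode v hv (τ * t) (hmaps ht)).scomp t (hmul t) hmaps).const_smul τ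
      refine (h1.prodMk h2).congr_deriv ?_
      simp [geodesicField]
    have huniq := ODE_solution_unique_of_mem_Icc_right (v := fun _ ↦ geodesicField Γ)
      (s := fun _ ↦ T) (K := κ) (a := 0) (b := 1) (fun _ _ ↦ hlip)
      (fun t ht ↦ (hf t ht).continuousWithinAt)
      (fun t ht ↦ (hf t (Ico_subset_Icc_self ht)).mono_of_mem_nhdsWithin
        (Icc_mem_nhdsGE_of_mem ht))
      (fun t ht ↦ by simpa using hmem _ hτv t (Ico_subset_Icc_self ht) 1 (by simp))
      (fun t ht ↦ (hg t ht).continuousWithinAt)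
      (fun t ht ↦ (hg t (Ico_subset_Icc_self ht)).mono_of_mem_nhdsWithin
        (Icc_mem_nhdsGE_of_mem ht))
      (fun t ht ↦ hmem v hv _ (hmaps (Ico_subset_Icc_self ht)) τ hτ)
      (by simp [primI_zero, hinit _ hτv, hinit _ hv]) (right_mem_Icc.2 zero_le_one)
    simpa [hEx] using congrArg Prod.fst huniq
  refine ⟨Ex, hExa, by simp [hEx, hψ0, primI, extendI, IccExtend], hExd, ?_⟩
  obtain ⟨V, hVe, hVo, hV0⟩ := eventually_nhds_iff.1 hExa.eventually_analyticAt
  have hExV : ContDiffOn ℝ ∞ Ex V := fun v hv ↦ (hVe v hv).contDiffAt.contDiffWithinAt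
  filter_upwards [hVo.mem_nhds hV0, Metric.ball_mem_nhds 0 (half_pos hδ)] with w hwV hw
  -- The solutions live on the closed interval `[0,1]`. Viewing `w` as time `1/2` on the ray of `2w`
  -- makes it an interior time, where two-sided derivatives exist; the factor `4` this produces in
  -- the equation cancels.
  have hv : (2 : ℝ) • w ∈ Metric.ball (0 : E) δ := by
    rw [mem_ball_zero_iff] at hw ⊢
    rw [norm_smul, Real.norm_of_nonneg zero_le_two]
    linarith
  have hw2 : (1 / 2 : ℝ) • (2 : ℝ) • w = w := by rw [smul_smul]; norm_num
  have hwV' : (1 / 2 : ℝ) • (2 : ℝ) • w ∈ V := by rwa [hw2]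
  have hIoo : Ioo (0 : ℝ) 1 ∈ 𝓝 (1 / 2 : ℝ) := Ioo_mem_nhds (by norm_num) (by norm_num)
  have e1 : (fun τ : ℝ ↦ Ex (τ • (2 : ℝ) • w)) =ᶠ[𝓝 (1 / 2)]
      fun τ ↦ x₀ + primI (ψ ((2 : ℝ) • w)) τ := by
    filter_upwards [hIoo] with τ hτ using hscale _ hv τ (Ioo_subset_Icc_self hτ)
  have e2 : deriv (fun τ : ℝ ↦ Ex (τ • (2 : ℝ) • w)) =ᶠ[𝓝 (1 / 2)]
      extendI (ψ ((2 : ℝ) • w)) := by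
    filter_upwards [e1.eventually_nhds] with τ hτ
    rw [EventuallyEq.deriv_eq hτ, ((hasDerivAt_primI _ τ).const_add x₀).deriv]
  have e3 := (hasDerivAt_comp_smul hVo hExV hwV').deriv.symm.trans e2.eq_of_nhds
  have e4 := (fderiv_comp_smul_second hVo hExV hwV').symm.trans e2.deriv_eq
  rw [((hode _ hv (1 / 2) (by norm_num)).hasDerivAt (mem_of_superset hIoo Ioo_subset_Icc_self)).deriv,
    ← e3, ← e1.eq_of_nhds, hw2, eq_neg_iff_add_eq_zero] at e4
  simp only [map_smul, smul_apply] at e4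
  rw [← smul_add, ← smul_add] at e4
  exact (smul_eq_zero_iff_right two_ne_zero).1 ((smul_eq_zero_iff_right two_ne_zero).1 e4)

end AnalyticExponential

/-! ### Analyticity of parallel forms, and parity of analytic functions -/

section AnalyticForm

open unitInterval

/-- A function that is differentiable with total differential `dh = L h` for an analytic `L`
is analytic. -/
theorem analyticAt_of_total_differential {E : Type*} [NormedAddCommGroup E] [NormedSpace ℝ E]
    {H : Type*} [NormedAddCommGroup H] [NormedSpace ℝ H] [CompleteSpace H]
    {L : E → E →L[ℝ] H →L[ℝ] H} {h : E → H} {x₀ : E} (hL : AnalyticAt ℝ L x₀)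
    (hh : ∀ᶠ z in 𝓝 x₀, HasFDerivAt h ((L z).flip (h z)) z) : AnalyticAt ℝ h x₀ := by
  -- Along the ray `s ↦ x₀ + s u` the function `c(s) = h(x₀ + s u)` satisfies the linear Volterra
  -- equation `c = h(x₀) + T_u c` with `(T_u c)(s) = ∫₀ˢ L(x₀ + τu)(u) c(τ) dτ`. Here `T_u` is
  -- analytic in `u` and `T_0 = 0`, so `1 - T_u` is invertible with analytic inverse for small `u`.
  -- Then `h(x₀ + u) = c(1)` is analytic in `u`.
  obtain ⟨N, hN, hNe⟩ := exists_analyticAt_superposition (K := I) hL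
  let ray : E →L[ℝ] C(I, E) := LinearMap.mkContinuous
    { toFun := fun u ↦ ⟨fun s ↦ (s : ℝ) • u, by fun_prop⟩
      map_add' := fun u v ↦ by ext; simp
      map_smul' := fun c u ↦ by ext s; simp [smul_comm c] }
    1 fun u ↦ by
      refine (ContinuousMap.norm_le _ (by positivity)).2 fun s ↦ ?_
      simp only [LinearMap.coe_mk, AddHom.coe_mk, ContinuousMap.coe_mk, norm_smul,
        Real.norm_of_nonneg s.2.1]
      gcongr
      exact s.2.2
  have hray : ∀ u (s : I), ray u s = (s : ℝ) • u := fun _ _ ↦ rfl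
  let M : E → C(I, H →L[ℝ] H) := fun u ↦
    pointwiseApply (N (ray u), ContinuousLinearMap.const ℝ I u)
  have hNray : ContDiffAt ℝ ω (fun u ↦ N (ray u)) 0 := by
    have : AnalyticAt ℝ N (ray 0) := by rwa [map_zero]
    exact (this.comp (ray.analyticAt 0)).contDiffAt
  have hM : ContDiffAt ℝ ω M 0 :=
    contDiffAt_pointwiseApply hNray (ContinuousLinearMap.contDiff _).contDiffAt
  let A : C(I, H →L[ℝ] H) →L[ℝ] C(I, H) →L[ℝ] C(I, H) :=
    (isBoundedBilinearMap_pointwiseApply (K := I) (E := H) (F := H)).toContinuousLinearMap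
  let T : E → C(I, H) →L[ℝ] C(I, H) := fun u ↦ (primitiveI H).comp (A (M u))
  have hT : ContDiffAt ℝ ω T 0 :=
    contDiffAt_const.clm_comp (A.contDiff.contDiffAt.comp _ hM)
  have hT0 : T 0 = 0 := by
    have : M 0 = 0 := by ext; simp [M, pointwiseApply]
    simp [T, this]
  have hinv : AnalyticAt ℝ (fun u ↦ Ring.inverse (1 - T u)) 0 := by
    have h1 : AnalyticAt ℝ Ring.inverse ((1 : C(I, H) →L[ℝ] C(I, H)) - T 0) := by
      rw [hT0, sub_zero]
      exact analyticAt_inverse (𝕜 := ℝ) (1 : (C(I, H) →L[ℝ] C(I, H))ˣ)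
    exact h1.comp (f := fun u ↦ 1 - T u) (analyticAt_const.sub hT.analyticAt)
  have hunit : ∀ᶠ u in 𝓝 (0 : E), IsUnit (1 - T u) := by
    have h1 : ContinuousAt (fun u ↦ 1 - T u) 0 := continuousAt_const.sub hT.continuousAt
    refine h1.eventually ?_
    change ∀ᶠ y in 𝓝 (1 - T 0), IsUnit y
    rw [hT0, sub_zero]
    exact Units.isOpen.mem_nhds isUnit_one
  let G : E → H := fun u ↦ Ring.inverse (1 - T u) (ContinuousMap.const I (h x₀)) 1
  have hG : AnalyticAt ℝ G 0 := by
    have h1 : AnalyticAt ℝ (fun u ↦ Ring.inverse (1 - T u) (ContinuousMap.const I (h x₀))) 0 :=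
      ((ContinuousLinearMap.apply ℝ C(I, H) (ContinuousMap.const I (h x₀))).analyticAt _).comp hinv
    exact ((ContinuousMap.evalCLM ℝ (1 : I)).analyticAt _).comp h1
  obtain ⟨δ, hδ, hball⟩ := Metric.eventually_nhds_iff_ball.1 hh
  have hNev : ∀ᶠ u in 𝓝 (0 : E), ∀ s, N (ray u) s = L (x₀ + ray u s) := by
    have : Tendsto ray (𝓝 0) (𝓝 0) := by
      have := ray.continuous.tendsto 0
      rwa [map_zero] at this
    exact this.eventually hNe
  have hfin : ∀ᶠ u in 𝓝 (0 : E), h (x₀ + u) = G u := by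
    filter_upwards [hunit, hNev, Metric.ball_mem_nhds 0 hδ] with u hu hN' hub
    have hin : ∀ t ∈ Icc (0 : ℝ) 1, x₀ + t • u ∈ Metric.ball x₀ δ := fun t ht ↦ by
      rw [mem_ball_iff_norm, add_sub_cancel_left, norm_smul, Real.norm_of_nonneg ht.1]
      exact (mul_le_of_le_one_left (norm_nonneg _) ht.2).trans_lt (mem_ball_zero_iff.1 hub)
    have hder : ∀ t ∈ Icc (0 : ℝ) 1, HasDerivAt (fun t : ℝ ↦ h (x₀ + t • u))
        (L (x₀ + t • u) u (h (x₀ + t • u))) t := fun t ht ↦ by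
      have h1 : HasDerivAt (fun t : ℝ ↦ x₀ + t • u) u t := by
        simpa using ((hasDerivAt_id t).smul_const u).const_add x₀
      exact (hball _ (hin t ht)).comp_hasDerivAt t h1
    have hcont : ContinuousOn (fun t : ℝ ↦ h (x₀ + t • u)) (Icc 0 1) := fun t ht ↦
      (hder t ht).continuousAt.continuousWithinAt
    let c : C(I, H) := ⟨fun s ↦ h (x₀ + (s : ℝ) • u), hcont.domRestrict⟩
    have hc : (1 - T u) c = ContinuousMap.const I (h x₀) := by
      ext s
      have h1 : primI (A (M u) c) s = h (x₀ + (s : ℝ) • u) - h x₀ := by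
        have h2 : ∀ t ∈ uIcc (0 : ℝ) s, HasDerivAt (fun t : ℝ ↦ h (x₀ + t • u))
            (extendI (A (M u) c) t) t := by
          intro t ht
          rw [uIcc_of_le s.2.1] at ht
          have ht' : t ∈ Icc (0 : ℝ) 1 := ⟨ht.1, ht.2.trans s.2.2⟩
          rw [extendI_of_mem _ ht']
          have h3 : A (M u) c ⟨t, ht'⟩ = N (ray u) ⟨t, ht'⟩ u (h (x₀ + t • u)) := rfl
          rw [h3, hN', hray]
          exact hder t ht'
        have := intervalIntegral.integral_eq_sub_of_hasDerivAt h2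
          ((continuous_extendI _).intervalIntegrable _ _)
        simpa [primI] using this
      have h4 : T u c s = primI (A (M u) c) s := rfl
      have h5 : c s = h (x₀ + (s : ℝ) • u) := rfl
      simp [h4, h1, h5]
    have : c = Ring.inverse (1 - T u) (ContinuousMap.const I (h x₀)) := by
      rw [← hc, ← mul_apply_eq_comp, Ring.inverse_mul_cancel _ hu]
      rfl
    have h6 : G u = c 1 := by rw [this]
    rw [h6]
    change h (x₀ + u) = h (x₀ + ((1 : I) : ℝ) • u)
    simp
  have hcomp : AnalyticAt ℝ (fun z ↦ G (z - x₀)) x₀ := by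
    have : AnalyticAt ℝ G (x₀ - x₀) := by rwa [sub_self]
    exact this.comp (f := fun z ↦ z - x₀) (analyticAt_id.sub analyticAt_const)
  refine hcomp.congr ?_
  have : Tendsto (fun z ↦ z - x₀) (𝓝 x₀) (𝓝 0) := by
    have h1 : ContinuousAt (fun z ↦ z - x₀) x₀ := by fun_prop
    simpa [ContinuousAt] using h1
  filter_upwards [this.eventually hfin] with z hz
  rw [← hz, add_sub_cancel]

variable {E : Type*} [NormedAddCommGroup E] [NormedSpace ℝ E]

/-- The action of endomorphisms on bilinear forms, `(T · b)(u, v) = b(T u, v) + b(u, T v)`. -/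
def formAction (E : Type*) [NormedAddCommGroup E] [NormedSpace ℝ E] :
    (E →L[ℝ] E) →L[ℝ] (E →L[ℝ] E →L[ℝ] ℝ) →L[ℝ] (E →L[ℝ] E →L[ℝ] ℝ) :=
  letI fl : (E →L[ℝ] E →L[ℝ] ℝ) →L[ℝ] (E →L[ℝ] E →L[ℝ] ℝ) :=
    (ContinuousLinearMap.flipₗᵢ ℝ E E ℝ).toContinuousLinearEquiv.toContinuousLinearMap
  letI l : (E →L[ℝ] E) →L[ℝ] (E →L[ℝ] E →L[ℝ] ℝ) →L[ℝ] (E →L[ℝ] E →L[ℝ] ℝ) :=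
    (ContinuousLinearMap.compL ℝ E E (E →L[ℝ] ℝ)).flip
  l + (ContinuousLinearMap.compL ℝ _ _ _ fl) ∘L ((ContinuousLinearMap.compL ℝ _ _ _).flip fl) ∘L l

theorem formAction_apply (T : E →L[ℝ] E) (b : E →L[ℝ] E →L[ℝ] ℝ) (u v : E) :
    formAction E T b u v = b (T u) v + b u (T v) := by
  simp [formAction]

/-- A parallel bilinear form is analytic where the Christoffel symbols are. -/
theorem analyticAt_parallel_form [CompleteSpace E] {Γ : E → E →L[ℝ] E →L[ℝ] E}
    {h : E → E →L[ℝ] E →L[ℝ] ℝ} {x₀ : E} (hΓ : AnalyticAt ℝ Γ x₀)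
    (hh : ∀ᶠ z in 𝓝 x₀, DifferentiableAt ℝ h z)
    (hpar : ∀ᶠ z in 𝓝 x₀, ∀ w u v, fderiv ℝ h z w u v = h z (Γ z w u) v + h z u (Γ z w v)) :
    AnalyticAt ℝ h x₀ := by
  refine analyticAt_of_total_differential (L := fun z ↦ formAction E ∘L Γ z)
    (contDiffAt_const.clm_comp hΓ.contDiffAt : ContDiffAt ℝ ω _ _).analyticAt ?_
  filter_upwards [hh, hpar] with z h1 h2
  refine h1.hasFDerivAt.congr_fderiv ?_
  ext w u v
  simp [formAction_apply, h2]

/-- An analytic function on a symmetric interval whose odd derivatives at `0` vanish is even. -/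
theorem even_of_odd_iteratedDeriv {φ : ℝ → ℝ} {J : Set ℝ} (hJ : IsPreconnected J)
    (hneg : ∀ t ∈ J, -t ∈ J) (h0 : (0 : ℝ) ∈ J) (hφ : AnalyticOnNhd ℝ φ J)
    (hodd : ∀ n, Odd n → iteratedDeriv n φ 0 = 0) {t : ℝ} (ht : t ∈ J) : φ (-t) = φ t := by
  have hφn : AnalyticOnNhd ℝ (fun t ↦ φ (-t)) J := fun t ht ↦
    (hφ _ (hneg t ht)).comp (f := fun t ↦ -t) analyticAt_id.neg
  have hd := hφn.sub hφ
  -- All derivatives of `φ(-t) - φ(t)` vanish at `0`, the even ones by parity and the odd ones by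
  -- hypothesis. The zero of infinite order spreads over `J` by the identity theorem.
  have hz : ((fun t ↦ φ (-t)) - φ) =ᶠ[𝓝 0] 0 := by
    refine analyticOrderAt_eq_top.1 (ENat.eq_top_iff_forall_ge.2 fun n ↦ ?_)
    rw [natCast_le_analyticOrderAt_iff_iteratedDeriv_eq_zero (hd 0 h0)]
    intro i _
    rw [iteratedDeriv_sub ((hφn 0 h0).contDiffAt) ((hφ 0 h0).contDiffAt), iteratedDeriv_comp_neg,
      neg_zero]
    rcases Nat.even_or_odd i with hi | hi
    · simp [hi.neg_one_pow]
    · simp [hodd i hi]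
  have := hd.eqOn_zero_of_preconnected_of_eventuallyEq_zero hJ h0 hz ht
  simpa [sub_eq_zero] using this

end AnalyticForm

/-! ### Components of vector fields in a chart -/

section Charts

variable {E : Type*} [NormedAddCommGroup E] [NormedSpace ℝ E]
  {M : Type*} [TopologicalSpace M] [ChartedSpace E M]
  {e : OpenPartialHomeomorph M E}

/-- The components of tangent vectors at `y` in the chart `e`. -/
abbrev comps (e : OpenPartialHomeomorph M E) (y : M) : Tan E y →L[ℝ] E :=
  mvfderiv 𝓘(ℝ, E) e y

theorem mdifferentiable_of_mem_maximalAtlas (he : e ∈ IsManifold.maximalAtlas 𝓘(ℝ, E) ∞ M) :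
    e.MDifferentiable 𝓘(ℝ, E) 𝓘(ℝ, E) :=
  ⟨(contMDiffOn_of_mem_maximalAtlas he).mdifferentiableOn (by simp),
    (contMDiffOn_symm_of_mem_maximalAtlas he).mdifferentiableOn (by simp)⟩

theorem comps_comp_symm (he : e ∈ IsManifold.maximalAtlas 𝓘(ℝ, E) ∞ M) {z : E}
    (hz : z ∈ e.target) :
    comps e (e.symm z) ∘L (mfderiv 𝓘(ℝ, E) 𝓘(ℝ, E) e.symm z : E →L[ℝ] Tan E (e.symm z))
      = ContinuousLinearMap.id ℝ E :=
  (mdifferentiable_of_mem_maximalAtlas he).comp_symm_deriv hz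

theorem symm_comp_comps (he : e ∈ IsManifold.maximalAtlas 𝓘(ℝ, E) ∞ M) {z : E}
    (hz : z ∈ e.target) :
    (mfderiv 𝓘(ℝ, E) 𝓘(ℝ, E) e.symm z : E →L[ℝ] Tan E (e.symm z)) ∘L comps e (e.symm z)
      = ContinuousLinearMap.id ℝ _ := by
  have h := (mdifferentiable_of_mem_maximalAtlas he).symm_comp_deriv (e.map_target hz)
  rw [e.right_inv hz] at h
  exact h

theorem isInvertible_comps (he : e ∈ IsManifold.maximalAtlas 𝓘(ℝ, E) ∞ M) {y : M}
    (hy : y ∈ e.source) : (comps e y).IsInvertible := by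
  have h1 := comps_comp_symm he (e.map_source hy)
  have h2 := symm_comp_comps he (e.map_source hy)
  have := ContinuousLinearMap.IsInvertible.of_inverse h1 h2
  rwa [e.left_inv hy] at this

theorem inverse_mfderiv_symm (he : e ∈ IsManifold.maximalAtlas 𝓘(ℝ, E) ∞ M) {z : E}
    (hz : z ∈ e.target) :
    (mfderiv 𝓘(ℝ, E) 𝓘(ℝ, E) e.symm z : E →L[ℝ] Tan E (e.symm z)).inverse
      = comps e (e.symm z) :=
  ContinuousLinearMap.inverse_eq (symm_comp_comps he hz) (comps_comp_symm he hz)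

theorem comps_coordField (he : e ∈ IsManifold.maximalAtlas 𝓘(ℝ, E) ∞ M) {y : M}
    (hy : y ∈ e.source) (v : E) : comps e y (coordField e v y) = v :=
  (isInvertible_comps he hy).self_apply_inverse v

theorem coordField_comps (he : e ∈ IsManifold.maximalAtlas 𝓘(ℝ, E) ∞ M) {y : M}
    (hy : y ∈ e.source) (u : Tan E y) : coordField e (comps e y u) y = u :=
  (isInvertible_comps he hy).inverse_apply_self u

theorem coordField_add (e : OpenPartialHomeomorph M E) (u v : E) (y : M) :
    coordField e (u + v) y = coordField e u y + coordField e v y :=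
  map_add _ _ _

theorem coordField_smul (e : OpenPartialHomeomorph M E) (c : ℝ) (v : E) (y : M) :
    coordField e (c • v) y = c • coordField e v y :=
  map_smul _ _ _

theorem comps_injective (he : e ∈ IsManifold.maximalAtlas 𝓘(ℝ, E) ∞ M) {y : M}
    (hy : y ∈ e.source) : Function.Injective (comps e y) :=
  Function.LeftInverse.injective (isInvertible_comps he hy).inverse_apply_self

/-- The components of a vector field, as a function of the coordinates. -/
def rep (e : OpenPartialHomeomorph M E) (Y : Π y : M, Tan E y) (z : E) : E :=
  comps e (e.symm z) (Y (e.symm z))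

theorem rep_apply {y : M} (hy : y ∈ e.source)
    (Y : Π y : M, Tan E y) : rep e Y (e y) = comps e y (Y y) := by
  rw [rep, e.left_inv hy]

theorem rep_coordField (he : e ∈ IsManifold.maximalAtlas 𝓘(ℝ, E) ∞ M) {z : E}
    (hz : z ∈ e.target) (v : E) : rep e (coordField e v) z = v :=
  comps_coordField he (e.map_target hz) v

/-- The derivative of a function in terms of its coordinate expression. -/
theorem mvfderiv_eq_fderiv {F : Type*} [NormedAddCommGroup F] [NormedSpace ℝ F]
    (he : e ∈ IsManifold.maximalAtlas 𝓘(ℝ, E) ∞ M) {y : M}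
    (hy : y ∈ e.source) {g : E → F} (hg : DifferentiableAt ℝ g (e y)) (u : Tan E y) :
    mvfderiv 𝓘(ℝ, E) (fun y ↦ g (e y)) y u = fderiv ℝ g (e y) (comps e y u) := by
  have h := mfderiv_comp (I := 𝓘(ℝ, E)) (I' := 𝓘(ℝ, E)) (I'' := 𝓘(ℝ, F)) y
    (g := g) hg.mdifferentiableAt
    ((mdifferentiable_of_mem_maximalAtlas he).mdifferentiableAt hy)
  rw [mfderiv_eq_fderiv] at h
  exact congrArg (fun T : E →L[ℝ] F ↦ T u) h

variable [IsManifold 𝓘(ℝ, E) ∞ M] [CompleteSpace E]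

/-- The component function is the pullback of the field under the inverse chart, and pullback under
a local diffeomorphism preserves smoothness. -/
theorem contDiffAt_rep (he : e ∈ IsManifold.maximalAtlas 𝓘(ℝ, E) ∞ M) {z : E} (hz : z ∈ e.target)
    {Y : Π y : M, Tan E y}
    (hY : ContMDiffAt 𝓘(ℝ, E) (𝓘(ℝ, E).prod 𝓘(ℝ, E)) ∞
      (fun y ↦ (⟨y, Y y⟩ : TangentBundle 𝓘(ℝ, E) M)) (e.symm z)) :
    ContDiffAt ℝ ∞ (rep e Y) z := by
  have h1 := ContMDiffAt.mpullback_vectorField_preimage (n := ∞) hY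
    (contMDiffAt_symm_of_mem_maximalAtlas he hz)
    (ContinuousLinearMap.IsInvertible.of_inverse (symm_comp_comps he hz) (comps_comp_symm he hz))
    (by simp)
  rw [contMDiffAt_vectorSpace_iff_contDiffAt] at h1
  refine h1.congr_of_eventuallyEq ?_
  filter_upwards [e.open_target.mem_nhds hz] with w hw
  exact congrArg (fun T : Tan E (e.symm w) →L[ℝ] E ↦ T (Y (e.symm w)))
    (inverse_mfderiv_symm he hw).symm

theorem differentiableAt_rep (he : e ∈ IsManifold.maximalAtlas 𝓘(ℝ, E) ∞ M) {z : E}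
    (hz : z ∈ e.target) {Y : Π y : M, Tan E y} (hY : DiffFieldAt Y (e.symm z)) :
    DifferentiableAt ℝ (rep e Y) z := by
  have h1 := MDifferentiableAt.mpullback_vectorField (n := ∞) hY
    (contMDiffAt_symm_of_mem_maximalAtlas he hz)
    (ContinuousLinearMap.IsInvertible.of_inverse (symm_comp_comps he hz) (comps_comp_symm he hz))
    (by norm_cast)
  have h2 : DifferentiableAt ℝ (VectorField.mpullback 𝓘(ℝ, E) 𝓘(ℝ, E) e.symm Y) z :=
    MDifferentiableAt.differentiableAt
      ((contMDiff_snd_tangentBundle_modelSpace (n := 1) E 𝓘(ℝ, E)).contMDiffAt.mdifferentiableAt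
        one_ne_zero |>.comp _ h1)
  refine h2.congr_of_eventuallyEq ?_
  filter_upwards [e.open_target.mem_nhds hz] with w hw
  exact congrArg (fun T : Tan E (e.symm w) →L[ℝ] E ↦ T (Y (e.symm w)))
    (inverse_mfderiv_symm he hw).symm

theorem contMDiffAt_of_comps (he : e ∈ IsManifold.maximalAtlas 𝓘(ℝ, E) ∞ M) {y : M}
    (hy : y ∈ e.source) {G : E → E} (hG : ContDiffAt ℝ ∞ G (e y)) :
    ContMDiffAt 𝓘(ℝ, E) (𝓘(ℝ, E).prod 𝓘(ℝ, E)) ∞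
      (fun y ↦ (⟨y, (comps e y).inverse (G (e y))⟩ : TangentBundle 𝓘(ℝ, E) M)) y :=
  ContMDiffAt.mpullback_vectorField_preimage (n := ∞) (m := ∞)
    (V := (G : Π z : E, TangentSpace 𝓘(ℝ, E) z))
    (contMDiffAt_vectorSpace_iff_contDiffAt.2 hG)
    (contMDiffAt_of_mem_maximalAtlas he hy) (isInvertible_comps he hy) (by simp)

theorem contMDiffAt_coordField (he : e ∈ IsManifold.maximalAtlas 𝓘(ℝ, E) ∞ M) {y : M}
    (hy : y ∈ e.source) (v : E) :
    ContMDiffAt 𝓘(ℝ, E) (𝓘(ℝ, E).prod 𝓘(ℝ, E)) ∞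
      (fun y ↦ (⟨y, coordField e v y⟩ : TangentBundle 𝓘(ℝ, E) M)) y :=
  contMDiffAt_of_comps he hy contDiffAt_const

theorem diffFieldAt_coordField (he : e ∈ IsManifold.maximalAtlas 𝓘(ℝ, E) ∞ M) {y : M}
    (hy : y ∈ e.source) (v : E) : DiffFieldAt (coordField e v) y :=
  (contMDiffAt_coordField he hy v).mdifferentiableAt (by simp)

/-- Coordinate fields are pullbacks of constant fields on `E`, which commute, and pullback respects
brackets. -/
theorem mlieBracket_coordField (he : e ∈ IsManifold.maximalAtlas 𝓘(ℝ, E) ∞ M) {y : M}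
    (hy : y ∈ e.source) (u v : E) :
    VectorField.mlieBracket 𝓘(ℝ, E) (coordField e u) (coordField e v) y = 0 := by
  have : IsManifold 𝓘(ℝ, E) (minSmoothness ℝ 2) M := by
    rw [minSmoothness_of_isRCLikeNormedField]
    exact IsManifold.of_le (n := ∞) (by norm_cast)
  let X (w : E) : Π z : E, TangentSpace 𝓘(ℝ, E) z := fun _ ↦ w
  have hc (w : E) : MDifferentiableAt 𝓘(ℝ, E) (𝓘(ℝ, E).prod 𝓘(ℝ, E))
      (fun z ↦ (⟨z, X w z⟩ : TangentBundle 𝓘(ℝ, E) E)) (e y) :=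
    (contMDiffAt_vectorSpace_iff_contDiffAt (n := 1)).2 contDiffAt_const
      |>.mdifferentiableAt one_ne_zero
  have h := VectorField.mpullback_mlieBracket (n := ∞) (hc u) (hc v)
    (contMDiffAt_of_mem_maximalAtlas he hy) (by simp; norm_cast)
  have h0 : VectorField.mlieBracket 𝓘(ℝ, E) (X u) (X v) = 0 := by
    rw [← VectorField.mlieBracketWithin_univ, VectorField.mlieBracketWithin_eq_lieBracketWithin]
    ext z
    simp [VectorField.lieBracketWithin, X]
    rfl
  rw [h0, VectorField.mpullback_zero] at h
  exact h.symm

end Charts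

/-! ### Connection and symplectic form in a chart -/

section ChartConnection

variable {E : Type*} [NormedAddCommGroup E] [NormedSpace ℝ E] [FiniteDimensional ℝ E]
  {M : Type*} [TopologicalSpace M] [ChartedSpace E M] [IsManifold 𝓘(ℝ, E) ∞ M]
  {e : OpenPartialHomeomorph M E}

theorem connectionForm_apply (cov : Connection E M) (e : OpenPartialHomeomorph M E) (y : M)
    (u : Tan E y) (v : E) :
    connectionForm cov e y u v = ∑ i, (Module.finBasis ℝ E).repr v i •
      comps e y (cov (coordField e (Module.finBasis ℝ E i)) y u) := by
  simp [connectionForm, Module.Basis.constr_apply_fintype]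

/-- The Christoffel symbols of `∇` in the chart `e`, as a function of the coordinates. -/
def chr (cov : Connection E M) (e : OpenPartialHomeomorph M E) (z : E) : E →L[ℝ] E →L[ℝ] E :=
  LinearMap.toContinuousLinearMap
    { toFun u := connectionForm cov e (e.symm z) (coordField e u (e.symm z))
      map_add' u v := by
        ext w
        simp [connectionForm_apply, coordField_add, Finset.sum_add_distrib]
      map_smul' c u := by
        ext w
        simp [connectionForm_apply, coordField_smul, Finset.smul_sum, smul_comm c] }

theorem chr_apply (cov : Connection E M) (e : OpenPartialHomeomorph M E) (z u : E) :
    chr cov e z u = connectionForm cov e (e.symm z) (coordField e u (e.symm z)) := rfl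

theorem connectionForm_eq_chr (cov : Connection E M)
    (he : e ∈ IsManifold.maximalAtlas 𝓘(ℝ, E) ∞ M) {y : M} (hy : y ∈ e.source) (u : Tan E y) :
    connectionForm cov e y u = chr cov e (e y) (comps e y u) := by
  rw [chr_apply]
  -- The type of tangent vectors depends on the base point, so `e.symm (e y) = y` cannot be
  -- rewritten directly; the point is generalized first.
  have : ∀ y' : M, y' = y → ∀ u' : Tan E y, connectionForm cov e y u' =
      connectionForm cov e y' (coordField e (comps e y u') y') := by
    rintro _ rfl u'
    rw [coordField_comps he hy]
  exact this _ (e.left_inv hy) u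

omit [FiniteDimensional ℝ E] in
-- Leibniz rule for an expansion in a local frame; it reduces `∇` to its values on the coordinate
-- fields of a basis.
theorem cov_sum_smul (cov : Connection E M) {ι : Type*} (s : Finset ι)
    {f : ι → M → ℝ} {X : ι → Π y : M, Tan E y} {y : M} (u : Tan E y)
    (hf : ∀ i, MDifferentiableAt 𝓘(ℝ, E) 𝓘(ℝ, ℝ) (f i) y) (hX : ∀ i, DiffFieldAt (X i) y) :
    DiffFieldAt (∑ i ∈ s, f i • X i) y ∧
    cov (∑ i ∈ s, f i • X i) y u =
      ∑ i ∈ s, (f i y • cov (X i) y u + mvfderiv 𝓘(ℝ, E) (f i) y u • X i y) := by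
  classical
  induction s using Finset.induction_on with
  | empty =>
    rw [Finset.sum_empty]
    exact ⟨mdifferentiableAt_zeroSection .., by simp [cov.zero]⟩
  | insert i s hi ih =>
    have h1 : DiffFieldAt (f i • X i) y := (hf i).smul_section (hX i)
    refine ⟨?_, ?_⟩
    · rw [Finset.sum_insert hi]
      exact mdifferentiableAt_add_section h1 ih.1
    · rw [Finset.sum_insert hi, Finset.sum_insert hi,
        cov.isCovariantDerivativeOnUniv.add h1 ih.1,
        cov.isCovariantDerivativeOnUniv.leibniz (hX i) (hf i)]
      simp [ih.2]

/-- The local expression `∇_u Y = dY(u) + Γ(u) Y`. -/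
theorem comps_cov (cov : Connection E M) (he : e ∈ IsManifold.maximalAtlas 𝓘(ℝ, E) ∞ M) {y : M}
    (hy : y ∈ e.source) {Y : Π y : M, Tan E y} (hY : DiffFieldAt Y y) (u : Tan E y) :
    comps e y (cov Y y u) = fderiv ℝ (rep e Y) (e y) (comps e y u)
      + chr cov e (e y) (comps e y u) (comps e y (Y y)) := by
  have : CompleteSpace E := FiniteDimensional.complete ℝ E
  set b := Module.finBasis ℝ E with hb
  let c (i : Fin (Module.finrank ℝ E)) : E →L[ℝ] ℝ := LinearMap.toContinuousLinearMap (b.coord i)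
  have hrep : DifferentiableAt ℝ (rep e Y) (e y) :=
    differentiableAt_rep he (e.map_source hy) (by rwa [e.left_inv hy])
  have hc i : DifferentiableAt ℝ (fun z ↦ c i (rep e Y z)) (e y) :=
    (c i).differentiableAt.comp _ hrep
  have hf i : MDifferentiableAt 𝓘(ℝ, E) 𝓘(ℝ, ℝ) (fun y ↦ c i (rep e Y (e y))) y :=
    (hc i).mdifferentiableAt.comp (g := fun z ↦ c i (rep e Y z)) y
      ((mdifferentiable_of_mem_maximalAtlas he).mdifferentiableAt hy)
  obtain ⟨hd, hs⟩ := cov_sum_smul cov Finset.univ (X := fun i ↦ coordField e (b i)) u hf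
    fun i ↦ diffFieldAt_coordField he hy (b i)
  -- `∇Y` at `y` depends only on the germ of `Y`, and near `y` the field equals its expansion in the
  -- coordinate frame.
  have heq : cov Y y =
      cov (∑ i, (fun y ↦ c i (rep e Y (e y))) • coordField e (b i)) y := by
    refine cov.isCovariantDerivativeOnUniv.congr_of_eventuallyEq hY hd univ_mem ?_
    filter_upwards [e.open_source.mem_nhds hy] with x hx
    apply comps_injective he hx
    have : ∀ i, c i (comps e x (Y x)) = b.repr (comps e x (Y x)) i := fun i ↦ rfl
    simp [comps_coordField he hx, rep_apply hx, this, b.sum_repr]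
  rw [heq, hs, ← connectionForm_eq_chr cov he hy, connectionForm_apply, map_sum]
  have h2 : ∀ i, mvfderiv 𝓘(ℝ, E) (fun y ↦ c i (rep e Y (e y))) y u
      = b.repr (fderiv ℝ (rep e Y) (e y) (comps e y u)) i := fun i ↦ by
    rw [mvfderiv_eq_fderiv he hy (hc i)]
    have : HasFDerivAt (fun z ↦ c i (rep e Y z)) (c i ∘L fderiv ℝ (rep e Y) (e y)) (e y) :=
      (c i).hasFDerivAt.comp (e y) hrep.hasFDerivAt
    rw [this.fderiv]
    rfl
  have h3 : ∀ i, c i (rep e Y (e y)) = b.repr (comps e y (Y y)) i := fun i ↦ by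
    rw [rep_apply hy]; rfl
  simp only [map_add, map_smul, comps_coordField he hy, h2, h3, Finset.sum_add_distrib,
    b.sum_repr]
  exact add_comm _ _

/-- The Christoffel symbols are defined on a basis and extended linearly. As coordinate fields have
constant components, the derivative term of `comps_cov` vanishes, which gives the description for
every `v`. -/
theorem chr_apply_eq (cov : Connection E M) (he : e ∈ IsManifold.maximalAtlas 𝓘(ℝ, E) ∞ M) {z : E}
    (hz : z ∈ e.target) (u v : E) :
    chr cov e z u v =
      comps e (e.symm z) (cov (coordField e v) (e.symm z) (coordField e u (e.symm z))) := by
  have : CompleteSpace E := FiniteDimensional.complete ℝ E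
  have hy := e.map_target hz
  rw [comps_cov cov he hy (diffFieldAt_coordField he hy v), comps_coordField he hy,
    comps_coordField he hy, e.right_inv hz]
  have : rep e (coordField e v) =ᶠ[𝓝 z] fun _ ↦ v := by
    filter_upwards [e.open_target.mem_nhds hz] with w hw using rep_coordField he hw v
  simp [this.fderiv_eq]

/-- The covariant derivative of a field that is smooth near `x` is smooth near `x`. -/
theorem contMDiffAt_cov [T2Space M] (cov : Connection E M)
    [CovariantDerivative.ContMDiffCovariantDerivative cov ∞]
    {Y : Π y : M, Tan E y} {x : M} {s : Set M} (hs : s ∈ 𝓝 x)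
    (hY : ContMDiffOn 𝓘(ℝ, E) (𝓘(ℝ, E).prod 𝓘(ℝ, E)) ∞
      (fun y ↦ (⟨y, Y y⟩ : TangentBundle 𝓘(ℝ, E) M)) s) :
    ContMDiffAt 𝓘(ℝ, E) (𝓘(ℝ, E).prod 𝓘(ℝ, E →L[ℝ] E)) ∞
      (fun y ↦ (⟨y, cov Y y⟩ :
        TotalSpace (E →L[ℝ] E) fun y : M ↦ Tan E y →L[ℝ] Tan E y)) x := by
  obtain ⟨u, hus, huo, hxu⟩ := mem_nhds_iff.1 hs
  obtain ⟨f, hf, hfu⟩ := (SmoothBumpFunction.nhds_basis_tsupport (I := 𝓘(ℝ, E)) x).mem_iff.1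
    (huo.mem_nhds hxu)
  -- Smoothness of the connection is applied to global sections. A bump function equal to `1` near
  -- `x` makes the field global without changing its germs near `x`.
  have h1 : ContMDiff 𝓘(ℝ, E) (𝓘(ℝ, E).prod 𝓘(ℝ, E)) ∞
      (fun y ↦ (⟨y, ((f : M → ℝ) • Y) y⟩ : TangentBundle 𝓘(ℝ, E) M)) :=
    ContMDiffOn.smul_section_of_tsupport f.contMDiff.contMDiffOn huo hfu (hY.mono hus)
  have h2 := (CovariantDerivative.ContMDiffCovariantDerivative.contMDiff (cov := cov)
    (k := ∞)).contMDiff (σ := (f : M → ℝ) • Y) h1.contMDiffOn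
  refine (h2.contMDiffAt univ_mem (x := x)).congr_of_eventuallyEq ?_
  have hev : ∀ᶠ y in 𝓝 x, ∀ᶠ z in 𝓝 y, f z = 1 :=
    eventually_eventually_nhds.2 f.eventuallyEq_one
  filter_upwards [hev, huo.mem_nhds hxu] with y hy hyu
  congr 1
  refine cov.isCovariantDerivativeOnUniv.congr_of_eventuallyEq
    (((hY.mono hus).contMDiffAt (huo.mem_nhds hyu)).mdifferentiableAt (by simp))
    (h1.contMDiffAt.mdifferentiableAt (by simp)) univ_mem ?_
  filter_upwards [hy] with z hz
  simp [hz]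

theorem contDiffOn_chr [T2Space M] (cov : Connection E M)
    [CovariantDerivative.ContMDiffCovariantDerivative cov ∞]
    (he : e ∈ IsManifold.maximalAtlas 𝓘(ℝ, E) ∞ M) :
    ContDiffOn ℝ ∞ (chr cov e) e.target := by
  have : CompleteSpace E := FiniteDimensional.complete ℝ E
  refine contDiffOn_clm_apply.2 fun u ↦ contDiffOn_clm_apply.2 fun v z hz ↦ ?_
  have hy := e.map_target hz
  have h1 := contMDiffAt_cov cov (e.open_source.mem_nhds hy) (Y := coordField e v)
    fun y hy ↦ (contMDiffAt_coordField he hy v).contMDiffWithinAt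
  have h2 : ContMDiffAt 𝓘(ℝ, E) (𝓘(ℝ, E).prod 𝓘(ℝ, E)) ∞
      (fun y ↦ (⟨y, cov (coordField e v) y (coordField e u y)⟩ : TangentBundle 𝓘(ℝ, E) M))
      (e.symm z) := h1.clm_bundle_apply (contMDiffAt_coordField he hy u)
  refine ((contDiffAt_rep he hz h2).congr_of_eventuallyEq ?_).contDiffWithinAt
  filter_upwards [e.open_target.mem_nhds hz] with w hw using chr_apply_eq cov he hw u v

/-- Coordinate fields commute, so vanishing torsion is symmetry of the Christoffel symbols. -/
theorem chr_symm {cov : Connection E M} {Ω : SymplecticForm E M}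
    (hcov : IsSymplecticConnection Ω cov) (he : e ∈ IsManifold.maximalAtlas 𝓘(ℝ, E) ∞ M) {z : E}
    (hz : z ∈ e.target) (u v : E) : chr cov e z u v = chr cov e z v u := by
  have : CompleteSpace E := FiniteDimensional.complete ℝ E
  have hy := e.map_target hz
  have h := cov.torsion_eq_zero_iff.1 hcov.torsion_free (diffFieldAt_coordField he hy u)
    (diffFieldAt_coordField he hy v)
  rw [mlieBracket_coordField he hy, sub_eq_zero] at h
  rw [chr_apply_eq cov he hz, chr_apply_eq cov he hz, h]

/-- The symplectic form in the chart `e`, as a function of the coordinates. -/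
def formRep (Ω : SymplecticForm E M) (e : OpenPartialHomeomorph M E) (z : E) :
    E →L[ℝ] E →L[ℝ] ℝ :=
  (ContinuousLinearMap.precomp ℝ (comps e (e.symm z)).inverse) ∘L Ω.form (e.symm z) ∘L
    (comps e (e.symm z)).inverse

omit [FiniteDimensional ℝ E] in
theorem formRep_apply (Ω : SymplecticForm E M) (e : OpenPartialHomeomorph M E) (z u v : E) :
    formRep Ω e z u v
      = Ω.form (e.symm z) (coordField e u (e.symm z)) (coordField e v (e.symm z)) := rfl

omit [FiniteDimensional ℝ E] in
theorem formRep_comps (Ω : SymplecticForm E M) (he : e ∈ IsManifold.maximalAtlas 𝓘(ℝ, E) ∞ M)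
    {y : M} (hy : y ∈ e.source) (u v : Tan E y) :
    formRep Ω e (e y) (comps e y u) (comps e y v) = Ω.form y u v := by
  rw [formRep_apply]
  have : ∀ y' : M, y' = y → Ω.form y' (coordField e (comps e y u) y')
      (coordField e (comps e y v) y') = Ω.form y u v := by
    rintro _ rfl
    rw [coordField_comps he hy, coordField_comps he hy]
  exact this _ (e.left_inv hy)

theorem contDiffOn_formRep (Ω : SymplecticForm E M)
    (he : e ∈ IsManifold.maximalAtlas 𝓘(ℝ, E) ∞ M) : ContDiffOn ℝ ∞ (formRep Ω e) e.target := by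
  have : CompleteSpace E := FiniteDimensional.complete ℝ E
  refine contDiffOn_clm_apply.2 fun u ↦ contDiffOn_clm_apply.2 fun v z hz ↦ ?_
  have hy := e.map_target hz
  have h1 : ContMDiffAt 𝓘(ℝ, E) (𝓘(ℝ, E).prod 𝓘(ℝ, ℝ)) ∞
      (fun y ↦ TotalSpace.mk' ℝ (E := Bundle.Trivial M ℝ) y
        (Ω.form y (coordField e u y) (coordField e v y))) (e.symm z) :=
    ContMDiffAt.clm_bundle_apply₂ (F₁ := E) (F₂ := E) Ω.smooth.contMDiffAt
      (contMDiffAt_coordField he hy u) (contMDiffAt_coordField he hy v)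
  rw [contMDiffAt_totalSpace] at h1
  have h2 : ContMDiffAt 𝓘(ℝ, E) 𝓘(ℝ, ℝ) ∞
      (fun y ↦ Ω.form y (coordField e u y) (coordField e v y)) (e.symm z) := h1.2
  exact ((h2.comp z (contMDiffAt_symm_of_mem_maximalAtlas he hz)).contDiffAt).contDiffWithinAt

/-- This is `∇ω = 0` evaluated on coordinate fields, whose covariant derivatives are the Christoffel
symbols. -/
theorem fderiv_formRep {Ω : SymplecticForm E M} {cov : Connection E M}
    (hcov : IsSymplecticConnection Ω cov) (he : e ∈ IsManifold.maximalAtlas 𝓘(ℝ, E) ∞ M) {z : E}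
    (hz : z ∈ e.target) (w u v : E) :
    fderiv ℝ (formRep Ω e) z w u v
      = formRep Ω e z (chr cov e z w u) v + formRep Ω e z u (chr cov e z w v) := by
  have : CompleteSpace E := FiniteDimensional.complete ℝ E
  have hy := e.map_target hz
  have hd : DifferentiableAt ℝ (formRep Ω e) z :=
    ((contDiffOn_formRep Ω he).contDiffAt (e.open_target.mem_nhds hz)).differentiableAt (by simp)
  have hd2 : HasFDerivAt (fun z ↦ formRep Ω e z u v)
      (((ContinuousLinearMap.apply ℝ ℝ v) ∘L (ContinuousLinearMap.apply ℝ _ u)) ∘L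
        fderiv ℝ (formRep Ω e) z) z :=
    (((ContinuousLinearMap.apply ℝ ℝ v) ∘L
      (ContinuousLinearMap.apply ℝ (E →L[ℝ] ℝ) u)).hasFDerivAt).comp z hd.hasFDerivAt
  have hp := hcov.parallel (e.symm z) _ _ (diffFieldAt_coordField he hy u)
    (diffFieldAt_coordField he hy v) (coordField e w (e.symm z))
  have h1 : mvfderiv 𝓘(ℝ, E) (fun y ↦ Ω.form y (coordField e u y) (coordField e v y)) (e.symm z)
      = mvfderiv 𝓘(ℝ, E) (fun y ↦ formRep Ω e (e y) u v) (e.symm z) := by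
    have : (fun y ↦ Ω.form y (coordField e u y) (coordField e v y)) =ᶠ[𝓝 (e.symm z)]
        fun y ↦ formRep Ω e (e y) u v := by
      filter_upwards [e.open_source.mem_nhds hy] with y hy'
      rw [formRep_apply, e.left_inv hy']
    simp only [mvfderiv]
    rw [this.mfderiv_eq, this.eq_of_nhds]
    rfl
  have hd3 : DifferentiableAt ℝ (fun z ↦ formRep Ω e z u v) (e (e.symm z)) := by
    rw [e.right_inv hz]; exact hd2.differentiableAt
  rw [h1, mvfderiv_eq_fderiv he hy hd3, comps_coordField he hy, e.right_inv hz, hd2.fderiv,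
    ← formRep_comps Ω he hy, ← formRep_comps Ω he hy, e.right_inv hz, comps_coordField he hy,
    comps_coordField he hy, ← chr_apply_eq cov he hz, ← chr_apply_eq cov he hz] at hp
  exact hp

end ChartConnection

/-! ### Invariance of the recursion under linear maps -/

section RecConj

variable {V W : Type*} [AddCommGroup V] [Module ℝ V] [FiniteDimensional ℝ V]
  [AddCommGroup W] [Module ℝ W] [FiniteDimensional ℝ W]

/-- Pairing with `B` moves the adjoint to the other argument, so `P^r` can be compared between `T_x
M` and `E` without transporting adjoints. -/
theorem recP_form_apply (B : LinearMap.BilinForm ℝ V) (hB : B.Nondegenerate)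
    (D : ℕ → Module.End ℝ V) (r : ℕ) (u v : V) :
    B (recP B hB D r u) v = (r + 2) • B (recQ D r u) v
      + ∑ q ∈ Finset.Icc 2 ((r - 1) / 2), ((r + 2).choose (q + 1)) •
        B (recQ D (r - q) u) (recQ D q v) := by
  have hadj : ∀ (T : Module.End ℝ V) u v,
      B (B.leftAdjointOfNondegenerate hB T u) v = B u (T v) := fun T u v ↦
    B.isAdjointPairLeftAdjointOfNondegenerate hB T u v
  simp [recP, LinearMap.sum_apply, hadj]
  ring

theorem recP_form_conj (L : V →ₗ[ℝ] W) {B : LinearMap.BilinForm ℝ V} (hB : B.Nondegenerate)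
    {B' : LinearMap.BilinForm ℝ W} (hB' : B'.Nondegenerate)
    (hBB : ∀ u v, B u v = B' (L u) (L v))
    {D : ℕ → Module.End ℝ V} {D' : ℕ → Module.End ℝ W} (h : ∀ k u, L (D k u) = D' k (L u))
    (r : ℕ) (u v : V) : B (recP B hB D r u) v = B' (recP B' hB' D' r (L u)) (L v) := by
  rw [recP_form_apply, recP_form_apply]
  simp only [hBB, recQ_conj L h]

end RecConj

/-! ### Curvature in a chart and change of charts -/

section Transition

variable {E : Type*} [NormedAddCommGroup E] [NormedSpace ℝ E] [FiniteDimensional ℝ E]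
  {M : Type*} [TopologicalSpace M] [ChartedSpace E M] [IsManifold 𝓘(ℝ, E) ∞ M]
  {e e₀ : OpenPartialHomeomorph M E}

theorem diffFieldAt_cov_apply [T2Space M] (cov : Connection E M)
    [CovariantDerivative.ContMDiffCovariantDerivative cov ∞] {Z Y : Π y : M, Tan E y} {x : M}
    {s : Set M} (hs : s ∈ 𝓝 x)
    (hZ : ContMDiffOn 𝓘(ℝ, E) (𝓘(ℝ, E).prod 𝓘(ℝ, E)) ∞
      (fun y ↦ (⟨y, Z y⟩ : TangentBundle 𝓘(ℝ, E) M)) s) (hY : DiffFieldAt Y x) :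
    DiffFieldAt (fun y ↦ cov Z y (Y y)) x :=
  (mdifferentiableAt_cov cov hs hZ).clm_bundle_apply hY

/-- The curvature in a chart. -/
theorem comps_curvature [T2Space M] {Ω : SymplecticForm E M} {cov : Connection E M}
    [CovariantDerivative.ContMDiffCovariantDerivative cov ∞]
    (hcov : IsSymplecticConnection Ω cov) (he : e ∈ IsManifold.maximalAtlas 𝓘(ℝ, E) ∞ M) {y : M}
    (hy : y ∈ e.source) (u w v : Tan E y) :
    comps e y (curvature cov y u w v)
      = curvLoc (chr cov e) (e y) (comps e y u) (comps e y w) (comps e y v) := by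
  have : CompleteSpace E := FiniteDimensional.complete ℝ E
  obtain ⟨s, hs, hZs⟩ := FiberBundle.exists_contMDiffOn_extend (k := ∞) 𝓘(ℝ, E) E w
  set X : Π y : M, Tan E y := FiberBundle.extend E u with hX
  set Z : Π y : M, Tan E y := FiberBundle.extend E w with hZ
  -- The definition fixes the extensions of `u` and `w`. In the middle slot the expression is
  -- tensorial, so an extension with constant components may be chosen.
  set Y : Π y : M, Tan E y := coordField e (comps e y v) with hY
  have hXy : X y = u := by simp [hX]
  have hZy : Z y = w := by simp [hZ]
  have hYy : Y y = v := coordField_comps he hy v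
  have dX : DiffFieldAt X y := FiberBundle.mdifferentiableAt_extend 𝓘(ℝ, E) E u
  have dY : DiffFieldAt Y y := diffFieldAt_coordField he hy _
  have dZ : ∀ᶠ y' in 𝓝 y, DiffFieldAt Z y' := by
    filter_upwards [eventually_mem_nhds_iff.2 hs] with y' hy'
    exact (hZs.contMDiffAt hy').mdifferentiableAt (by simp)
  have htend : Tendsto e.symm (𝓝 (e y)) (𝓝 y) := e.tendsto_symm hy
  have hz : e y ∈ e.target := e.map_source hy
  have hev : ∀ᶠ z in 𝓝 (e y), z ∈ e.target ∧ DiffFieldAt Z (e.symm z) :=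
    (e.open_target.eventually_mem hz).and (htend.eventually dZ)
  have cZ : ContDiffAt ℝ ∞ (rep e Z) (e y) := by
    refine contDiffAt_rep he hz ?_
    rw [e.left_inv hy]
    exact hZs.contMDiffAt hs
  have cX : DifferentiableAt ℝ (rep e X) (e y) :=
    differentiableAt_rep he hz (by rwa [e.left_inv hy])
  have cY : rep e Y =ᶠ[𝓝 (e y)] fun _ ↦ comps e y v := by
    filter_upwards [e.open_target.mem_nhds hz] with z hz using rep_coordField he hz _
  have cΓ : DifferentiableAt ℝ (chr cov e) (e y) :=
    ((contDiffOn_chr cov he).contDiffAt (e.open_target.mem_nhds hz)).differentiableAt (by simp)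
  have cdZ : DifferentiableAt ℝ (fderiv ℝ (rep e Z)) (e y) :=
    (cZ.fderiv_right (m := 1) (by norm_cast)).differentiableAt one_ne_zero
  have hinner (W : Π y : M, Tan E y) : rep e (fun y ↦ cov Z y (W y)) =ᶠ[𝓝 (e y)]
      fun z ↦ fderiv ℝ (rep e Z) z (rep e W z) + chr cov e z (rep e W z) (rep e Z z) := by
    filter_upwards [hev] with z hz
    have := comps_cov cov he (e.map_target hz.1) hz.2 (W (e.symm z))
    rwa [e.right_inv hz.1] at this
  have hder (W : Π y : M, Tan E y) (hW : DifferentiableAt ℝ (rep e W) (e y)) (a : E) :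
      fderiv ℝ (rep e (fun y ↦ cov Z y (W y))) (e y) a =
        (fderiv ℝ (fderiv ℝ (rep e Z)) (e y) a (rep e W (e y))
          + fderiv ℝ (rep e Z) (e y) (fderiv ℝ (rep e W) (e y) a))
        + ((fderiv ℝ (chr cov e) (e y) a (rep e W (e y))
          + chr cov e (e y) (fderiv ℝ (rep e W) (e y) a)) (rep e Z (e y))
          + chr cov e (e y) (rep e W (e y)) (fderiv ℝ (rep e Z) (e y) a)) := by
    have h1 := cdZ.hasFDerivAt.clm_apply hW.hasFDerivAt
    have h2 := (cΓ.hasFDerivAt.clm_apply hW.hasFDerivAt).clm_apply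
      (cZ.differentiableAt (by simp)).hasFDerivAt
    rw [(hinner W).fderiv_eq, (h1.fun_add h2).fderiv]
    simp only [add_apply, ContinuousLinearMap.comp_apply, ContinuousLinearMap.flip_apply]
    abel
  have dXi := diffFieldAt_cov_apply cov hs hZs dX
  have dYi := diffFieldAt_cov_apply cov hs hZs dY
  -- Torsion-freeness replaces the bracket by `∇_X Y - ∇_Y X`; in coordinates the derivatives of `X`
  -- then cancel.
  have hbr := cov.torsion_eq_zero_iff.1 hcov.torsion_free dX dY
  have hcurv : curvature cov y u w v = curvatureField cov X Y Z y := by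
    rw [← hYy]
    exact TensorialAt.mkHom_apply (curvatureField_tensorialAt cov y u w) dY
  have dcY : DifferentiableAt ℝ (rep e Y) (e y) :=
    cY.symm.differentiableAt_iff.1 (differentiableAt_const _)
  have hZ' := fun a ↦ comps_cov cov he hy dZ.self_of_nhds a
  rw [hcurv, curvatureField, ← hbr, map_sub, map_sub, comps_cov cov he hy dYi,
    comps_cov cov he hy dXi, hZ' (_ - _), hZ' (X y), hZ' (Y y), map_sub (comps e y) (cov Y y (X y)),
    comps_cov cov he hy dY, comps_cov cov he hy dX, hder Y dcY, hder X cX,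
    cY.fderiv_eq, curvLoc_apply]
  simp only [rep_apply hy, hXy, hYy, hZy]
  have hsymm : fderiv ℝ (fderiv ℝ (rep e Z)) (e y) (comps e y u) (comps e y v)
      = fderiv ℝ (fderiv ℝ (rep e Z)) (e y) (comps e y v) (comps e y u) :=
    (cZ.isSymmSndFDerivAt (by simp; norm_cast)).eq _ _
  have hsy : chr cov e (e y) (comps e y u) (comps e y v)
      = chr cov e (e y) (comps e y v) (comps e y u) := chr_symm hcov he hz _ _
  rw [hsymm]
  simp [map_add, hsy]
  abel

/-- The matrix of the change of components from the chart `e₀` to the chart `e`. -/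
def transition (e₀ e : OpenPartialHomeomorph M E) (z : E) : E →L[ℝ] E :=
  comps e (e.symm z) ∘L (comps e₀ (e.symm z)).inverse

omit [FiniteDimensional ℝ E] [IsManifold 𝓘(ℝ, E) ∞ M] in
theorem transition_apply (e₀ e : OpenPartialHomeomorph M E) (z v : E) :
    transition e₀ e z v = rep e (coordField e₀ v) z := rfl

omit [FiniteDimensional ℝ E] [IsManifold 𝓘(ℝ, E) ∞ M] in
theorem transition_comps (he₀ : e₀ ∈ IsManifold.maximalAtlas 𝓘(ℝ, E) ∞ M) {y : M}
    (hy₀ : y ∈ e₀.source) (hy : y ∈ e.source) (u : Tan E y) :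
    transition e₀ e (e y) (comps e₀ y u) = comps e y u := by
  rw [transition_apply, rep_apply hy, coordField_comps he₀ hy₀]

theorem contDiffAt_transition (he₀ : e₀ ∈ IsManifold.maximalAtlas 𝓘(ℝ, E) ∞ M)
    (he : e ∈ IsManifold.maximalAtlas 𝓘(ℝ, E) ∞ M) :
    ContDiffOn ℝ ∞ (transition e₀ e) (e.target ∩ e.symm ⁻¹' e₀.source) := by
  have : CompleteSpace E := FiniteDimensional.complete ℝ E
  refine contDiffOn_clm_apply.2 fun v z hz ↦ ?_
  exact (contDiffAt_rep he hz.1 (contMDiffAt_coordField he₀ hz.2 v)).contDiffWithinAt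

theorem differentiableAt_transition (he₀ : e₀ ∈ IsManifold.maximalAtlas 𝓘(ℝ, E) ∞ M)
    (he : e ∈ IsManifold.maximalAtlas 𝓘(ℝ, E) ∞ M) {y : M} (hy₀ : y ∈ e₀.source)
    (hy : y ∈ e.source) : DifferentiableAt ℝ (transition e₀ e) (e y) := by
  have hopen := e.symm.isOpen_inter_preimage e₀.open_source
  refine ((contDiffAt_transition he₀ he).contDiffAt (hopen.mem_nhds ?_)).differentiableAt (by simp)
  exact ⟨e.map_source hy, by simpa [e.left_inv hy] using hy₀⟩

/-- The transformation law of the Christoffel symbols. -/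
theorem connectionForm_transition (cov : Connection E M)
    (he₀ : e₀ ∈ IsManifold.maximalAtlas 𝓘(ℝ, E) ∞ M)
    (he : e ∈ IsManifold.maximalAtlas 𝓘(ℝ, E) ∞ M) {y : M} (hy₀ : y ∈ e₀.source)
    (hy : y ∈ e.source) (u : Tan E y) (v : E) :
    transition e₀ e (e y) (connectionForm cov e₀ y u v)
      = fderiv ℝ (transition e₀ e) (e y) (comps e y u) v
        + chr cov e (e y) (comps e y u) (transition e₀ e (e y) v) := by
  have : CompleteSpace E := FiniteDimensional.complete ℝ E
  have h1 : connectionForm cov e₀ y u v = comps e₀ y (cov (coordField e₀ v) y u) := by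
    have hz₀ := e₀.map_source hy₀
    have : rep e₀ (coordField e₀ v) =ᶠ[𝓝 (e₀ y)] fun _ ↦ v := by
      filter_upwards [e₀.open_target.mem_nhds hz₀] with w hw using rep_coordField he₀ hw v
    rw [connectionForm_eq_chr cov he₀ hy₀,
      comps_cov cov he₀ hy₀ (diffFieldAt_coordField he₀ hy₀ v), comps_coordField he₀ hy₀,
      this.fderiv_eq]
    simp
  -- The covariant derivative of a coordinate field of `e₀` is computed a second time in `e`, where
  -- its components are the transition matrix applied to `v`.
  rw [h1, transition_comps he₀ hy₀ hy, comps_cov cov he hy (diffFieldAt_coordField he₀ hy₀ v),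
    transition_apply, rep_apply hy]
  congr 1
  have h2 : HasFDerivAt (rep e (coordField e₀ v))
      ((ContinuousLinearMap.apply ℝ E v) ∘L fderiv ℝ (transition e₀ e) (e y)) (e y) :=
    ((ContinuousLinearMap.apply ℝ E v).hasFDerivAt).comp (e y)
      (differentiableAt_transition he₀ he hy₀ hy).hasFDerivAt
  rw [h2.fderiv]
  rfl

end Transition

/-! ### Fields along curves in an arbitrary chart -/

section Curves

variable {E : Type*} [NormedAddCommGroup E] [NormedSpace ℝ E] [FiniteDimensional ℝ E]
  {M : Type*} [TopologicalSpace M] [ChartedSpace E M] [IsManifold 𝓘(ℝ, E) ∞ M]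
  {e : OpenPartialHomeomorph M E} {γ : ℝ → M} {t : ℝ}

/-- The matrix `Γ(γ')` of the covariant derivative along `γ` in the chart `e`. -/
def curveMatrix (cov : Connection E M) (e : OpenPartialHomeomorph M E) (γ : ℝ → M) (s : ℝ) :
    E →L[ℝ] E :=
  chr cov e (e (γ s)) (deriv (fun τ ↦ e (γ τ)) s)

/-- The matrix of a field of endomorphisms along `γ` in the chart `e`. -/
def endRep (e : OpenPartialHomeomorph M E) (γ : ℝ → M)
    (A : Π s : ℝ, Tan E (γ s) →L[ℝ] Tan E (γ s)) (s : ℝ) : E →L[ℝ] E :=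
  comps e (γ s) ∘L A s ∘L (comps e (γ s)).inverse

omit [FiniteDimensional ℝ E] [IsManifold 𝓘(ℝ, E) ∞ M] in
theorem hasDerivAt_chart_comp (he : e ∈ IsManifold.maximalAtlas 𝓘(ℝ, E) ∞ M)
    (hγ : MDifferentiableAt 𝓘(ℝ, ℝ) 𝓘(ℝ, E) γ t) (hy : γ t ∈ e.source) :
    HasDerivAt (fun s ↦ e (γ s)) (comps e (γ t) (velocity γ t)) t := by
  have he' := (mdifferentiable_of_mem_maximalAtlas he).mdifferentiableAt hy
  have h : HasFDerivAt (fun s ↦ e (γ s)) ((mfderiv 𝓘(ℝ, E) 𝓘(ℝ, E) e (γ t)).comp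
      (mfderiv 𝓘(ℝ, ℝ) 𝓘(ℝ, E) γ t) : ℝ →L[ℝ] E) t :=
    (he'.hasMFDerivAt.comp t hγ.hasMFDerivAt).hasFDerivAt
  have hd : ∀ D : ℝ →L[ℝ] E, HasFDerivAt (fun s ↦ e (γ s)) D t →
      HasDerivAt (fun s ↦ e (γ s)) (D 1) t := fun D h ↦ h.hasDerivAt
  exact hd _ h

omit [FiniteDimensional ℝ E] [IsManifold 𝓘(ℝ, E) ∞ M] in
theorem comps_velocity (he : e ∈ IsManifold.maximalAtlas 𝓘(ℝ, E) ∞ M)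
    (hγ : MDifferentiableAt 𝓘(ℝ, ℝ) 𝓘(ℝ, E) γ t) (hy : γ t ∈ e.source) :
    comps e (γ t) (velocity γ t) = deriv (fun s ↦ e (γ s)) t :=
  (hasDerivAt_chart_comp he hγ hy).deriv.symm

theorem differentiableAt_transition_comp {e₀ : OpenPartialHomeomorph M E}
    (he₀ : e₀ ∈ IsManifold.maximalAtlas 𝓘(ℝ, E) ∞ M)
    (he : e ∈ IsManifold.maximalAtlas 𝓘(ℝ, E) ∞ M) (hγ : MDifferentiableAt 𝓘(ℝ, ℝ) 𝓘(ℝ, E) γ t)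
    (hy₀ : γ t ∈ e₀.source) (hy : γ t ∈ e.source) :
    HasDerivAt (fun s ↦ transition e₀ e (e (γ s)))
      (fderiv ℝ (transition e₀ e) (e (γ t)) (comps e (γ t) (velocity γ t))) t :=
  (differentiableAt_transition he₀ he hy₀ hy).hasFDerivAt.comp_hasDerivAt
    (l := transition e₀ e) (f := fun s ↦ e (γ s)) t (hasDerivAt_chart_comp he hγ hy)

/-- The covariant derivative along a curve in an arbitrary chart. -/
theorem comps_covDerivAlong (cov : Connection E M) (he : e ∈ IsManifold.maximalAtlas 𝓘(ℝ, E) ∞ M)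
    (hγ : MDifferentiableAt 𝓘(ℝ, ℝ) 𝓘(ℝ, E) γ t) (hy : γ t ∈ e.source)
    {V : Π s : ℝ, Tan E (γ s)} (hV : DifferentiableAt ℝ (fun s ↦ comps e (γ s) (V s)) t) :
    comps e (γ t) (covDerivAlong cov γ V t)
      = covCurve (curveMatrix cov e γ) (fun s ↦ comps e (γ s) (V s)) t := by
  -- The defining chart varies with `t`, which obstructs iteration. In a fixed chart `e`, the
  -- derivative of the transition matrix is absorbed by the inhomogeneous term of the transformation
  -- law.
  set e₀ := chartAt E (γ t) with hdef
  have he₀ : e₀ ∈ IsManifold.maximalAtlas 𝓘(ℝ, E) ∞ M := IsManifold.chart_mem_maximalAtlas _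
  have hy₀ : γ t ∈ e₀.source := mem_chart_source E (γ t)
  have hev : ∀ᶠ s in 𝓝 t, γ s ∈ e.source ∧ γ s ∈ e₀.source :=
    hγ.continuousAt.eventually
      ((e.open_source.eventually_mem hy).and (e₀.open_source.eventually_mem hy₀))
  have dV₀ : DifferentiableAt ℝ (fun s ↦ comps e₀ (γ s) (V s)) t := by
    refine (((differentiableAt_transition_comp he he₀ hγ hy hy₀).differentiableAt).clm_apply
      hV).congr_of_eventuallyEq ?_
    filter_upwards [hev] with s hs using (transition_comps he hs.1 hs.2 (V s)).symm
  have heq : (fun s ↦ comps e (γ s) (V s)) =ᶠ[𝓝 t]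
      fun s ↦ transition e₀ e (e (γ s)) (comps e₀ (γ s) (V s)) := by
    filter_upwards [hev] with s hs using (transition_comps he₀ hs.2 hs.1 (V s)).symm
  have hder := heq.deriv_eq.trans
    ((differentiableAt_transition_comp he₀ he hγ hy₀ hy).clm_apply dV₀.hasDerivAt).deriv
  have h0 : comps e₀ (γ t) (covDerivAlong cov γ V t)
      = deriv (fun s ↦ comps e₀ (γ s) (V s)) t
        + connectionForm cov e₀ (γ t) (velocity γ t) (comps e₀ (γ t) (V t)) :=
    comps_coordField he₀ hy₀ _
  rw [← transition_comps he₀ hy₀ hy, h0, map_add, connectionForm_transition cov he₀ he hy₀ hy,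
    covCurve, hder, transition_comps he₀ hy₀ hy, curveMatrix, comps_velocity he hγ hy]
  abel

omit [FiniteDimensional ℝ E] [IsManifold 𝓘(ℝ, E) ∞ M] in
theorem endRep_comps (he : e ∈ IsManifold.maximalAtlas 𝓘(ℝ, E) ∞ M)
    (hy : γ t ∈ e.source) (A : Π s : ℝ, Tan E (γ s) →L[ℝ] Tan E (γ s)) (u : Tan E (γ t)) :
    endRep e γ A t (comps e (γ t) u) = comps e (γ t) (A t u) := by
  change comps e (γ t) (A t (coordField e (comps e (γ t) u) (γ t))) = _
  rw [coordField_comps he hy]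

/-- The covariant derivative of an endomorphism field along a curve in an arbitrary chart. -/
theorem endRep_covDerivEndAlong (cov : Connection E M)
    (he : e ∈ IsManifold.maximalAtlas 𝓘(ℝ, E) ∞ M)
    (hγ : MDifferentiableAt 𝓘(ℝ, ℝ) 𝓘(ℝ, E) γ t) (hy : γ t ∈ e.source)
    {A : Π s : ℝ, Tan E (γ s) →L[ℝ] Tan E (γ s)} (hA : DifferentiableAt ℝ (endRep e γ A) t) :
    endRep e γ (covDerivEndAlong cov γ A) t
      = covCurveEnd (curveMatrix cov e γ) (endRep e γ A) t := by
  set e₀ := chartAt E (γ t) with hdef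
  have he₀ : e₀ ∈ IsManifold.maximalAtlas 𝓘(ℝ, E) ∞ M := IsManifold.chart_mem_maximalAtlas _
  have hy₀ : γ t ∈ e₀.source := mem_chart_source E (γ t)
  have hev : ∀ᶠ s in 𝓝 t, γ s ∈ e.source ∧ γ s ∈ e₀.source :=
    hγ.continuousAt.eventually
      ((e.open_source.eventually_mem hy).and (e₀.open_source.eventually_mem hy₀))
  have hT := differentiableAt_transition_comp he₀ he hγ hy₀ hy
  have hcomps : ∀ s, γ s ∈ e.source ∧ γ s ∈ e₀.source → ∀ w : E,
      ∃ u : Tan E (γ s), comps e₀ (γ s) u = w := fun s hs w ↦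
    ⟨coordField e₀ w (γ s), comps_coordField he₀ hs.2 w⟩
  have dB₀ : DifferentiableAt ℝ (endRep e₀ γ A) t := by
    refine (((differentiableAt_transition_comp he he₀ hγ hy hy₀).differentiableAt).clm_comp
      (hA.clm_comp hT.differentiableAt)).congr_of_eventuallyEq ?_
    filter_upwards [hev] with s hs
    ext w
    obtain ⟨u, rfl⟩ := hcomps s hs w
    simp only [ContinuousLinearMap.comp_apply]
    rw [endRep_comps he₀ hs.2, transition_comps he₀ hs.2 hs.1, endRep_comps he hs.1,
      transition_comps he hs.1 hs.2]
  -- The change of matrix is written as an intertwining relation, so that differentiating it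
  -- involves no inverse.
  have hcomm : (fun s ↦ endRep e γ A s ∘L transition e₀ e (e (γ s))) =ᶠ[𝓝 t]
      fun s ↦ transition e₀ e (e (γ s)) ∘L endRep e₀ γ A s := by
    filter_upwards [hev] with s hs
    ext w
    obtain ⟨u, rfl⟩ := hcomps s hs w
    simp only [ContinuousLinearMap.comp_apply]
    rw [endRep_comps he₀ hs.2, transition_comps he₀ hs.2 hs.1, endRep_comps he hs.1,
      transition_comps he₀ hs.2 hs.1]
  have hderiv := hcomm.deriv_eq
  rw [(hA.hasDerivAt.clm_comp hT).deriv, (hT.clm_comp dB₀.hasDerivAt).deriv] at hderiv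
  have h0 : ∀ u, comps e₀ (γ t) (covDerivEndAlong cov γ A t u)
      = (deriv (endRep e₀ γ A) t + connectionForm cov e₀ (γ t) (velocity γ t) ∘L endRep e₀ γ A t
        - endRep e₀ γ A t ∘L connectionForm cov e₀ (γ t) (velocity γ t)) (comps e₀ (γ t) u) :=
    fun u ↦ comps_coordField he₀ hy₀ _
  ext v
  obtain ⟨u, rfl⟩ : ∃ u : Tan E (γ t), comps e (γ t) u = v :=
    ⟨coordField e v (γ t), comps_coordField he hy v⟩
  have hd := congrArg (fun S : E →L[ℝ] E ↦ S (comps e₀ (γ t) u)) hderiv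
  have hc : ∀ w, transition e₀ e (e (γ t)) (endRep e₀ γ A t w)
      = endRep e γ A t (transition e₀ e (e (γ t)) w) := fun w ↦
    (congrArg (fun S : E →L[ℝ] E ↦ S w) hcomm.eq_of_nhds).symm
  simp only [add_apply, ContinuousLinearMap.comp_apply, transition_comps he₀ hy₀ hy] at hd
  rw [endRep_comps he hy, ← transition_comps he₀ hy₀ hy, h0]
  simp only [covCurveEnd, add_apply, sub_apply, ContinuousLinearMap.comp_apply, map_add, map_sub,
    connectionForm_transition cov he₀ he hy₀ hy, hc, transition_comps he₀ hy₀ hy]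
  rw [comps_velocity he hγ hy] at hd ⊢
  simp only [curveMatrix]
  rw [eq_sub_of_add_eq' hd.symm]
  abel

omit [FiniteDimensional ℝ E] [IsManifold 𝓘(ℝ, E) ∞ M] in
theorem contDiffOn_chart_comp (he : e ∈ IsManifold.maximalAtlas 𝓘(ℝ, E) ∞ M) {I : Set ℝ}
    (hγ : ContMDiffOn 𝓘(ℝ, ℝ) 𝓘(ℝ, E) ∞ γ I) (hm : MapsTo γ I e.source) :
    ContDiffOn ℝ ∞ (fun s ↦ e (γ s)) I :=
  ((contMDiffOn_of_mem_maximalAtlas he).comp hγ hm).contDiffOn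

/-- The geodesic equation in a chart. -/
theorem covDerivAlong_velocity_eq_zero_iff (cov : Connection E M)
    (he : e ∈ IsManifold.maximalAtlas 𝓘(ℝ, E) ∞ M) {I : Set ℝ} (hI : IsOpen I)
    (hγ : ContMDiffOn 𝓘(ℝ, ℝ) 𝓘(ℝ, E) ∞ γ I) (ht : t ∈ I) (hy : γ t ∈ e.source) :
    covDerivAlong cov γ (velocity γ) t = 0 ↔
      deriv (deriv (fun s ↦ e (γ s))) t + chr cov e (e (γ t)) (deriv (fun s ↦ e (γ s)) t)
        (deriv (fun s ↦ e (γ s)) t) = 0 := by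
  have hγt := hγ.contMDiffAt (hI.mem_nhds ht)
  have hd : ∀ᶠ s in 𝓝 t, MDifferentiableAt 𝓘(ℝ, ℝ) 𝓘(ℝ, E) γ s := by
    filter_upwards [hI.mem_nhds ht] with s hs
    exact (hγ.contMDiffAt (hI.mem_nhds hs)).mdifferentiableAt (by simp)
  have hev : (fun s ↦ comps e (γ s) (velocity γ s)) =ᶠ[𝓝 t] deriv (fun s ↦ e (γ s)) := by
    filter_upwards [hd, hγt.continuousAt.eventually (e.open_source.eventually_mem hy)]
      with s hs hs' using comps_velocity he hs hs'
  have hJ := hγ.continuousOn.isOpen_inter_preimage hI e.open_source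
  have hdd : DifferentiableAt ℝ (deriv (fun s ↦ e (γ s))) t :=
    differentiableAt_of_contDiffOn hJ (contDiffOn_deriv hJ
      (contDiffOn_chart_comp he (hγ.mono inter_subset_left) fun _ hs ↦ hs.2)) ⟨ht, hy⟩
  rw [← map_eq_zero_iff _ (comps_injective he hy),
    comps_covDerivAlong cov he hd.self_of_nhds hy (hev.differentiableAt_iff.2 hdd),
    covCurve, hev.deriv_eq, hev.eq_of_nhds]
  rfl

/-- The fields `∇_X^k Π` in a chart. -/
theorem endRep_iterPi [T2Space M] {Ω : SymplecticForm E M} {cov : Connection E M}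
    [CovariantDerivative.ContMDiffCovariantDerivative cov ∞]
    (hcov : IsSymplecticConnection Ω cov) (he : e ∈ IsManifold.maximalAtlas 𝓘(ℝ, E) ∞ M)
    {I : Set ℝ} (hI : IsOpen I) (hγ : ContMDiffOn 𝓘(ℝ, ℝ) 𝓘(ℝ, E) ∞ γ I)
    (hm : MapsTo γ I e.source) (k : ℕ) :
    EqOn (endRep e γ (iterPi cov γ k))
      ((covCurveEnd (curveMatrix cov e γ))^[k] fun s ↦ curvLoc (chr cov e) (e (γ s))
        (deriv (fun τ ↦ e (γ τ)) s) (deriv (fun τ ↦ e (γ τ)) s)) I := by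
  have hc := contDiffOn_chart_comp he hγ hm
  have hmc : MapsTo (fun s ↦ e (γ s)) I e.target := fun s hs ↦ e.map_source (hm hs)
  have hc' := contDiffOn_deriv hI hc
  have hA : ContDiffOn ℝ ∞ (curveMatrix cov e γ) I :=
    ((contDiffOn_chr cov he).comp hc hmc).clm_apply hc'
  have hD := contDiffOn_curvLoc e.open_target (contDiffOn_chr cov he) hc hc' hc' hmc
  have hd : ∀ s ∈ I, MDifferentiableAt 𝓘(ℝ, ℝ) 𝓘(ℝ, E) γ s := fun s hs ↦
    (hγ.contMDiffAt (hI.mem_nhds hs)).mdifferentiableAt (by simp)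
  induction k with
  | zero =>
    intro s hs
    ext v
    obtain ⟨u, rfl⟩ : ∃ u : Tan E (γ s), comps e (γ s) u = v :=
      ⟨coordField e v (γ s), comps_coordField he (hm hs) v⟩
    rw [endRep_comps he (hm hs)]
    simp only [iterPi, Function.iterate_zero, id_eq]
    rw [comps_curvature hcov he (hm hs), comps_velocity he (hd s hs) (hm hs)]
  | succ k ih =>
    intro s hs
    have hdiff := (contDiffOn_covCurveEnd_iterate hI hA hD k)
    have h1 : endRep e γ (iterPi cov γ (k + 1)) s
        = endRep e γ (covDerivEndAlong cov γ (iterPi cov γ k)) s := by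
      simp only [iterPi, Function.iterate_succ_apply']
    rw [h1, endRep_covDerivEndAlong cov he (hd s hs) (hm hs), Function.iterate_succ_apply',
      covCurveEnd_eqOn hI ih hs]
    exact ((ih.eventuallyEq_of_mem (hI.mem_nhds hs)).differentiableAt_iff).2
      (differentiableAt_of_contDiffOn hI hdiff hs)

/-- The symplectic form in a chart, as a bilinear form. -/
def bilinRep (Ω : SymplecticForm E M) (e : OpenPartialHomeomorph M E) (z : E) :
    LinearMap.BilinForm ℝ E :=
  LinearMap.mk₂ ℝ (fun u v ↦ formRep Ω e z u v) (by simp) (by simp) (by simp) (by simp)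

omit [FiniteDimensional ℝ E] in
theorem bilinRep_swap (Ω : SymplecticForm E M) (e : OpenPartialHomeomorph M E) (z u v : E) :
    bilinRep Ω e z u v = -bilinRep Ω e z v u :=
  Ω.form_swap _ _ _

omit [FiniteDimensional ℝ E] in
theorem bilinRep_nondegenerate (Ω : SymplecticForm E M)
    (he : e ∈ IsManifold.maximalAtlas 𝓘(ℝ, E) ∞ M) {z : E} (hz : z ∈ e.target) :
    (bilinRep Ω e z).Nondegenerate := by
  have hy := e.map_target hz
  have key : ∀ u, (∀ v, bilinRep Ω e z u v = 0) → u = 0 := fun u hu ↦ by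
    rw [← comps_coordField he hy u, Ω.nondegenerate _ (coordField e u (e.symm z)) fun v ↦ ?_,
      map_zero]
    rw [← coordField_comps he hy v]
    exact hu _
  exact ⟨key, fun u hu ↦ key u fun v ↦ by rw [bilinRep_swap, hu, neg_zero]⟩

/-- The condition `P^r ∈ sp` in a chart. -/
theorem fieldP_mem_iff [T2Space M] {Ω : SymplecticForm E M} {cov : Connection E M}
    [CovariantDerivative.ContMDiffCovariantDerivative cov ∞]
    (hcov : IsSymplecticConnection Ω cov) (he : e ∈ IsManifold.maximalAtlas 𝓘(ℝ, E) ∞ M)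
    {I : Set ℝ} (hI : IsOpen I) (hγ : ContMDiffOn 𝓘(ℝ, ℝ) 𝓘(ℝ, E) ∞ γ I)
    (hm : MapsTo γ I e.source) (ht : t ∈ I) (hB : (bilinRep Ω e (e (γ t))).Nondegenerate) (r : ℕ) :
    fieldP Ω cov γ r t ∈ skewAdjointLieSubalgebra (Ω.bilin (γ t)) ↔
      ∀ u v, bilinRep Ω e (e (γ t)) (recP (bilinRep Ω e (e (γ t))) hB (fun k ↦
          ((covCurveEnd (curveMatrix cov e γ))^[k] (fun s ↦ curvLoc (chr cov e) (e (γ s))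
            (deriv (fun τ ↦ e (γ τ)) s) (deriv (fun τ ↦ e (γ τ)) s)) t).toLinearMap) r u) v
        + bilinRep Ω e (e (γ t)) u (recP (bilinRep Ω e (e (γ t))) hB (fun k ↦
          ((covCurveEnd (curveMatrix cov e γ))^[k] (fun s ↦ curvLoc (chr cov e) (e (γ s))
            (deriv (fun τ ↦ e (γ τ)) s) (deriv (fun τ ↦ e (γ τ)) s)) t).toLinearMap) r v) = 0 := by
  have hy := hm ht
  have hBB : ∀ u v : Tan E (γ t), Ω.bilin (γ t) u v
      = bilinRep Ω e (e (γ t)) ((comps e (γ t)).toLinearMap u) ((comps e (γ t)).toLinearMap v) :=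
    fun u v ↦ (formRep_comps Ω he hy u v).symm
  have hD : ∀ (k : ℕ) (u : Tan E (γ t)), (comps e (γ t)).toLinearMap (iterPi cov γ k t u) =
      ((covCurveEnd (curveMatrix cov e γ))^[k] (fun s ↦ curvLoc (chr cov e) (e (γ s))
        (deriv (fun τ ↦ e (γ τ)) s) (deriv (fun τ ↦ e (γ τ)) s)) t).toLinearMap
        ((comps e (γ t)).toLinearMap u) := fun k u ↦ by
    have h := congrArg (fun S : E →L[ℝ] E ↦ S (comps e (γ t) u))
      (endRep_iterPi hcov he hI hγ hm k ht)
    exact (endRep_comps he hy _ _).symm.trans h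
  have hconj := fun u v ↦ recP_form_conj (comps e (γ t)).toLinearMap
    (Ω.bilin_nondegenerate (γ t)) hB hBB
    (D := fun k ↦ (iterPi cov γ k t).toLinearMap) hD r u v
  have hmem : fieldP Ω cov γ r t ∈ skewAdjointLieSubalgebra (Ω.bilin (γ t)) ↔
      ∀ u v, Ω.bilin (γ t) (fieldP Ω cov γ r t u) v + Ω.bilin (γ t) u (fieldP Ω cov γ r t v) = 0 := by
    change fieldP Ω cov γ r t ∈ (Ω.bilin (γ t)).skewAdjointSubmodule ↔ _
    rw [LinearMap.mem_skewAdjointSubmodule]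
    refine forall₂_congr fun u v ↦ ?_
    simp [eq_neg_iff_add_eq_zero]
  have hswap : ∀ u v : Tan E (γ t), Ω.bilin (γ t) u v = -Ω.bilin (γ t) v u := fun u v ↦
    Ω.form_swap _ u v
  rw [hmem]
  -- By skew-symmetry both terms take the shape `ω(P·, ·)`, to which the transport `recP_form_conj`
  -- applies.
  have hterm : ∀ u v : Tan E (γ t), Ω.bilin (γ t) (fieldP Ω cov γ r t u) v
      + Ω.bilin (γ t) u (fieldP Ω cov γ r t v) = _ := fun u v ↦ by
    rw [hswap u, fieldP, hconj u v, hconj v u, ← bilinRep_swap]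
  simp only [hterm]
  refine ⟨fun h u v ↦ ?_, fun h u v ↦ h _ _⟩
  rw [← comps_coordField he hy u, ← comps_coordField he hy v]
  exact h _ _

end Curves

/-! ### Local uniqueness for the geodesic equation -/

section OdeUniqueness

variable {E : Type*} [NormedAddCommGroup E] [NormedSpace ℝ E]

/-- Local uniqueness of solutions of the geodesic equation. -/
theorem eventuallyEq_of_geodesic_equation {Γ : E → E →L[ℝ] E →L[ℝ] E} {c₁ c₂ : ℝ → E} {t : ℝ}
    (hΓ : ContDiffAt ℝ 1 Γ (c₁ t))
    (h₁ : ∀ᶠ s in 𝓝 t, DifferentiableAt ℝ c₁ s ∧ DifferentiableAt ℝ (deriv c₁) s ∧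
      deriv (deriv c₁) s + Γ (c₁ s) (deriv c₁ s) (deriv c₁ s) = 0)
    (h₂ : ∀ᶠ s in 𝓝 t, DifferentiableAt ℝ c₂ s ∧ DifferentiableAt ℝ (deriv c₂) s ∧
      deriv (deriv c₂) s + Γ (c₂ s) (deriv c₂ s) (deriv c₂ s) = 0)
    (heq : c₁ t = c₂ t) (hd : deriv c₁ t = deriv c₂ t) : c₁ =ᶠ[𝓝 t] c₂ := by
  obtain ⟨K, S, hS, hlip⟩ := (contDiffAt_geodesicField (p := (c₁ t, deriv c₁ t))
    hΓ).exists_lipschitzOnWith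
  have key : ∀ c : ℝ → E, (∀ᶠ s in 𝓝 t, DifferentiableAt ℝ c s ∧ DifferentiableAt ℝ (deriv c) s ∧
      deriv (deriv c) s + Γ (c s) (deriv c s) (deriv c s) = 0) → c₁ t = c t →
      deriv c₁ t = deriv c t →
      ∀ᶠ s in 𝓝 t, HasDerivAt (fun s ↦ (c s, deriv c s)) (geodesicField Γ (c s, deriv c s)) s ∧
        (c s, deriv c s) ∈ S := by
    intro c hc h1 h2
    have hcont : ContinuousAt (fun s ↦ (c s, deriv c s)) t :=
      hc.self_of_nhds.1.continuousAt.prodMk hc.self_of_nhds.2.1.continuousAt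
    rw [h1, h2] at hS
    filter_upwards [hc, hcont.eventually_mem hS] with s hs hs'
    refine ⟨?_, hs'⟩
    have := hs.1.hasDerivAt.prodMk hs.2.1.hasDerivAt
    rwa [eq_neg_of_add_eq_zero_left hs.2.2] at this
  have := ODE_solution_unique_of_eventually (v := fun _ ↦ geodesicField Γ) (s := fun _ ↦ S)
    (.of_forall fun _ ↦ hlip) (key c₁ h₁ rfl rfl) (key c₂ h₂ heq hd) (by simp [heq, hd])
  exact this.mono fun s hs ↦ congrArg Prod.fst hs

end OdeUniqueness

/-! ### Uniqueness and reparametrization of geodesics on the manifold -/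

section Uniqueness

variable {E : Type*} [NormedAddCommGroup E] [NormedSpace ℝ E] [FiniteDimensional ℝ E]
  {M : Type*} [TopologicalSpace M] [ChartedSpace E M] [IsManifold 𝓘(ℝ, E) ∞ M]
  {e : OpenPartialHomeomorph M E} {cov : Connection E M} {γ γ₁ γ₂ : ℝ → M} {J : Set ℝ} {t : ℝ}

theorem IsGeodesicOn.mono (hγ : IsGeodesicOn cov γ J) {K : Set ℝ} (hK : IsOpen K) (hKJ : K ⊆ J) :
    IsGeodesicOn cov γ K :=
  ⟨hK, hγ.2.1.mono hKJ, fun t ht ↦ hγ.2.2 t (hKJ ht)⟩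

theorem IsGeodesicOn.continuousAt (hγ : IsGeodesicOn cov γ J) (ht : t ∈ J) : ContinuousAt γ t :=
  (hγ.2.1.contMDiffAt (hγ.1.mem_nhds ht)).continuousAt

theorem IsGeodesicOn.mdifferentiableAt (hγ : IsGeodesicOn cov γ J) (ht : t ∈ J) :
    MDifferentiableAt 𝓘(ℝ, ℝ) 𝓘(ℝ, E) γ t :=
  (hγ.2.1.contMDiffAt (hγ.1.mem_nhds ht)).mdifferentiableAt (by simp)

theorem IsGeodesicOn.chart_equation (hγ : IsGeodesicOn cov γ J)
    (he : e ∈ IsManifold.maximalAtlas 𝓘(ℝ, E) ∞ M) (ht : t ∈ J) (hy : γ t ∈ e.source) :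
    ∀ᶠ s in 𝓝 t, DifferentiableAt ℝ (fun τ ↦ e (γ τ)) s ∧
      DifferentiableAt ℝ (deriv (fun τ ↦ e (γ τ))) s ∧
      deriv (deriv (fun τ ↦ e (γ τ))) s
        + chr cov e (e (γ s)) (deriv (fun τ ↦ e (γ τ)) s) (deriv (fun τ ↦ e (γ τ)) s) = 0 := by
  have hJ := hγ.2.1.continuousOn.isOpen_inter_preimage hγ.1 e.open_source
  have hc := contDiffOn_chart_comp he (hγ.2.1.mono inter_subset_left)
    fun s (hs : s ∈ J ∩ γ ⁻¹' e.source) ↦ hs.2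
  filter_upwards [hJ.mem_nhds ⟨ht, hy⟩] with s hs
  exact ⟨differentiableAt_of_contDiffOn hJ hc hs,
    differentiableAt_of_contDiffOn hJ (contDiffOn_deriv hJ hc) hs,
    (covDerivAlong_velocity_eq_zero_iff cov he hγ.1 hγ.2.1 hs.1 hs.2).1 (hγ.2.2 s hs.1)⟩

omit [FiniteDimensional ℝ E] [IsManifold 𝓘(ℝ, E) ∞ M] in
theorem HasInitialVelocity.chart {x : M} {X : Tan E x} (h : HasInitialVelocity γ x X)
    (hγ : MDifferentiableAt 𝓘(ℝ, ℝ) 𝓘(ℝ, E) γ 0)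
    (he : e ∈ IsManifold.maximalAtlas 𝓘(ℝ, E) ∞ M) (hx : x ∈ e.source) :
    γ 0 = x ∧ deriv (fun s ↦ e (γ s)) 0 = comps e x X := by
  have h1 : γ 0 = x := congrArg TotalSpace.proj h
  refine ⟨h1, ?_⟩
  rw [← comps_velocity he hγ (h1 ▸ hx)]
  exact congrArg (fun p : TangentBundle 𝓘(ℝ, E) M ↦ comps e p.1 p.2) h

omit [FiniteDimensional ℝ E] [IsManifold 𝓘(ℝ, E) ∞ M] in
theorem hasInitialVelocity_of_chart {x : M} {X : Tan E x}
    (hγ : MDifferentiableAt 𝓘(ℝ, ℝ) 𝓘(ℝ, E) γ 0)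
    (he : e ∈ IsManifold.maximalAtlas 𝓘(ℝ, E) ∞ M) (hx : x ∈ e.source)
    (h0 : γ 0 = x) (hd : deriv (fun s ↦ e (γ s)) 0 = comps e x X) : HasInitialVelocity γ x X := by
  subst h0
  rw [← comps_velocity he hγ hx] at hd
  rw [HasInitialVelocity, comps_injective he hx hd]

variable [T2Space M] [CovariantDerivative.ContMDiffCovariantDerivative cov ∞]

theorem IsGeodesicOn.eventuallyEq (h₁ : IsGeodesicOn cov γ₁ J) (h₂ : IsGeodesicOn cov γ₂ J)
    (he : e ∈ IsManifold.maximalAtlas 𝓘(ℝ, E) ∞ M) (ht : t ∈ J) (hy : γ₁ t ∈ e.source)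
    (heq : γ₁ t = γ₂ t) (hd : deriv (fun s ↦ e (γ₁ s)) t = deriv (fun s ↦ e (γ₂ s)) t) :
    γ₁ =ᶠ[𝓝 t] γ₂ := by
  have hy₂ : γ₂ t ∈ e.source := heq ▸ hy
  have hΓ : ContDiffAt ℝ 1 (chr cov e) (e (γ₁ t)) :=
    ((contDiffOn_chr cov he).contDiffAt (e.open_target.mem_nhds (e.map_source hy))).of_le
      (by norm_cast)
  have := eventuallyEq_of_geodesic_equation hΓ (h₁.chart_equation he ht hy)
    (h₂.chart_equation he ht hy₂) (congrArg e heq) hd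
  filter_upwards [this, (h₁.continuousAt ht).eventually_mem (e.open_source.mem_nhds hy),
    (h₂.continuousAt ht).eventually_mem (e.open_source.mem_nhds hy₂)] with s hs hs₁ hs₂
  exact e.injOn hs₁ hs₂ hs

/-- Uniqueness of geodesics on a connected set of times. -/
theorem IsGeodesicOn.eqOn (h₁ : IsGeodesicOn cov γ₁ J) (h₂ : IsGeodesicOn cov γ₂ J)
    (hJ : IsPreconnected J)
    (he : e ∈ IsManifold.maximalAtlas 𝓘(ℝ, E) ∞ M) (ht : t ∈ J) (hy : γ₁ t ∈ e.source)
    (heq : γ₁ t = γ₂ t) (hd : deriv (fun s ↦ e (γ₁ s)) t = deriv (fun s ↦ e (γ₂ s)) t) :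
    EqOn γ₁ γ₂ J := by
  -- The times at which the germs agree form an open set. It is also closed in `J`: at a limit point
  -- positions and velocities agree by continuity and the Hausdorff property, and local uniqueness
  -- applies again.
  have hopen : IsOpen {s | γ₁ =ᶠ[𝓝 s] γ₂} := isOpen_setOfPred_eventually_nhds
  have hsub : J ⊆ {s | γ₁ =ᶠ[𝓝 s] γ₂} := by
    refine hJ.subset_of_closure_inter_subset hopen
      ⟨t, ht, h₁.eventuallyEq h₂ he ht hy heq hd⟩ ?_
    rintro s ⟨hs, hsJ⟩
    have hfreq : ∃ᶠ τ in 𝓝 s, γ₁ =ᶠ[𝓝 τ] γ₂ := mem_closure_iff_frequently.1 hs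
    have heq' : γ₁ s = γ₂ s := tendsto_nhds_unique_of_frequently_eq (h₁.continuousAt hsJ)
      (h₂.continuousAt hsJ) (hfreq.mono fun τ hτ ↦ hτ.self_of_nhds)
    have he' : chartAt E (γ₁ s) ∈ IsManifold.maximalAtlas 𝓘(ℝ, E) ∞ M :=
      IsManifold.chart_mem_maximalAtlas _
    have hy' := mem_chart_source E (γ₁ s)
    refine h₁.eventuallyEq h₂ he' hsJ hy' heq' ?_
    exact tendsto_nhds_unique_of_frequently_eq
      ((h₁.chart_equation he' hsJ hy').self_of_nhds.2.1.continuousAt)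
      ((h₂.chart_equation he' hsJ (heq' ▸ hy')).self_of_nhds.2.1.continuousAt)
      (hfreq.mono fun τ hτ ↦ (hτ.fun_comp (chartAt E (γ₁ s))).deriv_eq)
  exact fun s hs ↦ (hsub hs).self_of_nhds

omit [T2Space M] [CovariantDerivative.ContMDiffCovariantDerivative cov ∞] in
/-- An affine reparametrization of a geodesic is a geodesic. -/
theorem IsGeodesicOn.comp_mul (hγ : IsGeodesicOn cov γ J) (c : ℝ) :
    IsGeodesicOn cov (fun s ↦ γ (c * s)) ((fun s ↦ c * s) ⁻¹' J) := by
  have hlin : ContMDiff 𝓘(ℝ, ℝ) 𝓘(ℝ, ℝ) ∞ (fun s : ℝ ↦ c * s) :=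
    (contDiff_const.mul contDiff_id).contMDiff
  have hopen : IsOpen ((fun s ↦ c * s) ⁻¹' J) := hγ.1.preimage (continuous_const_mul c)
  have hsm : ContMDiffOn 𝓘(ℝ, ℝ) 𝓘(ℝ, E) ∞ (fun s ↦ γ (c * s)) ((fun s ↦ c * s) ⁻¹' J) :=
    hγ.2.1.comp hlin.contMDiffOn fun s hs ↦ hs
  refine ⟨hopen, hsm, fun t ht ↦ ?_⟩
  set e := chartAt E (γ (c * t)) with hdef
  have he : e ∈ IsManifold.maximalAtlas 𝓘(ℝ, E) ∞ M := IsManifold.chart_mem_maximalAtlas _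
  have hy : γ (c * t) ∈ e.source := mem_chart_source E _
  rw [covDerivAlong_velocity_eq_zero_iff cov he hopen hsm ht hy]
  have hch := (hγ.chart_equation he ht hy).self_of_nhds
  have h1 : deriv (fun s ↦ e (γ (c * s))) = fun s ↦ c • deriv (fun τ ↦ e (γ τ)) (c * s) := by
    ext s
    exact deriv_comp_mul_left c (fun τ ↦ e (γ τ)) s
  have h2 : deriv (fun s ↦ c • deriv (fun τ ↦ e (γ τ)) (c * s)) t
      = c • c • deriv (deriv (fun τ ↦ e (γ τ))) (c * t) := by
    have h3 : deriv (fun s ↦ c • deriv (fun τ ↦ e (γ τ)) (c * s)) t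
        = c • deriv (fun s ↦ deriv (fun τ ↦ e (γ τ)) (c * s)) t := deriv_fun_const_smul_field ..
    rw [h3, deriv_comp_mul_left c (deriv (fun τ ↦ e (γ τ))) t]
  rw [h1, h2]
  simp only [map_smul, smul_apply]
  rw [← smul_add, ← smul_add, hch.2.2, smul_zero, smul_zero]

end Uniqueness

/-! ### Normal coordinates and the geodesic symmetry -/

section NormalCoordinates

variable {E : Type*} [NormedAddCommGroup E] [NormedSpace ℝ E] [FiniteDimensional ℝ E]
  {M : Type*} [TopologicalSpace M] [ChartedSpace E M] [IsManifold 𝓘(ℝ, E) ∞ M]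
  {e : OpenPartialHomeomorph M E} {cov : Connection E M} {x : M}

/-- The normal coordinate parametrization of `N`, read in the chart `e`. -/
def normalRep (N : SymmetricNormalNhd cov x) (e : OpenPartialHomeomorph M E) (v : E) : E :=
  e (N.toFun v)

/-- The domain of `normalRep N e`. -/
def normalDomain (N : SymmetricNormalNhd cov x) (e : OpenPartialHomeomorph M E) : Set E :=
  N.source ∩ N.toFun ⁻¹' e.source

theorem isOpen_normalDomain (N : SymmetricNormalNhd cov x) (e : OpenPartialHomeomorph M E) :
    IsOpen (normalDomain N e) :=
  N.toOpenPartialHomeomorph.isOpen_inter_preimage e.open_source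

theorem contDiffOn_normalRep (N : SymmetricNormalNhd cov x)
    (he : e ∈ IsManifold.maximalAtlas 𝓘(ℝ, E) ∞ M) :
    ContDiffOn ℝ ∞ (normalRep N e) (normalDomain N e) :=
  ((contMDiffOn_of_mem_maximalAtlas he).comp (N.contMDiffOn.mono inter_subset_left)
    fun _ hv ↦ hv.2).contDiffOn

theorem mapsTo_normalRep (N : SymmetricNormalNhd cov x) (e : OpenPartialHomeomorph M E) :
    MapsTo (normalRep N e) (normalDomain N e) e.target := fun _ hv ↦ e.map_source hv.2

theorem mdifferentiableAt_normal (N : SymmetricNormalNhd cov x) {v : E} (hv : v ∈ N.source) :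
    MDifferentiableAt 𝓘(ℝ, E) 𝓘(ℝ, E) N.toFun v :=
  (N.contMDiffOn.contMDiffAt (N.open_source.mem_nhds hv)).mdifferentiableAt (by simp)

theorem fderiv_normalRep (N : SymmetricNormalNhd cov x)
    (he : e ∈ IsManifold.maximalAtlas 𝓘(ℝ, E) ∞ M) {v : E} (hv : v ∈ normalDomain N e) (Y : E) :
    fderiv ℝ (normalRep N e) v Y
      = comps e (N.toFun v) (mfderiv 𝓘(ℝ, E) 𝓘(ℝ, E) N.toFun v Y) := by
  have h := mfderiv_comp v ((mdifferentiable_of_mem_maximalAtlas he).mdifferentiableAt hv.2)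
    (mdifferentiableAt_normal N hv.1)
  rw [mfderiv_eq_fderiv] at h
  exact congrArg (fun T : E →L[ℝ] E ↦ T Y) h

/-- The pullback of the symplectic form to the tangent space, computed in a chart. -/
theorem formRep_normalRep (Ω : SymplecticForm E M) (N : SymmetricNormalNhd cov x)
    (he : e ∈ IsManifold.maximalAtlas 𝓘(ℝ, E) ∞ M) {v : E} (hv : v ∈ normalDomain N e) (Y Z : E) :
    formRep Ω e (normalRep N e v) (fderiv ℝ (normalRep N e) v Y) (fderiv ℝ (normalRep N e) v Z)
      = Ω.form (N.toFun v) (mfderiv 𝓘(ℝ, E) 𝓘(ℝ, E) N.toFun v Y)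
          (mfderiv 𝓘(ℝ, E) 𝓘(ℝ, E) N.toFun v Z) := by
  rw [fderiv_normalRep N he hv, fderiv_normalRep N he hv]
  exact formRep_comps Ω he hv.2 _ _

/-- Chain rule for `s_x ∘ exp_x = exp_x ∘ (-1)`, valid near `v`. -/
theorem mfderiv_geodesicSymmetry (N : SymmetricNormalNhd cov x) {v : E} (hv : v ∈ N.source)
    (Y : E) :
    (mfderiv 𝓘(ℝ, E) 𝓘(ℝ, E) (geodesicSymmetry N) (N.toFun v)
      (mfderiv 𝓘(ℝ, E) 𝓘(ℝ, E) N.toFun v Y) : E)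
      = -(mfderiv 𝓘(ℝ, E) 𝓘(ℝ, E) N.toFun (-v) Y : E) := by
  have hy : N.toFun v ∈ N.target := N.map_source hv
  have hinv : N.invFun (N.toFun v) = v := N.left_inv hv
  have hneg : HasFDerivAt (fun v : E ↦ -v) (-ContinuousLinearMap.id ℝ E) v := (hasFDerivAt_id v).neg
  have hnegm : MDifferentiableAt 𝓘(ℝ, E) 𝓘(ℝ, E) (fun v : E ↦ -v) v :=
    hneg.differentiableAt.mdifferentiableAt
  have hs : MDifferentiableAt 𝓘(ℝ, E) 𝓘(ℝ, E) (geodesicSymmetry N) (N.toFun v) := by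
    have h1 : MDifferentiableAt 𝓘(ℝ, E) 𝓘(ℝ, E) N.invFun (N.toFun v) :=
      (N.contMDiffOn_symm.contMDiffAt (N.open_target.mem_nhds hy)).mdifferentiableAt (by simp)
    have h2 : MDifferentiableAt 𝓘(ℝ, E) 𝓘(ℝ, E) (fun y ↦ -N.invFun y) (N.toFun v) :=
      MDifferentiableAt.comp (N.toFun v) (g := fun v : E ↦ -v) (by rwa [hinv]) h1
    exact MDifferentiableAt.comp (N.toFun v) (g := N.toFun)
      (mdifferentiableAt_normal N (by rw [hinv]; exact N.neg_mem v hv)) h2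
  have hev : (fun w ↦ geodesicSymmetry N (N.toFun w)) =ᶠ[𝓝 v] fun w ↦ N.toFun (-w) := by
    filter_upwards [N.open_source.mem_nhds hv] with w hw
    exact congrArg (fun z ↦ N.toFun (-z)) (N.left_inv hw)
  have h1 : (mfderiv 𝓘(ℝ, E) 𝓘(ℝ, E) (fun w ↦ geodesicSymmetry N (N.toFun w)) v : E →L[ℝ] E)
      = mfderiv 𝓘(ℝ, E) 𝓘(ℝ, E) (fun w ↦ N.toFun (-w)) v := hev.mfderiv_eq
  have h2 := mfderiv_comp v hs (mdifferentiableAt_normal N hv)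
  have h3 := mfderiv_comp (I := 𝓘(ℝ, E)) (I' := 𝓘(ℝ, E)) (I'' := 𝓘(ℝ, E)) v
    (mdifferentiableAt_normal N (N.neg_mem v hv)) hnegm
  have h4 : (mfderiv 𝓘(ℝ, E) 𝓘(ℝ, E) (fun v : E ↦ -v) v : E →L[ℝ] E)
      = -ContinuousLinearMap.id ℝ E := by
    rw [mfderiv_eq_fderiv]; exact hneg.fderiv
  have h5 : ((mfderiv 𝓘(ℝ, E) 𝓘(ℝ, E) (geodesicSymmetry N) (N.toFun v) : E →L[ℝ] E) ∘L
      (mfderiv 𝓘(ℝ, E) 𝓘(ℝ, E) N.toFun v : E →L[ℝ] E))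
      = (mfderiv 𝓘(ℝ, E) 𝓘(ℝ, E) N.toFun (-v) : E →L[ℝ] E) ∘L
        (mfderiv 𝓘(ℝ, E) 𝓘(ℝ, E) (fun v : E ↦ -v) v : E →L[ℝ] E) :=
    h2.symm.trans (h1.trans h3)
  rw [h4] at h5
  have := congrArg (fun T : E →L[ℝ] E ↦ T Y) h5
  have hS : ∀ S : E →L[ℝ] E, (S ∘L (-ContinuousLinearMap.id ℝ E)) Y = -(S Y) := by simp
  exact this.trans (hS _)

theorem surjective_mfderiv_normal (N : SymmetricNormalNhd cov x) {v : E} (hv : v ∈ N.source)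
    (u : Tan E (N.toFun v)) : ∃ Y : E, mfderiv 𝓘(ℝ, E) 𝓘(ℝ, E) N.toFun v Y = u := by
  have hN : N.toOpenPartialHomeomorph.MDifferentiable 𝓘(ℝ, E) 𝓘(ℝ, E) :=
    ⟨N.contMDiffOn.mdifferentiableOn (by simp), N.contMDiffOn_symm.mdifferentiableOn (by simp)⟩
  exact hN.mfderiv_surjective hv u

theorem geodesicSymmetry_apply (N : SymmetricNormalNhd cov x) {v : E} (hv : v ∈ N.source) :
    geodesicSymmetry N (N.toFun v) = N.toFun (-v) :=
  congrArg (fun z ↦ N.toFun (-z)) (N.left_inv hv)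

/-- Invariance under the geodesic symmetry means that the form pulled back to the tangent space
is invariant under `v ↦ -v`. -/
theorem symmetry_preserves_iff (Ω : SymplecticForm E M) (N : SymmetricNormalNhd cov x) :
    (∀ y ∈ N.target, ∀ u v : Tan E y,
      Ω.form (geodesicSymmetry N y)
        (mfderiv 𝓘(ℝ, E) 𝓘(ℝ, E) (geodesicSymmetry N) y u)
        (mfderiv 𝓘(ℝ, E) 𝓘(ℝ, E) (geodesicSymmetry N) y v) = Ω.form y u v) ↔
    ∀ v ∈ N.source, ∀ Y Z : E,
      Ω.form (N.toFun (-v)) (mfderiv 𝓘(ℝ, E) 𝓘(ℝ, E) N.toFun (-v) Y)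
          (mfderiv 𝓘(ℝ, E) 𝓘(ℝ, E) N.toFun (-v) Z)
        = Ω.form (N.toFun v) (mfderiv 𝓘(ℝ, E) 𝓘(ℝ, E) N.toFun v Y)
          (mfderiv 𝓘(ℝ, E) 𝓘(ℝ, E) N.toFun v Z) := by
  have key : ∀ v ∈ N.source, ∀ Y Z : E,
      Ω.form (geodesicSymmetry N (N.toFun v))
        (mfderiv 𝓘(ℝ, E) 𝓘(ℝ, E) (geodesicSymmetry N) (N.toFun v)
          (mfderiv 𝓘(ℝ, E) 𝓘(ℝ, E) N.toFun v Y))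
        (mfderiv 𝓘(ℝ, E) 𝓘(ℝ, E) (geodesicSymmetry N) (N.toFun v)
          (mfderiv 𝓘(ℝ, E) 𝓘(ℝ, E) N.toFun v Z))
      = Ω.form (N.toFun (-v)) (mfderiv 𝓘(ℝ, E) 𝓘(ℝ, E) N.toFun (-v) Y)
          (mfderiv 𝓘(ℝ, E) 𝓘(ℝ, E) N.toFun (-v) Z) := fun v hv Y Z ↦ by
    -- Regarding tangent vectors as elements of `E` lets the base point be substituted independently
    -- of the vectors; the two minus signs cancel by bilinearity.
    let Φ : M → E → E → ℝ := fun y a b ↦ Ω.form y a b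
    have hΦ : ∀ y y' a b a' b', y = y' → a = -a' → b = -b' → Φ y a b = Φ y' a' b' := by
      rintro y _ _ _ a b rfl rfl rfl
      have h : ∀ a b : Tan E y, Ω.form y (-a) (-b) = Ω.form y a b := by simp
      exact h a b
    exact hΦ _ _ _ _ _ _ (geodesicSymmetry_apply N hv) (mfderiv_geodesicSymmetry N hv Y)
      (mfderiv_geodesicSymmetry N hv Z)
  constructor
  · intro h v hv Y Z
    exact (key v hv Y Z).symm.trans (h _ (N.map_source hv) _ _)
  · intro h y hy u w
    obtain ⟨v, hv, rfl⟩ : ∃ v ∈ N.source, N.toFun v = y :=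
      ⟨N.invFun y, N.map_target hy, N.right_inv hy⟩
    obtain ⟨Y, rfl⟩ := surjective_mfderiv_normal N hv u
    obtain ⟨Z, rfl⟩ := surjective_mfderiv_normal N hv w
    exact (key v hv Y Z).trans (h v hv Y Z)

variable [T2Space M] [CovariantDerivative.ContMDiffCovariantDerivative cov ∞]

/-- On a symmetric normal neighbourhood, radial curves are geodesics. -/
theorem SymmetricNormalNhd.exists_geodesic (N : SymmetricNormalNhd cov x) {w : E}
    (hw : w ∈ N.source) : ∃ (γ : ℝ → M) (a b : ℝ), a < 0 ∧ 1 < b ∧ IsGeodesicOn cov γ (Ioo a b) ∧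
      HasInitialVelocity γ x w ∧ ∀ t ∈ Ioo a b, t • w ∈ N.source → N.toFun (t • w) = γ t := by
  obtain ⟨γ, a, b, ha, hb, hγ, hi, -⟩ := N.isExp w hw
  refine ⟨γ, a, b, ha, hb, hγ, hi, fun t ht hts ↦ ?_⟩
  obtain ⟨γ', a', b', ha', hb', hγ', hi', h1⟩ := N.isExp _ hts
  set e := chartAt E x
  have he : e ∈ IsManifold.maximalAtlas 𝓘(ℝ, E) ∞ M := IsManifold.chart_mem_maximalAtlas _
  have hx : x ∈ e.source := mem_chart_source E x
  have h0 : (0 : ℝ) ∈ Ioo a b := ⟨ha, by linarith⟩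
  have h0' : (0 : ℝ) ∈ Ioo a' b' := ⟨ha', by linarith⟩
  obtain ⟨hx1, hd1⟩ := hi.chart (hγ.mdifferentiableAt h0) he hx
  obtain ⟨hx2, hd2⟩ := hi'.chart (hγ'.mdifferentiableAt h0') he hx
  -- `IsExp` supplies an unrelated geodesic for each vector. The one for `t • w` and the rescaled
  -- curve `s ↦ γ (t s)` share initial data and are compared on this interval, which contains both
  -- `0` and `1`.
  set J := (fun s ↦ t * s) ⁻¹' Ioo a b ∩ Ioo a' b' with hJ
  have hopen : IsOpen J := (isOpen_Ioo.preimage (continuous_const_mul t)).inter isOpen_Ioo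
  have hconn : IsPreconnected J := by
    have h1 : Convex ℝ ((fun s ↦ t * s) ⁻¹' Ioo a b) :=
      (convex_Ioo a b).is_linear_preimage (IsLinearMap.isLinearMap_smul t)
    exact (h1.inter (convex_Ioo a' b')).isPreconnected
  have hg1 := (hγ.comp_mul t).mono hopen inter_subset_left
  have hg2 := hγ'.mono hopen inter_subset_right
  have hJ0 : (0 : ℝ) ∈ J := ⟨by simpa using h0, h0'⟩
  have hJ1 : (1 : ℝ) ∈ J := ⟨by simpa using ht, by constructor <;> linarith⟩
  have := hg1.eqOn hg2 hconn he hJ0 (by simp only [mul_zero]; rwa [hx1])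
    (by simp only [mul_zero]; rw [hx1, hx2]) (by
      rw [deriv_comp_mul_left t (fun τ ↦ e (γ τ)) 0, mul_zero, hd1, hd2]
      exact ((comps e x).map_smul t _).symm) hJ1
  simp only [mul_one] at this
  rw [this, h1]

theorem SymmetricNormalNhd.apply_zero (N : SymmetricNormalNhd cov x) : N.toFun 0 = x := by
  obtain ⟨γ, a, b, ha, hb, -, hi, h⟩ := N.exists_geodesic N.zero_mem
  have h1 := h 0 ⟨ha, by linarith⟩ (by simpa using N.zero_mem)
  rw [zero_smul] at h1
  rw [h1]
  exact congrArg TotalSpace.proj hi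

theorem zero_mem_normalDomain (N : SymmetricNormalNhd cov x) (hx : x ∈ e.source) :
    (0 : E) ∈ normalDomain N e := ⟨N.zero_mem, by rw [mem_preimage, N.apply_zero]; exact hx⟩

omit [T2Space M] [CovariantDerivative.ContMDiffCovariantDerivative cov ∞] in
/-- Near admissible times, radial curves in a chart agree with geodesics. -/
theorem SymmetricNormalNhd.eventuallyEq_geodesic (N : SymmetricNormalNhd cov x) {w : E}
    {γ : ℝ → M} {a b t : ℝ} (h : ∀ t ∈ Ioo a b, t • w ∈ N.source → N.toFun (t • w) = γ t)
    (ht : t ∈ Ioo a b) (htw : t • w ∈ N.source) :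
    (fun τ : ℝ ↦ normalRep N e (τ • w)) =ᶠ[𝓝 t] fun τ ↦ e (γ τ) := by
  have hc : Continuous fun τ : ℝ ↦ τ • w := by fun_prop
  filter_upwards [isOpen_Ioo.mem_nhds ht, hc.continuousAt.eventually (N.open_source.mem_nhds htw)]
    with τ h1 h2
  rw [normalRep, h τ h1 h2]

/-- The geodesic equation satisfied by the normal coordinate parametrization. -/
theorem normalRep_equation (N : SymmetricNormalNhd cov x)
    (he : e ∈ IsManifold.maximalAtlas 𝓘(ℝ, E) ∞ M) :
    ∀ w ∈ normalDomain N e, fderiv ℝ (fderiv ℝ (normalRep N e)) w w w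
      + chr cov e (normalRep N e w) (fderiv ℝ (normalRep N e) w w)
          (fderiv ℝ (normalRep N e) w w) = 0 := by
  intro w hw
  -- Time `1` is interior to the domain of the geodesic with initial velocity `w`, so its equation
  -- there can be read from the derivatives of `normalRep` at `w`.
  obtain ⟨γ, a, b, ha, hb, hγ, -, h⟩ := N.exists_geodesic hw.1
  have h1 : (1 : ℝ) ∈ Ioo a b := ⟨by linarith, hb⟩
  have hw1 : (1 : ℝ) • w ∈ normalDomain N e := by rwa [one_smul]
  have heq := N.eventuallyEq_geodesic (e := e) h h1 hw1.1
  have hγ1 : N.toFun w = γ 1 := by simpa using h 1 h1 hw1.1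
  have hch := (hγ.chart_equation he h1 (by rw [← hγ1]; exact hw.2)).self_of_nhds.2.2
  have hd := hasDerivAt_comp_smul (isOpen_normalDomain N e) (contDiffOn_normalRep N he) hw1
  have hdd := fderiv_comp_smul_second (isOpen_normalDomain N e) (contDiffOn_normalRep N he) hw1
  rw [← heq.deriv.deriv_eq, ← heq.deriv_eq, hd.deriv, hdd, ← hγ1] at hch
  simp only [one_smul] at hch
  exact hch

/-- The differential of `exp_x` at `0` is the identity: on a vector of the domain it is the initial
velocity of the corresponding radial geodesic. -/
theorem fderiv_normalRep_zero (N : SymmetricNormalNhd cov x)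
    (he : e ∈ IsManifold.maximalAtlas 𝓘(ℝ, E) ∞ M) (hx : x ∈ e.source) (v : E) :
    fderiv ℝ (normalRep N e) 0 v = comps e x v := by
  have key : ∀ w ∈ N.source, fderiv ℝ (normalRep N e) 0 w = comps e x w := by
    intro w hw
    obtain ⟨γ, a, b, ha, hb, hγ, hi, h⟩ := N.exists_geodesic hw
    have h0 : (0 : ℝ) ∈ Ioo a b := ⟨ha, by linarith⟩
    have h0w : (0 : ℝ) • w ∈ normalDomain N e := by
      rw [zero_smul]; exact zero_mem_normalDomain N hx
    have heq := N.eventuallyEq_geodesic (e := e) h h0 h0w.1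
    have hd := hasDerivAt_comp_smul (isOpen_normalDomain N e) (contDiffOn_normalRep N he) h0w
    rw [← (hi.chart (hγ.mdifferentiableAt h0) he hx).2, ← heq.deriv_eq, hd.deriv, zero_smul]
  -- An arbitrary `v` is reached by linearity from a small nonzero multiple inside the domain.
  have hc : Continuous fun τ : ℝ ↦ τ • v := by fun_prop
  have hev : ∀ᶠ τ : ℝ in 𝓝[≠] 0, τ • v ∈ N.source :=
    (hc.tendsto' 0 0 (zero_smul ℝ v)).eventually (N.open_source.mem_nhds N.zero_mem)
      |>.filter_mono nhdsWithin_le_nhds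
  obtain ⟨τ, hτ, hτ0⟩ := (hev.and self_mem_nhdsWithin).exists
  have h1 := key _ hτ
  have h2 : comps e x (τ • v : E) = τ • comps e x v := (comps e x).map_smul τ _
  rw [map_smul, h2] at h1
  exact smul_right_injective E hτ0 h1

end NormalCoordinates

/-! ### Radial curves as solutions -/

section RadialCurves

variable {E : Type*} [NormedAddCommGroup E] [NormedSpace ℝ E]

/-- Radial curves of a map whose second radial derivatives satisfy the geodesic equation are
solutions of it. -/
theorem eventually_radial_equation {Γ : E → E →L[ℝ] E →L[ℝ] E} {U V : Set E}
    (hΓ : ContDiffOn ℝ ∞ Γ U) (hV : IsOpen V) {Ex : E → E} (hEx : ContDiffOn ℝ ∞ Ex V)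
    (hm : MapsTo Ex V U)
    (hgeo : ∀ w ∈ V, fderiv ℝ (fderiv ℝ Ex) w w w + Γ (Ex w) (fderiv ℝ Ex w w) (fderiv ℝ Ex w w) = 0)
    {X : E} {t : ℝ} (ht : t • X ∈ V) :
    ∀ᶠ s in 𝓝 t, DifferentiableAt ℝ (fun τ : ℝ ↦ Ex (τ • X)) s ∧
      DifferentiableAt ℝ (deriv (fun τ : ℝ ↦ Ex (τ • X))) s ∧
      deriv (deriv (fun τ : ℝ ↦ Ex (τ • X))) s
        + Γ (Ex (s • X)) (deriv (fun τ : ℝ ↦ Ex (τ • X)) s)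
          (deriv (fun τ : ℝ ↦ Ex (τ • X)) s) = 0 := by
  have hlin : Continuous fun τ : ℝ ↦ τ • X := by fun_prop
  have hO : IsOpen ((fun τ : ℝ ↦ τ • X) ⁻¹' V) := hV.preimage hlin
  have hc : ContDiffOn ℝ ∞ (fun τ : ℝ ↦ Ex (τ • X)) ((fun τ : ℝ ↦ τ • X) ⁻¹' V) :=
    hEx.comp (contDiff_id.smul contDiff_const).contDiffOn fun _ h ↦ h
  filter_upwards [hO.mem_nhds ht] with s hs
  refine ⟨differentiableAt_of_contDiffOn hO hc hs,
    differentiableAt_of_contDiffOn hO (contDiffOn_deriv hO hc) hs, ?_⟩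
  rw [fderiv_comp_smul_second hV hEx hs, (hasDerivAt_comp_smul hV hEx hs).deriv]
  exact radial_geodesic hΓ hV hEx hm hgeo hs

end RadialCurves

/-! ### The Taylor coefficient criterion and implication (i) -/

section Criterion

variable {E : Type*} [NormedAddCommGroup E] [NormedSpace ℝ E] [FiniteDimensional ℝ E]
  {M : Type*} [TopologicalSpace M] [ChartedSpace E M] [IsManifold 𝓘(ℝ, E) ∞ M]
  {e : OpenPartialHomeomorph M E} {cov : Connection E M} {x : M} {Ω : SymplecticForm E M}

/-- `t² (exp_x^* ω)_{tX}(Y, Z)`, computed in the chart `e`. -/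
def radialForm (Ω : SymplecticForm E M) (N : SymmetricNormalNhd cov x)
    (e : OpenPartialHomeomorph M E) (X Y Z : E) (t : ℝ) : ℝ :=
  formRep Ω e (normalRep N e (t • X)) (t • fderiv ℝ (normalRep N e) (t • X) Y)
    (t • fderiv ℝ (normalRep N e) (t • X) Z)

/-- The factor `t²` is even, so evenness of the pulled-back form passes to `radialForm`, and at `t =
±1` the two coincide. -/
theorem radialForm_eq (N : SymmetricNormalNhd cov x)
    (he : e ∈ IsManifold.maximalAtlas 𝓘(ℝ, E) ∞ M) (X Y Z : E) {t : ℝ}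
    (ht : t • X ∈ normalDomain N e) :
    radialForm Ω N e X Y Z t = t ^ 2 * Ω.form (N.toFun (t • X))
      (mfderiv 𝓘(ℝ, E) 𝓘(ℝ, E) N.toFun (t • X) Y)
      (mfderiv 𝓘(ℝ, E) 𝓘(ℝ, E) N.toFun (t • X) Z) := by
  rw [← formRep_normalRep Ω N he ht, radialForm]
  simp only [map_smul, smul_apply, smul_eq_mul]
  ring

variable [T2Space M] [CovariantDerivative.ContMDiffCovariantDerivative cov ∞]

/-- Near time `0`, the geodesic with initial velocity `X` is the radial curve `t ↦ exp_x (tX)`. -/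
theorem exists_radial_interval (N : SymmetricNormalNhd cov x)
    (he : e ∈ IsManifold.maximalAtlas 𝓘(ℝ, E) ∞ M) (hx : x ∈ e.source) {X : E} {γ : ℝ → M}
    {J : Set ℝ} (hJ : (0 : ℝ) ∈ J) (hγ : IsGeodesicOn cov γ J) (hi : HasInitialVelocity γ x X) :
    ∃ I : Set ℝ, IsOpen I ∧ (0 : ℝ) ∈ I ∧ I ⊆ J ∧ MapsTo γ I e.source ∧
      (∀ t ∈ I, t • X ∈ normalDomain N e) ∧ ∀ t ∈ I, e (γ t) = normalRep N e (t • X) := by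
  obtain ⟨h0, hd⟩ := hi.chart (hγ.mdifferentiableAt hJ) he hx
  have h0X : (0 : ℝ) • X ∈ normalDomain N e := by
    rw [zero_smul]; exact zero_mem_normalDomain N hx
  have hy : γ 0 ∈ e.source := by rwa [h0]
  have hlin : Continuous fun τ : ℝ ↦ τ • X := by fun_prop
  have hΓ : ContDiffAt ℝ 1 (chr cov e) (e (γ 0)) :=
    ((contDiffOn_chr cov he).contDiffAt (e.open_target.mem_nhds (e.map_source hy))).of_le
      (by norm_cast)
  have heq := eventuallyEq_of_geodesic_equation hΓ (hγ.chart_equation he hJ hy)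
    (eventually_radial_equation (contDiffOn_chr cov he) (isOpen_normalDomain N e)
      (contDiffOn_normalRep N he) (mapsTo_normalRep N e) (normalRep_equation N he) h0X)
    (by rw [zero_smul, normalRep, N.apply_zero, h0])
    (by rw [hd, (hasDerivAt_comp_smul (isOpen_normalDomain N e) (contDiffOn_normalRep N he)
      h0X).deriv, zero_smul, fderiv_normalRep_zero N he hx])
  have hall := ((hγ.1.eventually_mem hJ).and
    ((hγ.continuousAt hJ).eventually_mem (e.open_source.mem_nhds hy))).and
    ((hlin.continuousAt.eventually_mem ((isOpen_normalDomain N e).mem_nhds h0X)).and heq)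
  obtain ⟨I, hI, hIo, hI0⟩ := eventually_nhds_iff.1 hall
  exact ⟨I, hIo, hI0, fun t ht ↦ (hI t ht).1.1, fun t ht ↦ (hI t ht).1.2,
    fun t ht ↦ (hI t ht).2.1, fun t ht ↦ (hI t ht).2.2⟩

/-- `P^r_x` is in the symplectic Lie algebra iff the derivatives of order `r + 2` of the pulled
back form along the radial curve vanish. -/
theorem fieldP_mem_iff_iteratedDeriv (hcov : IsSymplecticConnection Ω cov)
    (N : SymmetricNormalNhd cov x) (he : e ∈ IsManifold.maximalAtlas 𝓘(ℝ, E) ∞ M)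
    (hx : x ∈ e.source) {X : E} {γ : ℝ → M} {J : Set ℝ} (hJ : (0 : ℝ) ∈ J)
    (hγ : IsGeodesicOn cov γ J) (hi : HasInitialVelocity γ x X) {r : ℕ} (hr : Odd r)
    (hr3 : 3 ≤ r) :
    fieldP Ω cov γ r 0 ∈ skewAdjointLieSubalgebra (Ω.bilin (γ 0)) ↔
      ∀ Y Z, iteratedDeriv (r + 2) (radialForm Ω N e X Y Z) 0 = 0 := by
  obtain ⟨I, hIo, hI0, hIJ, hm, hIV, hIe⟩ := exists_radial_interval N he hx hJ hγ hi
  have hB := bilinRep_nondegenerate Ω he (e.map_source (hm hI0))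
  rw [fieldP_mem_iff hcov he hIo (hγ.2.1.mono hIJ) hm hI0 hB]
  have hE0 : normalRep N e 0 = e (γ 0) := by rw [hIe 0 hI0, zero_smul]
  have hder : ∀ Y Z, iteratedDeriv (r + 2) (radialForm Ω N e X Y Z) 0 = _ := fun Y Z ↦
    iteratedDeriv_radial_form_eq_recP e.open_target (contDiffOn_chr cov he)
      (fun z hz u v ↦ chr_symm hcov he hz u v) (isOpen_normalDomain N e)
      (contDiffOn_normalRep N he) (mapsTo_normalRep N e) (normalRep_equation N he) hIo hIV hIe
      (A := curveMatrix cov e γ) (D := fun s ↦ curvLoc (chr cov e) (e (γ s))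
        (deriv (fun τ ↦ e (γ τ)) s) (deriv (fun τ ↦ e (γ τ)) s))
      (fun _ _ ↦ rfl) (fun _ _ ↦ rfl) (contDiffOn_formRep Ω he)
      (fun z hz w u v ↦ fderiv_formRep hcov he hz w u v) hI0 (bilinRep Ω e (e (γ 0))) hB
      (fun u v ↦ by rw [hE0]; rfl) (bilinRep_swap Ω e _) Y Z hr hr3
  simp only [hder]
  refine ⟨fun h Y Z ↦ h _ _, fun h u v ↦ ?_⟩
  -- The derivatives only test vectors in the image of the differential at `0`, which is all of `E`.
  have hsurj : ∀ u : E, ∃ Y, fderiv ℝ (normalRep N e) 0 Y = u := fun u ↦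
    ⟨coordField e u x, (fderiv_normalRep_zero N he hx _).trans (comps_coordField he hx u)⟩
  obtain ⟨Y, rfl⟩ := hsurj u
  obtain ⟨Z, rfl⟩ := hsurj v
  exact h Y Z

theorem iteratedDeriv_radialForm_low (hcov : IsSymplecticConnection Ω cov)
    (N : SymmetricNormalNhd cov x) (he : e ∈ IsManifold.maximalAtlas 𝓘(ℝ, E) ∞ M)
    (hx : x ∈ e.source) {X : E} {γ : ℝ → M} {J : Set ℝ} (hJ : (0 : ℝ) ∈ J)
    (hγ : IsGeodesicOn cov γ J) (hi : HasInitialVelocity γ x X) (Y Z : E) {n : ℕ}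
    (hn : n = 1 ∨ n = 3) : iteratedDeriv n (radialForm Ω N e X Y Z) 0 = 0 := by
  obtain ⟨I, hIo, hI0, -, -, hIV, hIe⟩ := exists_radial_interval N he hx hJ hγ hi
  exact iteratedDeriv_radial_form_low e.open_target (contDiffOn_chr cov he)
      (fun z hz u v ↦ chr_symm hcov he hz u v) (isOpen_normalDomain N e)
      (contDiffOn_normalRep N he) (mapsTo_normalRep N e) (normalRep_equation N he) hIo hIV hIe
      (A := curveMatrix cov e γ) (D := fun s ↦ curvLoc (chr cov e) (e (γ s))
        (deriv (fun τ ↦ e (γ τ)) s) (deriv (fun τ ↦ e (γ τ)) s))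
      (fun _ _ ↦ rfl) (fun _ _ ↦ rfl) (contDiffOn_formRep Ω he)
      (fun z hz w u v ↦ fderiv_formRep hcov he hz w u v) hI0 Y Z hn

/-- If the geodesic symmetry at `x` preserves `ω` locally, then all `P^r_x` with `r` odd are in the
symplectic Lie algebra. -/
theorem conditionP_of_symmetryPreserves (hcov : IsSymplecticConnection Ω cov)
    (h : SymmetryPreserves Ω cov x) {r : ℕ} (hr : Odd r) (hr3 : 3 ≤ r) :
    ConditionP Ω cov r x := by
  obtain ⟨N, hN⟩ := h
  rw [symmetry_preserves_iff] at hN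
  intro X γ ε hε hγ hi
  set e := chartAt E x
  have he : e ∈ IsManifold.maximalAtlas 𝓘(ℝ, E) ∞ M := IsManifold.chart_mem_maximalAtlas _
  have hx : x ∈ e.source := mem_chart_source E x
  refine (fieldP_mem_iff_iteratedDeriv hcov N he hx (J := Ioo (-ε) ε) (by simpa using hε) hγ hi
    hr hr3).2 fun Y Z ↦ ?_
  have hV := (isOpen_normalDomain N e).mem_nhds (zero_mem_normalDomain N hx)
  have hev : ∀ W : E, radialForm Ω N e W Y Z =ᶠ[𝓝 0] fun t ↦ radialForm Ω N e W Y Z (-t) := by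
    intro W
    have hlin : Continuous fun τ : ℝ ↦ τ • W := by fun_prop
    have hlin' : Continuous fun τ : ℝ ↦ (-τ) • W := by fun_prop
    filter_upwards [(hlin.tendsto' 0 0 (zero_smul ℝ _)).eventually_mem hV,
      (hlin'.tendsto' 0 0 (by simp)).eventually_mem hV] with t h1 h2
    have h3 := hN _ h1.1 Y Z
    rw [← neg_smul] at h3
    rw [radialForm_eq N he W Y Z h1, radialForm_eq N he W Y Z h2, h3, neg_sq]
  have heven := hev X
  have h1 := heven.iteratedDeriv_eq (r + 2)
  have hodd : Odd (r + 2) := hr.add_even even_two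
  -- An odd derivative at `0` of a function that is even near `0` equals its own negative.
  rw [iteratedDeriv_comp_neg, neg_zero, hodd.neg_one_pow, neg_one_smul] at h1
  exact self_eq_neg.1 h1

end Criterion

/-! ### Analyticity of operator-valued maps -/

section Analyticity

/-- A family of linear maps on a finite-dimensional space is analytic if all its values are. -/
theorem analyticAt_of_analyticAt_apply {E F G : Type*} [NormedAddCommGroup E] [NormedSpace ℝ E]
    [NormedAddCommGroup F] [NormedSpace ℝ F] [FiniteDimensional ℝ F]
    [NormedAddCommGroup G] [NormedSpace ℝ G] {f : E → F →L[ℝ] G} {z : E}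
    (hf : ∀ v, AnalyticAt ℝ (fun y ↦ f y v) z) : AnalyticAt ℝ f z := by
  let b := Module.finBasis ℝ F
  have h : f = fun y ↦ ∑ i, ContinuousLinearMap.smulRightL ℝ F G
      (LinearMap.toContinuousLinearMap (b.coord i)) (f y (b i)) := by
    ext y v
    conv_lhs => rw [← b.sum_repr v]
    simp [map_sum, -Module.Basis.sum_repr]
  rw [h]
  exact Finset.analyticAt_fun_sum _ fun i _ ↦
    (ContinuousLinearMap.analyticAt _ _).comp (hf (b i))

end Analyticity

/-! ### Analytic normal neighbourhoods and implication (ii) -/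

section NormalNeighbourhoods

variable {E : Type*} [NormedAddCommGroup E] [NormedSpace ℝ E] [FiniteDimensional ℝ E]
  {M : Type*} [TopologicalSpace M] [ChartedSpace E M] [IsManifold 𝓘(ℝ, E) ∞ M]
  {e : OpenPartialHomeomorph M E} {cov : Connection E M} {x : M} {Ω : SymplecticForm E M}

variable [T2Space M] [CovariantDerivative.ContMDiffCovariantDerivative cov ∞]

theorem isGeodesicOn_radial (he : e ∈ IsManifold.maximalAtlas 𝓘(ℝ, E) ∞ M) {Ex : E → E} {V : Set E}
    (hV : IsOpen V) (hEx : ContDiffOn ℝ ∞ Ex V) (hm : MapsTo Ex V e.target)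
    (hgeo : ∀ w ∈ V, fderiv ℝ (fderiv ℝ Ex) w w w
      + chr cov e (Ex w) (fderiv ℝ Ex w w) (fderiv ℝ Ex w w) = 0)
    {X : E} {J : Set ℝ} (hJ : IsOpen J) (hJV : ∀ t ∈ J, t • X ∈ V) :
    IsGeodesicOn cov (fun t ↦ e.symm (Ex (t • X))) J := by
  have hc : ContDiffOn ℝ ∞ (fun t : ℝ ↦ Ex (t • X)) J :=
    hEx.comp (f := fun t : ℝ ↦ t • X) (by fun_prop) hJV
  have hs : ContMDiffOn 𝓘(ℝ, ℝ) 𝓘(ℝ, E) ∞ (fun t ↦ e.symm (Ex (t • X))) J :=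
    (contMDiffOn_symm_of_mem_maximalAtlas he).comp hc.contMDiffOn fun t ht ↦ hm (hJV t ht)
  refine ⟨hJ, hs, fun t ht ↦ ?_⟩
  have hr : (fun s ↦ e (e.symm (Ex (s • X)))) =ᶠ[𝓝 t] fun s ↦ Ex (s • X) := by
    filter_upwards [hJ.mem_nhds ht] with s hs using e.right_inv (hm (hJV s hs))
  rw [covDerivAlong_velocity_eq_zero_iff cov he hJ hs ht (e.map_target (hm (hJV t ht))),
    hr.deriv.deriv_eq, hr.deriv_eq, e.right_inv (hm (hJV t ht))]
  exact (eventually_radial_equation (contDiffOn_chr cov he) hV hEx hm hgeo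
    (hJV t ht)).self_of_nhds.2.2

/-- If the Christoffel symbols in the chart `e` are analytic at `x`, then `x` has a symmetric normal
neighbourhood on which the exponential map is analytic in the chart `e`. -/
theorem exists_analytic_normalNhd (he : e ∈ IsManifold.maximalAtlas 𝓘(ℝ, E) ∞ M)
    (hx : x ∈ e.source) (hΓ : AnalyticAt ℝ (chr cov e) (e x)) {P : E → Prop}
    (hP : ∀ᶠ z in 𝓝 (e x), P z) :
    ∃ N : SymmetricNormalNhd cov x, ∀ v ∈ N.source, N.toFun v ∈ e.source ∧
      AnalyticAt ℝ (normalRep N e) v ∧ P (normalRep N e v) := by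
  have : CompleteSpace E := FiniteDimensional.complete ℝ E
  obtain ⟨Ex, hEa, hE0, hEd, hgeo⟩ := exists_analytic_exp hΓ
  have hE1 : HasFDerivAt Ex ((ContinuousLinearEquiv.refl ℝ E : E ≃L[ℝ] E) : E →L[ℝ] E) 0 := by
    have := hEa.differentiableAt.hasFDerivAt
    rw [hEd] at this
    exact this
  have hEc : ContDiffAt ℝ ∞ Ex 0 := hEa.contDiffAt
  let φ := hEc.toOpenPartialHomeomorph Ex hE1 (by simp)
  have hφ0 : (0 : E) ∈ φ.source := hEc.mem_toOpenPartialHomeomorph_source hE1 (by simp)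
  -- Smoothness of the local inverse on the whole image requires an invertible differential at every
  -- point, not only at `0`.
  have hinv : ∀ᶠ w in 𝓝 (0 : E), ∃ A : E ≃L[ℝ] E, (A : E →L[ℝ] E) = fderiv ℝ Ex w := by
    have h1 := ContinuousLinearEquiv.nhds (ContinuousLinearEquiv.refl ℝ E)
    exact hEa.fderiv.continuousAt.eventually_mem (s := range ((↑) : (E ≃L[ℝ] E) → E →L[ℝ] E))
      (by rw [hEd]; exact h1)
  have hmem : ∀ᶠ z in 𝓝 (Ex 0), z ∈ e.target ∧ P z := by
    rw [hE0]
    exact (e.open_target.eventually_mem (e.map_source hx)).and hP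
  have hall := ((φ.open_source.eventually_mem hφ0).and
    (hEa.continuousAt.eventually hmem)).and (hEa.eventually_analyticAt.and (hinv.and hgeo))
  obtain ⟨ρ, hρ, hb⟩ := Metric.eventually_nhds_iff_ball.1 hall
  set V := Metric.ball (0 : E) ρ with hVdef
  have hV : IsOpen V := Metric.isOpen_ball
  have hVφ : V ⊆ φ.source := fun w hw ↦ (hb w hw).1.1
  have hm : MapsTo Ex V e.target := fun w hw ↦ (hb w hw).1.2.1
  have hEV : ContDiffOn ℝ ∞ Ex V := fun w hw ↦ (hb w hw).2.1.contDiffAt.contDiffWithinAt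
  -- The domain of `Ex` consists of components in the chart `e`, that of a normal neighbourhood of
  -- vectors in `T_x M`; `L` converts the second into the first.
  obtain ⟨L, hL⟩ : ∃ L : E ≃L[ℝ] E, ∀ v : E, L v = comps e x v :=
    let ⟨L, h⟩ := isInvertible_comps he hx
    ⟨L, fun v ↦ congrArg (fun T : E →L[ℝ] E ↦ T v) h⟩
  let T : OpenPartialHomeomorph E M :=
    (L.toHomeomorph.transOpenPartialHomeomorph (φ.restrOpen V hV)).trans e.symm
  have hT : ∀ v, v ∈ T.source ↔ L v ∈ V := fun v ↦
    ⟨fun h ↦ h.1.2, fun h ↦ ⟨⟨hVφ h, h⟩, hm h⟩⟩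
  have hzero : (0 : E) ∈ T.source := by
    rw [hT, map_zero]
    exact Metric.mem_ball_self hρ
  have hrep : ∀ v ∈ T.source, e (T v) = Ex (L v) := fun v hv ↦ e.right_inv (hm ((hT v).1 hv))
  have hLv : ∀ v ∈ T.source, ∀ t : ℝ, ‖t • L v‖ = |t| * ‖L v‖ := fun v _ t ↦ by
    rw [norm_smul, Real.norm_eq_abs]
  have hexp : ∀ v ∈ T.source, IsExp cov x v (T v) := by
    intro v hv
    have hn : ‖L v‖ < ρ := by simpa [hVdef] using (hT v).1 hv
    -- The geodesic must exist on an open interval containing `[0,1]`; since the ball is open there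
    -- is room beyond time `1`.
    obtain ⟨c, hc1, hc⟩ : ∃ c : ℝ, 1 < c ∧ c * ‖L v‖ < ρ := by
      have h1 : ∀ᶠ c in 𝓝 (1 : ℝ), c * ‖L v‖ < ρ :=
        (continuous_id.mul continuous_const).continuousAt.eventually_lt_const (by simpa using hn)
      obtain ⟨c, h2, h3⟩ := ((h1.filter_mono nhdsWithin_le_nhds).and
        (self_mem_nhdsWithin : ∀ᶠ c in 𝓝[>] (1 : ℝ), c ∈ Ioi 1)).exists
      exact ⟨c, h3, h2⟩
    have hJV : ∀ t ∈ Ioo (-c) c, t • L v ∈ V := by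
      intro t ht
      rw [hVdef, mem_ball_zero_iff, hLv v hv]
      exact (mul_le_mul_of_nonneg_right (abs_lt.2 ht).le (norm_nonneg _)).trans_lt hc
    have hg := isGeodesicOn_radial (cov := cov) he hV hEV hm (fun w hw ↦ (hb w hw).2.2.2)
      isOpen_Ioo hJV
    have h0 : (0 : ℝ) ∈ Ioo (-c) c := by constructor <;> linarith
    refine ⟨_, -c, c, by linarith, hc1, hg, hasInitialVelocity_of_chart
      (hg.mdifferentiableAt h0) he hx ?_ ?_, ?_⟩
    · simp only [zero_smul, hE0]
      exact e.left_inv hx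
    · have hr : (fun s : ℝ ↦ e (e.symm (Ex (s • L v)))) =ᶠ[𝓝 0] fun s ↦ Ex (s • L v) := by
        filter_upwards [isOpen_Ioo.mem_nhds h0] with s hs using e.right_inv (hm (hJV s hs))
      rw [hr.deriv_eq, (hasDerivAt_comp_smul hV hEV (hJV 0 h0)).deriv, zero_smul, hEd]
      exact hL v
    · simp only [one_smul]
      rfl
  have hTs : ContMDiffOn 𝓘(ℝ, E) 𝓘(ℝ, E) ∞ T T.source := by
    have h1 : ContDiffOn ℝ ∞ (fun v ↦ Ex (L v)) T.source :=
      hEV.comp L.contDiff.contDiffOn fun v hv ↦ (hT v).1 hv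
    exact (contMDiffOn_symm_of_mem_maximalAtlas he).comp h1.contMDiffOn fun v hv ↦
      hm ((hT v).1 hv)
  have hTi : ContMDiffOn 𝓘(ℝ, E) 𝓘(ℝ, E) ∞ T.symm T.target := by
    have h1 : ContDiffOn ℝ ∞ (fun z ↦ L.symm (φ.symm z)) (φ.restrOpen V hV).target := by
      refine L.symm.contDiff.comp_contDiffOn fun z hz ↦ ?_
      have hz' : φ.symm z ∈ V := (φ.restrOpen V hV).map_target hz |>.2
      obtain ⟨A, hA⟩ := (hb _ hz').2.2.1
      refine (φ.contDiffAt_symm (f₀' := A) hz.1 ?_ ?_).contDiffWithinAt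
      · rw [hA]
        exact (hb _ hz').2.1.differentiableAt.hasFDerivAt
      · exact (hb _ hz').2.1.contDiffAt
    exact h1.contMDiffOn.comp ((contMDiffOn_of_mem_maximalAtlas he).mono fun y hy ↦ hy.1)
      fun y hy ↦ hy.2
  let N : SymmetricNormalNhd cov x :=
    { T with
      zero_mem := hzero
      starConvex := by
        have h1 : StarConvex ℝ (L 0) V := by
          rw [map_zero]
          exact (convex_ball 0 ρ).starConvex (Metric.mem_ball_self hρ)
        have h2 := h1.linear_preimage (L : E →ₗ[ℝ] E)
        have h3 : T.source = (L : E →ₗ[ℝ] E) ⁻¹' V := Set.ext hT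
        rw [← h3] at h2
        exact h2
      neg_mem := fun v hv ↦ (hT _).2 (by
        have := (hT v).1 hv
        rw [hVdef, mem_ball_zero_iff] at this ⊢
        rwa [map_neg, norm_neg])
      isExp := hexp
      contMDiffOn := hTs
      contMDiffOn_symm := hTi }
  refine ⟨N, fun v hv ↦ ?_⟩
  have hLvV := (hT v).1 hv
  refine ⟨e.map_target (hm hLvV), ?_, ?_⟩
  · have h1 : normalRep N e =ᶠ[𝓝 v] fun v ↦ Ex (L v) := by
      filter_upwards [T.open_source.mem_nhds hv] with w hw using hrep w hw
    exact (AnalyticAt.comp (g := Ex) (hb _ hLvV).2.1 (L.analyticAt v)).congr h1.symm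
  · have h1 : normalRep N e v = Ex (L v) := hrep v hv
    rw [h1]
    exact (hb _ hLvV).1.2.2

/-- If `∇` is analytic at `x` and all `P^r_x` with `r` odd are in the symplectic Lie algebra, then the
geodesic symmetry at `x` preserves `ω` locally. -/
theorem symmetryPreserves_of_conditionP (hcov : IsSymplecticConnection Ω cov)
    (han : IsAnalyticAt cov x) (hP : ∀ r, Odd r → 3 ≤ r → ConditionP Ω cov r x) :
    SymmetryPreserves Ω cov x := by
  have : CompleteSpace E := FiniteDimensional.complete ℝ E
  obtain ⟨e, he, hx, hchr⟩ := han
  have hΓ : AnalyticAt ℝ (chr cov e) (e x) := analyticAt_of_analyticAt_apply hchr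
  have hnhd := e.open_target.eventually_mem (e.map_source hx)
  have hform : AnalyticAt ℝ (formRep Ω e) (e x) := by
    refine analyticAt_parallel_form hΓ ?_ ?_
    · filter_upwards [hnhd] with z hz using
        ((contDiffOn_formRep Ω he).contDiffAt (e.open_target.mem_nhds hz)).differentiableAt (by simp)
    · filter_upwards [hnhd] with z hz w u v using fderiv_formRep hcov he hz w u v
  -- The free predicate is analyticity of the form, so form and exponential map are analytic on all
  -- of `N`, not just near its centre.
  obtain ⟨N, hN⟩ := exists_analytic_normalNhd (cov := cov) he hx hΓ hform.eventually_analyticAt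
  have hdom : ∀ v ∈ N.source, v ∈ normalDomain N e := fun v hv ↦ ⟨hv, (hN v hv).1⟩
  refine ⟨N, (symmetry_preserves_iff Ω N).2 fun v hv Y Z ↦ ?_⟩
  -- The admissible times on the line through `v`: connected because the domain is star-shaped,
  -- symmetric about `0`, and containing `1`.
  set J : Set ℝ := {t | t • v ∈ N.source} with hJdef
  have hJ : IsPreconnected J := by
    have h1 : StarConvex ℝ (LinearMap.toSpanSingleton ℝ E v 0) N.source := by
      rw [map_zero]; exact N.starConvex
    have h2 := h1.linear_preimage (LinearMap.toSpanSingleton ℝ E v)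
    exact (h2.isPathConnected (a := 0) (by simpa using N.zero_mem)).isConnected.isPreconnected
  have h0 : (0 : ℝ) ∈ J := by rw [hJdef, mem_ofPred_eq, zero_smul]; exact N.zero_mem
  have h1 : (1 : ℝ) ∈ J := by rwa [hJdef, mem_ofPred_eq, one_smul]
  have hneg : ∀ t ∈ J, -t ∈ J := fun t ht ↦ by
    rw [hJdef, mem_ofPred_eq, neg_smul]; exact N.neg_mem _ ht
  have hφ : AnalyticOnNhd ℝ (radialForm Ω N e v Y Z) J := by
    intro t ht
    have hl : AnalyticAt ℝ (fun t : ℝ ↦ t • v) t := analyticAt_id.smul analyticAt_const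
    obtain ⟨-, h2, h3⟩ := hN _ ht
    have h4 : ContDiffAt ℝ ω (fun t : ℝ ↦ formRep Ω e (normalRep N e (t • v))) t :=
      (AnalyticAt.comp (g := formRep Ω e) h3 (f := fun t : ℝ ↦ normalRep N e (t • v))
        (AnalyticAt.comp (g := normalRep N e) (f := fun t : ℝ ↦ t • v) h2 hl)).contDiffAt
    have h5 : ∀ Y : E, ContDiffAt ℝ ω (fun t : ℝ ↦ t • fderiv ℝ (normalRep N e) (t • v) Y) t :=
      fun Y ↦ contDiffAt_id.smul ((AnalyticAt.comp (g := fderiv ℝ (normalRep N e))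
        (f := fun t : ℝ ↦ t • v) h2.fderiv hl).contDiffAt.clm_apply contDiffAt_const)
    exact ((h4.clm_apply (h5 Y)).clm_apply (h5 Z) : ContDiffAt ℝ ω _ t).analyticAt
  have hodd : ∀ n, Odd n → iteratedDeriv n (radialForm Ω N e v Y Z) 0 = 0 := by
    intro n hn
    obtain ⟨γ, a, b, ha, hb, hγ, hi, -⟩ := N.exists_geodesic hv
    -- `ConditionP` asks for a geodesic on a symmetric interval, so the domain is cut down.
    have hε : 0 < min (-a) b := lt_min (by linarith) (by linarith)
    have hγε : IsGeodesicOn cov γ (Ioo (-min (-a) b) (min (-a) b)) :=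
      hγ.mono isOpen_Ioo (Ioo_subset_Ioo (by linarith [min_le_left (-a) b]) (min_le_right _ _))
    have h0ε : (0 : ℝ) ∈ Ioo (-min (-a) b) (min (-a) b) := ⟨by linarith, hε⟩
    by_cases hn5 : n = 1 ∨ n = 3
    · exact iteratedDeriv_radialForm_low hcov N he hx h0ε hγε hi Y Z hn5
    -- Every odd order other than 1 and 3 is `r + 2` with `r ≥ 3` odd.
    · obtain ⟨k, rfl⟩ := hn
      obtain ⟨m, rfl⟩ : ∃ m, k = m + 2 := ⟨k - 2, by omega⟩
      exact (fieldP_mem_iff_iteratedDeriv hcov N he hx h0ε hγε hi (r := 2 * m + 3)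
        ⟨m + 1, by ring⟩ (by omega)).1 (hP _ ⟨m + 1, by ring⟩ (by omega) _ γ _ hε hγε hi) Y Z
  -- At `t = 1` the factor `t²` is `1`, so evenness compares the pulled-back form at `v` and `-v`.
  have heven := even_of_odd_iteratedDeriv hJ hneg h0 hφ hodd h1
  rw [radialForm_eq N he v Y Z (hdom _ h1), radialForm_eq N he v Y Z (hdom _ (hneg 1 h1)),
    neg_smul, one_smul, neg_sq, one_pow, one_mul, one_mul] at heven
  exact heven

end NormalNeighbourhoods

end Fedosov

end

theorem theorem1p1 {E : Type*} [NormedAddCommGroup E] [NormedSpace ℝ E] [FiniteDimensional ℝ E]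
    {M : Type*} [TopologicalSpace M] [T2Space M] [ChartedSpace E M] [IsManifold 𝓘(ℝ, E) ∞ M]
    (Ω : Fedosov.SymplecticForm E M) (cov : Fedosov.Connection E M)
    [CovariantDerivative.ContMDiffCovariantDerivative cov ∞]
    (hcov : Fedosov.IsSymplecticConnection Ω cov) :
    (∀ x : M, Fedosov.SymmetryPreserves Ω cov x →
      ∀ r : ℕ, Odd r → 3 ≤ r → Fedosov.ConditionP Ω cov r x) ∧
    (∀ x : M, Fedosov.IsAnalyticAt cov x →
      (∀ r : ℕ, Odd r → 3 ≤ r → Fedosov.ConditionP Ω cov r x) →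
        Fedosov.SymmetryPreserves Ω cov x) := by
  exact ⟨fun x h r hr hr3 ↦ Fedosov.conditionP_of_symmetryPreserves hcov h hr hr3,
    fun x han hP ↦ Fedosov.symmetryPreserves_of_conditionP hcov han hP⟩
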